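/- \textbf{Theorem 4.} Let $b$, $t$, $\beta$ be integers with $1 \le t < b$. Floating-point numbers are the numbers $m 2^e$ with $m, e \in \mathbb{Z}$, $|m| < 2^b$ (precision $b$, no overflow or underflow). Write $\mathrm{RN}$ for rounding to nearest (ties to even), $\mathrm{ulp}(a) = 2^{\lfloor \log_2 |a| \rfloor - b + 1}$ for $a \neq 0$, $\mathrm{ulp}(0) = 0$, and $\varepsilon = 2^{1-b}$ for the machine precision. A floating-point expansion (FPE) with $t$ terms is a list $x_1, \dots, x_t$ of floating-point numbers, with value $\sum_i x_i$; it is ulp-nonoverlapping if $|x_{i}| \le \mathrm{ulp}(x_{i-1})$ for $2 \le i \le t$. Expansions are added, multiplied and divided by the following routines, in which every operation is rounded by $\mathrm{RN}$; here $\mathrm{2Sum}(a,a')=(s,e)$ denotes the six-operation algorithm with $s=\mathrm{RN}(a+a')$ and error term $e$, $\mathrm{Fast2Sum}(a,a') = (s,\mathrm{RN}(a'-\mathrm{RN}(s-a)))$, and $\mathrm{2Prod}(a,a') = (\pi,\mathrm{RN}(aa'-\pi))$ with $\pi=\mathrm{RN}(aa')$. \begin{itemize} \item \emph{Renormalization}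 to $r$ terms: VecSum (a chain of 2Sums from the last entry of the list to the first, keeping the errors) followed by VecSumErrBranch (a chain of 2Sums from the first entry on, which emits a term whenever the error is nonzero, at most $r$ terms). \item \emph{Addition}: merge the terms of both expansions in order of decreasing absolute value and renormalize. \item \emph{Multiplication} with bin size $\beta$: partial products are accumulated by Fast2Sums into bins whose starting values are $1.5 \cdot 2^{T - (k+1)\beta + b - 1}$, $k = 0, 1, \dots$, where $T$ is the sum of the exponents of the leading terms; the products $x_i y_j$ with $i+j \le r+1$ are formed by 2Prod, those with $i+j=r+2$ are rounded products without error term; at the end the starting values are subtracted and VecSumErrBranch is applied to the first $\lfloor rb/\beta \rfloor + 2$ bins. \item \emph{Reciprocal}: the Newton iteration $\rho \leftarrow \rho \cdot (2 - \rho x)$ in expansion arithmetic, started at $\mathrm{RN}(1/x_1)$, with $q$ steps for $2^q$ terms. \emph{Division}: multiplication by the reciprocal of the divisor, where $2^q$ is the number of terms of the divisor rounded up to a power of two. \end{itemize} The bin size is assumed to leave at least one bit for carries and to exceed the number $b - \beta - 1$ of these bits by at least $5$: $\beta + 2 \le b$ and $b + 4 \le 2\beta$ (e.g. $\beta = 45$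 for $b = 53$). Let $L$ be a floating-point logarithm with $|L(v) - \log v| \le \eta$ for all floating-point numbers $v \in [1/2,\, 4\varepsilon^{-(t-1)}]$. The FPE $\tanh^{-1}$ routine returns, for an expansion $x$ (the symbol $x$ also denotes its value) and $f = |x|$: NaN if $f > 1$; $\infty$ if $f = 1$; and otherwise $\tfrac12\,\mathrm{sign}(x)\, L(\tilde z_1)$, where $\tilde z_1$ is the leading term of the expansion $\tilde z$ obtained by evaluating $$1 + 2f + \frac{2f\cdot f}{1-f} \ \text{ if } f < \tfrac12, \qquad 1 + \frac{2f}{1-f} \ \text{ if } f \ge \tfrac12,$$ with these routines, with $t$ output terms in every addition, multiplication and division of the formula. Then for every ulp-nonoverlapping FPE $x$ with $t$ terms of precision $b$ and value in $[-1 + \varepsilon^{t-1},\, 1 - \varepsilon^{t-1}]$, the routine returns a real number $y$ with $$|y - \tanh^{-1}(x)| \le \varepsilon^*, \qquad \varepsilon^* = 4\varepsilon + \tfrac{\eta}{2}.$$ Moreover, if $|x| \ge \tfrac12$, then $\tilde z_1 > 0$ and replacing the logarithm by the logarithm of the leading term contributes an error of at most $4\varepsilon$: $$\bigl|\tfrac12\,\mathrm{sign}(x)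 \log \tilde z_1 - \tanh^{-1}(x)\bigr| \le 4\varepsilon .$$ -/

import Mathlib

noncomputable section

namespace FPE

/-! ## Binary floating-point numbers of precision `p` (no overflow or underflow) -/

/-- `x` is a binary floating-point number of precision `p`. -/
def IsFloat (p : ℕ) (x : ℝ) : Prop :=
  ∃ m e : ℤ, |m| < 2 ^ p ∧ x = (m : ℝ) * (2 : ℝ) ^ e

/-- `⌊log₂ |x|⌋` (with the value `0` at `x = 0`). -/
def expo (x : ℝ) : ℤ := Int.log 2 |x|

/-- The unit in the last place of a number of precision `p`, with `ulp 0 = 0`. -/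
def ulp (p : ℕ) (x : ℝ) : ℝ := if x = 0 then 0 else (2 : ℝ) ^ (expo x - p + 1)

/-- The machine precision, i.e. the distance from `1` to the next number of precision `p`. -/
def machEps (p : ℕ) : ℝ := (2 : ℝ) ^ (1 - (p : ℤ))

/-- A nearest integer, ties to even. -/
def roundEven (x : ℝ) : ℤ :=
  if Int.fract x < 1 / 2 then ⌊x⌋
  else if 1 / 2 < Int.fract x then ⌊x⌋ + 1
  else if Even ⌊x⌋ then ⌊x⌋ else ⌊x⌋ + 1

/-- `RN`: rounding to nearest, ties to even, to precision `p`. -/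
def rn (p : ℕ) (x : ℝ) : ℝ :=
  (roundEven (x / (2 : ℝ) ^ (expo x - p + 1)) : ℝ) * (2 : ℝ) ^ (expo x - p + 1)

/-! ## Floating-point expansions

An expansion is the list of its terms, the leading term first; its value is the sum of the list. -/

/-- The list `x` is an ulp-nonoverlapping expansion with `t` terms of precision `p`. -/
structure IsFPE (p t : ℕ) (x : List ℝ) : Prop where
  length_eq : x.length = t
  isFloat : ∀ a ∈ x, IsFloat p a
  nonoverlapping : x.IsChain (fun a a' => |a'| ≤ ulp p a)

/-- The leading term of an expansion. -/
def lead (x : List ℝ) : ℝ := x.headD 0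

/-- 2Sum. -/
def twoSum (p : ℕ) (x y : ℝ) : ℝ × ℝ :=
  let s := rn p (x + y)
  let x' := rn p (s - y)
  let y' := rn p (s - x')
  let dx := rn p (x - x')
  let dy := rn p (y - y')
  (s, rn p (dx + dy))

/-- Fast2Sum. -/
def fastTwoSum (p : ℕ) (x y : ℝ) : ℝ × ℝ :=
  let s := rn p (x + y)
  let z := rn p (s - x)
  (s, rn p (y - z))

/-- 2Prod: the rounded product and its (rounded) error, as computed with a fused multiply-add. -/
def twoProd (p : ℕ) (x y : ℝ) : ℝ × ℝ :=
  let s := rn p (x * y)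
  (s, rn p (x * y - s))

/-- VecSum: a chain of 2Sums that starts at the last entry of the list. -/
def vecSum (p : ℕ) : List ℝ → List ℝ
  | [] => []
  | a :: l =>
    match vecSum p l with
    | [] => [a]
    | s :: es => (twoSum p a s).1 :: (twoSum p a s).2 :: es

/-- The loop of VecSumErrBranch. The first argument is the number of output terms that are still to
be filled, the second one is the running error, the third one holds the entries still to be read. -/
def vecSumErrBranchLoop (p : ℕ) : ℕ → ℝ → List ℝ → List ℝ
  | 0, _, _ => []
  | _ + 1, err, [] => [err]
  | m + 1, err, e :: es =>
    if (twoSum p err e).2 = 0 then vecSumErrBranchLoop p (m + 1) (twoSum p err e).1 es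
    else (twoSum p err e).1 :: vecSumErrBranchLoop p m (twoSum p err e).2 es

/-- VecSumErrBranch with `m` output terms (filled up with zeros). -/
def vecSumErrBranch (p : ℕ) (e : List ℝ) (m : ℕ) : List ℝ :=
  let r := match e with
    | [] => []
    | e₁ :: es => vecSumErrBranchLoop p m e₁ es
  r ++ List.replicate (m - r.length) 0

/-- FPERenormalize. -/
def renormalize (p : ℕ) (x : List ℝ) (r : ℕ) : List ℝ :=
  vecSumErrBranch p (vecSum p x) r

/-- MergeFPEs: the terms of both expansions, sorted by absolute value, the largest one first. -/
def merge (x y : List ℝ) : List ℝ :=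
  (x ++ y).insertionSort (fun a a' => |a'| ≤ |a|)

/-- FPEAddition with `r` output terms. -/
def add (p : ℕ) (x y : List ℝ) (r : ℕ) : List ℝ :=
  renormalize p (merge x y) r

/-- Accumulate: add a partial product `v` and its error `e` to the bins `B`, starting at bin `sh`.
The bin size is `β`. -/
def accumulate (p β : ℕ) (B : ℕ → ℝ) (v e : ℝ) (sh : ℕ) (l : ℤ) : ℕ → ℝ :=
  let c : ℤ := (p : ℤ) - β - 1
  if l < β - 2 * c - 1 then
    let s₀ := fastTwoSum p (B sh) v
    let b₁ := rn p (B (sh + 1) + s₀.2)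
    let s₁ := fastTwoSum p b₁ e
    let b₂ := rn p (B (sh + 2) + s₁.2)
    Function.update (Function.update (Function.update B sh s₀.1) (sh + 1) s₁.1) (sh + 2) b₂
  else if l < β - c then
    let s₀ := fastTwoSum p (B sh) v
    let b₁ := rn p (B (sh + 1) + s₀.2)
    let s₁ := fastTwoSum p b₁ e
    let s₂ := fastTwoSum p (B (sh + 2)) s₁.2
    let b₃ := rn p (B (sh + 3) + s₂.2)
    Function.update (Function.update (Function.update (Function.update B
      sh s₀.1) (sh + 1) s₁.1) (sh + 2) s₂.1) (sh + 3) b₃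
  else
    let s₀ := fastTwoSum p (B sh) v
    let s₁ := fastTwoSum p (B (sh + 1)) s₀.2
    let b₂ := rn p (B (sh + 2) + s₁.2)
    let s₂ := fastTwoSum p b₂ e
    let b₃ := rn p (B (sh + 3) + s₂.2)
    Function.update (Function.update (Function.update (Function.update B
      sh s₀.1) (sh + 1) s₁.1) (sh + 2) s₂.1) (sh + 3) b₃

/-- Accumulate the partial product of the terms `a` and `a'`, given as `v` with error `e`; the bins
are aligned at the exponent `T`. -/
def accumulateProd (p β : ℕ) (T : ℤ) (B : ℕ → ℝ) (a a' v e : ℝ) : ℕ → ℝ :=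
  let d : ℤ := T - expo a - expo a'
  let sh : ℕ := (d / (β : ℤ)).toNat
  accumulate p β B v e sh (d - sh * β)

/-- The starting value of bin `k` (the bins are numbered from `0`). -/
def binInit (p β : ℕ) (T : ℤ) (k : ℕ) : ℝ :=
  3 / 2 * (2 : ℝ) ^ (T - ((k : ℤ) + 1) * β + p - 1)

/-- The bins after all partial products of `x` and `y` have been accumulated. With terms numbered
from `0`, the products `x i * y j` with `i + j < r` enter with their errors, and those with
`i + j = r` without. -/
def mulBins (p β : ℕ) (T : ℤ) (x y : List ℝ) (r : ℕ) : ℕ → ℝ :=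
  (List.range (min x.length (r + 1))).foldl
    (fun B i =>
      let J := min y.length (r - i)
      let B' := (List.range J).foldl
        (fun B j =>
          accumulateProd p β T B (x.getD i 0) (y.getD j 0)
            (twoProd p (x.getD i 0) (y.getD j 0)).1 (twoProd p (x.getD i 0) (y.getD j 0)).2) B
      if J < y.length then
        accumulateProd p β T B' (x.getD i 0) (y.getD J 0) (rn p (x.getD i 0 * y.getD J 0)) 0
      else B')
    (binInit p β T)

/-- FPEMultiplication with `r` output terms and bin size `β`. -/
def mul (p β : ℕ) (x y : List ℝ) (r : ℕ) : List ℝ :=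
  let T := expo (lead x) + expo (lead y)
  let B := mulBins p β T x y r
  vecSumErrBranch p
    ((List.range (r * p / β + 2)).map (fun k => rn p (B k - binInit p β T k))) r

/-- The Newton iteration of FPEReciprocal: the approximation of `1 / x` after `q` steps. -/
def reciprocalIter (p β : ℕ) (x : List ℝ) : ℕ → List ℝ
  | 0 => [rn p (1 / lead x)]
  | i + 1 =>
    let r := reciprocalIter p β x i
    let v := mul p β r x (2 ^ (i + 2))
    let w := renormalize p (v.map (fun a => -a) ++ [2]) (2 ^ (i + 2))
    mul p β r w (2 ^ (i + 2))

/-- FPEReciprocal with `2 ^ q` output terms. -/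
def reciprocal (p β : ℕ) (x : List ℝ) (q : ℕ) : List ℝ :=
  (reciprocalIter p β x q).take (2 ^ q)

/-- FPEDivision with `r` output terms. The reciprocal has as many terms as the divisor, rounded up
to a power of two. -/
def div (p β : ℕ) (x y : List ℝ) (r : ℕ) : List ℝ :=
  mul p β x (reciprocal p β y (Nat.clog 2 y.length)) r

/-- The negative of an expansion. -/
def neg (x : List ℝ) : List ℝ := x.map (fun a => -a)

/-- Twice an expansion. -/
def double (x : List ℝ) : List ℝ := x.map (fun a => 2 * a)

/-- The absolute value of an expansion. -/
def absE (x : List ℝ) : List ℝ := if x.sum < 0 then neg x else x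

/-- The expansion under the logarithm in the inverse hyperbolic tangent routine: with `f = |x|`,
it is `1 + 2 f + (2 f * f) / (1 - f)` if the value of `f` is less than `1 / 2` and
`1 + 2 f / (1 - f)` otherwise, in expansion arithmetic with as many terms as `x` has. -/
def artanhArg (p β : ℕ) (x : List ℝ) : List ℝ :=
  let t := x.length
  let f := absE x
  let d := add p [1] (neg f) t
  if |x.sum| < 1 / 2 then
    add p (add p [1] (double f) t) (div p β (mul p β (double f) f t) d t) t
  else
    add p [1] (div p β (double f) d t) t

/-- The inverse hyperbolic tangent routine. `L` is the floating-point logarithm, which is applied to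
the leading term of the expansion under the logarithm; `none` stands for NaN. -/
def artanh (L : ℝ → ℝ) (p β : ℕ) (x : List ℝ) : Option EReal :=
  if 1 < |x.sum| then none
  else if |x.sum| = 1 then some ⊤
  else some ((1 / 2 * Real.sign x.sum * L (lead (artanhArg p β x)) : ℝ) : EReal)

end FPE

end

/-!
Write `u = 2 ^ (-p)` for the unit roundoff (so the machine precision is `2 u`), `f = |x|` and
`z = (1 + f) / (1 - f)`. Since `artanh f = log z / 2`, a relative error of `15 u` in the leading
term of the expansion under the logarithm costs at most `8 u` in the result
(`abs_half_log_sub_le`). That `15 u` suffices is `lead_artanhArg_spec`; most of the work goes into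
keeping the constants of the intermediate steps small enough for it. For `t = 1` the range of `x`
is the point `0`, where the sign, and with it the result, is zero.

* *Expansions.* The routines do not return ulp-nonoverlapping expansions. What is
  propagated instead is `Shape`: the absolute sums of the terms from number `1`, `2`, `3`, `4` on,
  relative to the leading term and in units of `u`.
* *The difference `1 - f`.* Here the cancellation may be arbitrarily strong, so that absolute sums of
  the inputs are of no use. But VecSum is error-free, on an ulp-nonoverlapping expansion its outputs
  again decrease geometrically (`vecSum_chain`), and leading zeros are skipped
  (`vecSumErrBranch_chain`). Hence the computed difference has a relative error of only `0.1 u`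
  (`renormalize_cons_chain`).
* *Multiplication* (`mul_spec`). Fast2Sum is used without an ordering hypothesis, but its computed
  error differs from the true one by `O(u)` times the second argument, and what leaves a bin is at
  most `O(u)` times its contents. The starting value of bin `k` has the size
  `2 ^ (T - (k + 1) β + p)`, so that the remainders leaving it are about `2 ^ (-(k + 1) β)` times the
  leading product, plus `u` times what has been collected in it. The effect of each operation is
  recorded by `OpCost`, costs add up along the list of products (`foldl_opCost`), and for each
  product there are two bounds: one by its size, and one by the remainders. The bounds for the
  contents of the bins and those for the remainders depend on each other; `MulParams.Valid` lists the
  inequalities that make the numbers consistent, and `mulBins_spec` deduces the bounds from them. Only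
  the `O(t)` products that are large enough to be charged with the remainders matter for the later
  bins, each with `O(u ^ 2)`, so that it is enough that `t u` is small.
* *Reciprocal.* A step of the Newton iteration turns the relative error `e` into `e ^ 2 + O(u)`
  (`newton_step`); the expansion arithmetic limits the accuracy to a few units of `u`, whatever the
  number of terms. The bound `7 u` reproduces itself, and the last step gives `5.9 u`
  (`reciprocal_spec`). The last step works with more terms than there are in the steps before, which
  is why it has bounds of its own.
* *The final sums* have no cancellation. Each error of a 2Sum is at most the smaller of a summand and
  `u` times the total, so that the errors of VecSum are bounded by a sum of capped absolute values
  (`capSum`), to which all but a few terms contribute almost nothing (`renormalize_spec`).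
-/

noncomputable section

namespace FPE

/-! ### The unit roundoff and exponents -/

/-- The unit roundoff `2 ^ (-p)`. -/
def uro (p : ℕ) : ℝ := (2 : ℝ) ^ (-(p : ℤ))

/-- `x` is an integral multiple of `2 ^ k`. -/
def IsMult (k : ℤ) (x : ℝ) : Prop := ∃ m : ℤ, x = (m : ℝ) * (2 : ℝ) ^ k

lemma uro_pos (p : ℕ) : 0 < uro p := by unfold uro; positivity

lemma two_zpow_pos (k : ℤ) : (0 : ℝ) < (2 : ℝ) ^ k := by positivity

lemma two_zpow_add (a b : ℤ) : (2 : ℝ) ^ (a + b) = 2 ^ a * 2 ^ b :=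
  zpow_add₀ two_ne_zero a b

lemma two_zpow_le {a b : ℤ} (h : a ≤ b) : (2 : ℝ) ^ a ≤ 2 ^ b :=
  zpow_le_zpow_right₀ one_le_two h

lemma two_zpow_lt {a b : ℤ} (h : a < b) : (2 : ℝ) ^ a < 2 ^ b :=
  zpow_lt_zpow_right₀ one_lt_two h

lemma zpow_expo_le {x : ℝ} (hx : x ≠ 0) : (2 : ℝ) ^ expo x ≤ |x| := by
  have := Int.zpow_log_le_self (b := 2) (R := ℝ) one_lt_two (abs_pos.2 hx)
  simpa [expo] using this

lemma lt_zpow_expo (x : ℝ) : |x| < (2 : ℝ) ^ (expo x + 1) := by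
  have := Int.lt_zpow_succ_log_self (b := 2) (R := ℝ) one_lt_two |x|
  simpa [expo] using this

lemma expo_lt {x : ℝ} {k : ℤ} (hx : x ≠ 0) (h : |x| < 2 ^ k) : expo x < k := by
  by_contra hk
  push Not at hk
  exact absurd (lt_of_le_of_lt ((two_zpow_le hk).trans (zpow_expo_le hx)) h) (lt_irrefl _)

lemma le_expo {x : ℝ} {k : ℤ} (h : 2 ^ k ≤ |x|) : k ≤ expo x := by
  by_contra hk
  push Not at hk
  have := two_zpow_le (show expo x + 1 ≤ k by lia)
  exact absurd (lt_of_lt_of_le (lt_zpow_expo x) (this.trans h)) (lt_irrefl _)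

lemma expo_neg (x : ℝ) : expo (-x) = expo x := by simp [expo]

lemma expo_two_zpow (k : ℤ) : expo ((2 : ℝ) ^ k) = k := by
  have h0 : |(2 : ℝ) ^ k| = 2 ^ k := abs_of_pos (two_zpow_pos k)
  apply le_antisymm
  · have := expo_lt (x := (2 : ℝ) ^ k) (k := k + 1) (two_zpow_pos k).ne'
      (by rw [h0]; exact two_zpow_lt (by lia))
    lia
  · exact le_expo h0.ge

/-! ### Multiples of powers of two -/

lemma IsMult.mono {j k : ℤ} {x : ℝ} (h : IsMult k x) (hjk : j ≤ k) : IsMult j x := by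
  obtain ⟨m, rfl⟩ := h
  obtain ⟨n, hn⟩ := Int.eq_ofNat_of_zero_le (sub_nonneg.2 hjk)
  refine ⟨m * 2 ^ n, ?_⟩
  have : k = n + j := by lia
  rw [this, two_zpow_add]
  push_cast
  rw [zpow_natCast]
  ring

lemma IsMult.add {k : ℤ} {x y : ℝ} (hx : IsMult k x) (hy : IsMult k y) : IsMult k (x + y) := by
  obtain ⟨m, rfl⟩ := hx
  obtain ⟨n, rfl⟩ := hy
  exact ⟨m + n, by push_cast; ring⟩

lemma IsMult.neg {k : ℤ} {x : ℝ} (hx : IsMult k x) : IsMult k (-x) := by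
  obtain ⟨m, rfl⟩ := hx
  exact ⟨-m, by push_cast; ring⟩

lemma IsMult.sub {k : ℤ} {x y : ℝ} (hx : IsMult k x) (hy : IsMult k y) : IsMult k (x - y) := by
  rw [sub_eq_add_neg]; exact hx.add hy.neg

lemma isMult_zero (k : ℤ) : IsMult k 0 := ⟨0, by simp⟩

lemma isMult_two_zpow {j k : ℤ} (h : j ≤ k) : IsMult j ((2 : ℝ) ^ k) :=
  IsMult.mono ⟨1, by simp⟩ h

lemma IsMult.le_abs {k : ℤ} {x : ℝ} (hx : IsMult k x) (h0 : x ≠ 0) : (2 : ℝ) ^ k ≤ |x| := by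
  obtain ⟨m, rfl⟩ := hx
  have hm : m ≠ 0 := by rintro rfl; simp at h0
  rw [abs_mul, abs_of_pos (two_zpow_pos k)]
  have : (1 : ℝ) ≤ |(m : ℝ)| := by exact_mod_cast Int.one_le_abs hm
  nlinarith [two_zpow_pos k]

/-- A multiple of `2 ^ k` of absolute value less than `2 ^ n` stays away from `2 ^ n`. -/
lemma IsMult.abs_le_sub {k n : ℤ} {x : ℝ} (hx : IsMult k x) (hkn : k ≤ n) (h : |x| < 2 ^ n) :
    |x| ≤ 2 ^ n - 2 ^ k := by
  have h1 : IsMult k (2 ^ n - |x|) := by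
    refine (isMult_two_zpow hkn).sub ?_
    rcases abs_choice x with h | h <;> rw [h]
    exacts [hx, hx.neg]
  have := h1.le_abs (by linarith)
  rw [abs_of_pos (by linarith)] at this
  linarith

lemma isFloat_of_isMult {p : ℕ} {k : ℤ} {x : ℝ} (hp : 1 ≤ p) (hx : IsMult k x)
    (h : |x| ≤ 2 ^ (k + p)) : IsFloat p x := by
  obtain ⟨m, rfl⟩ := hx
  have hm : |m| ≤ 2 ^ p := by
    rw [abs_mul, abs_of_pos (two_zpow_pos k), two_zpow_add, mul_comm] at h
    have := le_of_mul_le_mul_left h (two_zpow_pos k)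
    rw [zpow_natCast] at this
    exact_mod_cast this
  rcases hm.lt_or_eq with hm | hm
  · exact ⟨m, k, hm, rfl⟩
  · have h2 : (1 : ℤ) < 2 ^ p := by
      calc (1 : ℤ) < 2 ^ 1 := by norm_num
        _ ≤ 2 ^ p := pow_le_pow_right₀ (by norm_num) hp
    rcases (abs_eq (by positivity)).1 hm with hm | hm
    · refine ⟨1, k + p, by simpa using h2, ?_⟩
      rw [hm, two_zpow_add, zpow_natCast]; push_cast; ring
    · refine ⟨-1, k + p, by simpa using h2, ?_⟩
      rw [hm, two_zpow_add, zpow_natCast]; push_cast; ring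

/-- A floating-point number is a multiple of a power `2 ^ k` and smaller than `2 ^ (k + p)`. -/
lemma IsFloat.exists_isMult {p : ℕ} {x : ℝ} (hx : IsFloat p x) :
    ∃ k, IsMult k x ∧ |x| < 2 ^ (k + p) := by
  obtain ⟨m, e, hm, rfl⟩ := hx
  refine ⟨e, ⟨m, rfl⟩, ?_⟩
  rw [abs_mul, abs_of_pos (two_zpow_pos e), two_zpow_add, mul_comm]
  refine mul_lt_mul_of_pos_left ?_ (two_zpow_pos e)
  rw [zpow_natCast]
  exact_mod_cast hm

lemma IsFloat.isMult {p : ℕ} {k : ℤ} {x : ℝ} (hx : IsFloat p x) (h : 2 ^ k ≤ |x|) :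
    IsMult (k - p + 1) x := by
  obtain ⟨j, hj, hlt⟩ := hx.exists_isMult
  refine hj.mono ?_
  by_contra hc
  push Not at hc
  have := two_zpow_le (show j + p ≤ k by lia)
  linarith

lemma isFloat_zero (p : ℕ) : IsFloat p 0 := ⟨0, 0, by simp, by simp⟩

lemma IsFloat.neg {p : ℕ} {x : ℝ} (hx : IsFloat p x) : IsFloat p (-x) := by
  obtain ⟨m, e, hm, rfl⟩ := hx
  exact ⟨-m, e, by simpa using hm, by push_cast; ring⟩

lemma isFloat_two_zpow {p : ℕ} (hp : 1 ≤ p) (k : ℤ) : IsFloat p ((2 : ℝ) ^ k) :=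
  isFloat_of_isMult hp (isMult_two_zpow le_rfl)
    (by rw [abs_of_pos (two_zpow_pos k)]; exact two_zpow_le (by lia))

lemma IsFloat.two_mul {p : ℕ} {x : ℝ} (hx : IsFloat p x) : IsFloat p (2 * x) := by
  obtain ⟨m, e, hm, rfl⟩ := hx
  exact ⟨m, e + 1, hm, by rw [two_zpow_add]; simp; ring⟩

/-! ### Rounding to nearest -/

lemma abs_roundEven_sub_le (x : ℝ) : |(roundEven x : ℝ) - x| ≤ 1 / 2 := by
  have h0 := Int.fract_nonneg x
  have h1 := Int.fract_lt_one x
  have h : (⌊x⌋ : ℝ) = x - Int.fract x := by rw [Int.fract]; ring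
  unfold roundEven
  rw [abs_le]
  split_ifs <;> push_cast <;> rw [h] <;> constructor <;> linarith

lemma abs_roundEven_sub_le_int (x : ℝ) (n : ℤ) : |(roundEven x : ℝ) - x| ≤ |(n : ℝ) - x| := by
  rcases eq_or_ne n (roundEven x) with rfl | hn
  · exact le_rfl
  · have h1 : (1 : ℝ) ≤ |(n : ℝ) - roundEven x| := by
      exact_mod_cast Int.one_le_abs (sub_ne_zero.2 hn)
    have h2 := abs_roundEven_sub_le x
    have h3 : |(n : ℝ) - roundEven x| ≤ |(n : ℝ) - x| + |(roundEven x : ℝ) - x| := by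
      rw [abs_sub_comm (roundEven x : ℝ) x]; exact abs_sub_le _ _ _
    linarith

lemma rn_isMult (p : ℕ) (x : ℝ) : IsMult (expo x - p + 1) (rn p x) := ⟨_, rfl⟩

lemma rn_zero (p : ℕ) : rn p 0 = 0 := by simp [rn, roundEven]

lemma abs_rn_sub_le (p : ℕ) (x : ℝ) : |rn p x - x| ≤ 1 / 2 * 2 ^ (expo x - p + 1) := by
  have hg := two_zpow_pos (expo x - p + 1)
  have h := abs_roundEven_sub_le (x / (2 : ℝ) ^ (expo x - p + 1))
  have : rn p x - x = ((roundEven (x / (2 : ℝ) ^ (expo x - p + 1)) : ℝ)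
      - x / (2 : ℝ) ^ (expo x - p + 1)) * (2 : ℝ) ^ (expo x - p + 1) := by
    rw [sub_mul, div_mul_cancel₀ _ hg.ne', rn]
  rw [this, abs_mul, abs_of_pos hg]
  exact mul_le_mul_of_nonneg_right h hg.le

lemma half_ulp_eq (p : ℕ) (e : ℤ) : 1 / 2 * (2 : ℝ) ^ (e - p + 1) = uro p * 2 ^ e := by
  rw [two_zpow_add, sub_eq_add_neg, two_zpow_add, uro]; simp; ring

lemma abs_rn_sub_le_uro (p : ℕ) (x : ℝ) : |rn p x - x| ≤ uro p * |x| := by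
  rcases eq_or_ne x 0 with rfl | hx
  · simp [rn_zero]
  · refine (abs_rn_sub_le p x).trans ?_
    rw [half_ulp_eq]
    exact mul_le_mul_of_nonneg_left (zpow_expo_le hx) (uro_pos p).le

lemma abs_rn_sub_le_of_lt {p : ℕ} {x : ℝ} {k : ℤ} (h : |x| < 2 ^ (k + 1)) :
    |rn p x - x| ≤ uro p * 2 ^ k := by
  rcases eq_or_ne x 0 with rfl | hx
  · simp [rn_zero]; have := uro_pos p; positivity
  · refine (abs_rn_sub_le p x).trans ?_
    rw [half_ulp_eq]
    have := expo_lt hx h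
    exact mul_le_mul_of_nonneg_left (two_zpow_le (by lia)) (uro_pos p).le

lemma abs_rn_sub_le_isMult {p : ℕ} {x y : ℝ} (hy : IsMult (expo x - p + 1) y) :
    |rn p x - x| ≤ |y - x| := by
  obtain ⟨n, rfl⟩ := hy
  have hg := two_zpow_pos (expo x - p + 1)
  have h := abs_roundEven_sub_le_int (x / (2 : ℝ) ^ (expo x - p + 1)) n
  have h1 : rn p x - x = ((roundEven (x / (2 : ℝ) ^ (expo x - p + 1)) : ℝ)
      - x / (2 : ℝ) ^ (expo x - p + 1)) * (2 : ℝ) ^ (expo x - p + 1) := by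
    rw [sub_mul, div_mul_cancel₀ _ hg.ne', rn]
  have h2 : (n : ℝ) * (2 : ℝ) ^ (expo x - p + 1) - x = ((n : ℝ)
      - x / (2 : ℝ) ^ (expo x - p + 1)) * (2 : ℝ) ^ (expo x - p + 1) := by
    rw [sub_mul, div_mul_cancel₀ _ hg.ne']
  rw [h1, h2, abs_mul, abs_mul]
  exact mul_le_mul_of_nonneg_right h (abs_nonneg _)

/-- `rn` rounds to a nearest floating-point number. -/
lemma abs_rn_sub_le_float {p : ℕ} (hp : 1 ≤ p) (x : ℝ) {y : ℝ} (hy : IsFloat p y) :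
    |rn p x - x| ≤ |y - x| := by
  rcases eq_or_ne x 0 with rfl | hx
  · simp [rn_zero]
  rcases le_or_gt (2 ^ expo x) |y| with h | h
  · exact abs_rn_sub_le_isMult (hy.isMult h)
  · have hE : IsMult (expo x - p + 1) ((2 : ℝ) ^ expo x) := isMult_two_zpow (by lia)
    have hxE := zpow_expo_le hx
    have hy' := abs_lt.1 h
    rcases le_total 0 x with h0 | h0
    · refine (abs_rn_sub_le_isMult hE).trans ?_
      rw [abs_of_nonneg h0] at hxE
      rw [abs_of_nonpos (by linarith), abs_of_nonpos (by linarith)]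
      linarith
    · refine (abs_rn_sub_le_isMult hE.neg).trans ?_
      rw [abs_of_nonpos h0] at hxE
      rw [abs_of_nonneg (by linarith), abs_of_nonneg (by linarith)]
      linarith

lemma rn_of_isFloat {p : ℕ} (hp : 1 ≤ p) {x : ℝ} (hx : IsFloat p x) : rn p x = x := by
  have := abs_rn_sub_le_float hp x hx
  simp only [sub_self, abs_zero] at this
  exact sub_eq_zero.1 (abs_eq_zero.1 (le_antisymm this (abs_nonneg _)))

lemma isFloat_rn {p : ℕ} (hp : 1 ≤ p) (x : ℝ) : IsFloat p (rn p x) := by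
  refine isFloat_of_isMult hp (rn_isMult p x) ?_
  have h1 := abs_rn_sub_le_isMult (p := p) (x := x) (y := 0) (isMult_zero _)
  rcases eq_or_ne x 0 with rfl | hx
  · simp only [rn_zero, abs_zero]; positivity
  -- The upper end `2 ^ (expo x + 1)` of the binade is itself on the grid.
  have hE : IsMult (expo x - p + 1) ((2 : ℝ) ^ (expo x + 1)) := isMult_two_zpow (by lia)
  have hlt := lt_zpow_expo x
  rw [show expo x - p + 1 + p = expo x + 1 by ring]
  rcases le_total 0 x with h0 | h0
  · have h2 := abs_rn_sub_le_isMult hE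
    rw [abs_of_nonneg h0] at hlt
    rw [zero_sub, abs_neg, abs_of_nonneg h0] at h1
    rw [abs_of_nonneg (by linarith : 0 ≤ (2 : ℝ) ^ (expo x + 1) - x)] at h2
    rw [abs_le] at *
    constructor <;> linarith [h1.1, h1.2, h2.1, h2.2]
  · have h2 := abs_rn_sub_le_isMult hE.neg
    rw [abs_of_nonpos h0] at hlt
    rw [zero_sub, abs_neg, abs_of_nonpos h0] at h1
    rw [abs_of_nonpos (by linarith : -(2 : ℝ) ^ (expo x + 1) - x ≤ 0)] at h2
    rw [abs_le] at *
    constructor <;> linarith [h1.1, h1.2, h2.1, h2.2]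

lemma rn_le_of_le {p : ℕ} (hp : 1 ≤ p) {x y : ℝ} (hy : IsFloat p y) (h : x ≤ y) : rn p x ≤ y := by
  have := abs_rn_sub_le_float hp x hy
  rw [abs_of_nonneg (by linarith : 0 ≤ y - x)] at this
  linarith [(abs_le.1 this).2]

lemma le_rn_of_le {p : ℕ} (hp : 1 ≤ p) {x y : ℝ} (hy : IsFloat p y) (h : y ≤ x) : y ≤ rn p x := by
  have := abs_rn_sub_le_float hp x hy
  rw [abs_of_nonpos (by linarith : y - x ≤ 0)] at this
  linarith [(abs_le.1 this).1]

lemma IsFloat.abs {p : ℕ} {x : ℝ} (hx : IsFloat p x) : IsFloat p |x| := by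
  rcases abs_choice x with h | h <;> rw [h]
  exacts [hx, hx.neg]

lemma abs_rn_le_of_le {p : ℕ} (hp : 1 ≤ p) {x y : ℝ} (hy : IsFloat p y) (h : |x| ≤ y) :
    |rn p x| ≤ y := by
  rw [abs_le] at *
  exact ⟨le_rn_of_le hp hy.neg h.1, rn_le_of_le hp hy h.2⟩

lemma le_abs_rn_of_le {p : ℕ} (hp : 1 ≤ p) {x y : ℝ} (hy : IsFloat p y) (h : y ≤ |x|) :
    y ≤ |rn p x| := by
  rcases le_total 0 x with h0 | h0
  · rw [abs_of_nonneg h0] at h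
    exact (le_rn_of_le hp hy h).trans (le_abs_self _)
  · rw [abs_of_nonpos h0] at h
    have := rn_le_of_le hp hy.neg (show x ≤ -y by linarith)
    linarith [neg_abs_le (rn p x)]

lemma rn_eq_zero {p : ℕ} (hp : 1 ≤ p) {x : ℝ} (h : rn p x = 0) : x = 0 := by
  by_contra hx
  have := le_abs_rn_of_le hp (isFloat_two_zpow hp (expo x)) (zpow_expo_le hx)
  rw [h, abs_zero] at this
  linarith [two_zpow_pos (expo x)]

lemma abs_rn_le (p : ℕ) (x : ℝ) : |rn p x| ≤ (1 + uro p) * |x| := by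
  have h := abs_rn_sub_le_uro p x
  have := abs_sub_abs_le_abs_sub (rn p x) x
  linarith

lemma isFloat_of_isMult_lt {p : ℕ} {k : ℤ} {x : ℝ} (hp : 1 ≤ p) (hx : IsMult k x)
    (h : expo x - p + 1 ≤ k) : IsFloat p x := by
  refine isFloat_of_isMult hp hx ((lt_zpow_expo x).le.trans (two_zpow_le (by lia)))

lemma IsMult.rn {p : ℕ} {k : ℤ} {x : ℝ} (hp : 1 ≤ p) (hx : IsMult k x) : IsMult k (rn p x) := by
  rcases le_total (expo x - p + 1) k with h | h
  · rw [rn_of_isFloat hp (isFloat_of_isMult_lt hp hx h)]; exact hx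
  · exact (rn_isMult p x).mono h

/-! ### Error-free transformations -/

/-- The difference of two floating-point numbers is one if it is not larger than either of them. -/
lemma isFloat_of_small {p : ℕ} (hp : 1 ≤ p) {a b x : ℝ} (ha : IsFloat p a) (hb : IsFloat p b)
    (hx : ∀ k, IsMult k a → IsMult k b → IsMult k x) (h1 : |x| ≤ |a|) (h2 : |x| ≤ |b|) :
    IsFloat p x := by
  obtain ⟨i, hi, hai⟩ := ha.exists_isMult
  obtain ⟨j, hj, hbj⟩ := hb.exists_isMult
  rcases le_total i j with h | h
  · exact isFloat_of_isMult hp (hx i hi (hj.mono h)) (h1.trans hai.le)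
  · exact isFloat_of_isMult hp (hx j (hi.mono h) hj) (h2.trans hbj.le)

lemma isFloat_sub_of_le {p : ℕ} (hp : 1 ≤ p) {a b : ℝ} (ha : IsFloat p a) (hb : IsFloat p b)
    (h1 : |a - b| ≤ |a|) (h2 : |a - b| ≤ |b|) : IsFloat p (a - b) :=
  isFloat_of_small hp ha hb (fun _ h h' => h.sub h') h1 h2

lemma isFloat_add_of_le {p : ℕ} (hp : 1 ≤ p) {a b : ℝ} (ha : IsFloat p a) (hb : IsFloat p b)
    (h1 : |a + b| ≤ |a|) (h2 : |a + b| ≤ |b|) : IsFloat p (a + b) :=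
  isFloat_of_small hp ha hb (fun _ h h' => h.add h') h1 h2

lemma abs_add_sub_rn_le_left {p : ℕ} (hp : 1 ≤ p) {a : ℝ} (ha : IsFloat p a) (b : ℝ) :
    |a + b - rn p (a + b)| ≤ |b| := by
  have := abs_rn_sub_le_float hp (a + b) ha
  rw [abs_sub_comm]
  simpa using this

lemma abs_add_sub_rn_le_right {p : ℕ} (hp : 1 ≤ p) (a : ℝ) {b : ℝ} (hb : IsFloat p b) :
    |a + b - rn p (a + b)| ≤ |a| := by
  have := abs_rn_sub_le_float hp (a + b) hb
  rw [abs_sub_comm]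
  simpa using this

/-- The rounding error of a sum is a floating-point number. -/
lemma isFloat_add_err {p : ℕ} (hp : 1 ≤ p) {a b : ℝ} (ha : IsFloat p a) (hb : IsFloat p b) :
    IsFloat p (a + b - rn p (a + b)) :=
  isFloat_of_small hp ha hb (fun _ h h' => (h.add h').sub ((h.add h').rn hp))
    (abs_add_sub_rn_le_right hp a hb) (abs_add_sub_rn_le_left hp ha b)

/-- The exactness of the subtraction in Fast2Sum (Dekker). The hypothesis says that the exponent of
`b` is at most the exponent of some representation of `a`. -/
lemma isFloat_rn_add_sub {p : ℕ} (hp : 1 ≤ p) {k : ℤ} {a b : ℝ} (hk : IsMult k a)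
    (ha : |a| < 2 ^ (k + p)) (hb : IsFloat p b) (hbk : |b| < 2 ^ (k + p)) :
    IsFloat p (rn p (a + b) - a) := by
  by_cases hf : IsFloat p (a + b)
  · rw [rn_of_isFloat hp hf]; simpa using hb
  set x := a + b with hx
  set H := expo x - p + 1 with hH
  have hx0 : x ≠ 0 := by intro h; rw [h] at hf; exact hf (isFloat_zero p)
  have herr := abs_rn_sub_le p x
  have hHe : |rn p x - a| ≤ |b| + 1 / 2 * 2 ^ H := by
    have : rn p x - a = (rn p x - x) + b := by rw [hx]; ring
    rw [this]; linarith [abs_add_le (rn p x - x) b]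
  obtain ⟨k', hk', hbk'⟩ := hb.exists_isMult
  rcases le_or_gt H k with h | h
  · have hk'H : k' < H := by
      by_contra hc
      push Not at hc
      exact hf (isFloat_of_isMult_lt hp ((hk.mono h).add (hk'.mono hc)) le_rfl)
    refine isFloat_of_isMult (k := H) hp ((rn_isMult p x).sub (hk.mono h)) (hHe.trans ?_)
    have h1 : (2 : ℝ) ^ (k' + p) ≤ 2 ^ (H - 1 + p) := two_zpow_le (by lia)
    have h2 : (2 : ℝ) ^ (H + p) = 2 * 2 ^ (H - 1 + p) := by
      rw [show H + (p : ℤ) = 1 + (H - 1 + p) by ring, two_zpow_add]; norm_num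
    have h3 : (2 : ℝ) ^ H ≤ 2 ^ (H - 1 + p) := two_zpow_le (by lia)
    rw [h2]
    have h4 := hbk'.le.trans h1
    have h5 := two_zpow_pos H
    clear_value H
    generalize (2 : ℝ) ^ (H - 1 + p) = X at *
    linarith
  · have hlt : expo x < k + p + 1 := by
      refine expo_lt hx0 ((abs_add_le a b).trans_lt ?_)
      rw [two_zpow_add (k + p) 1]; norm_num; linarith
    have hHk : H = k + 1 := by lia
    refine isFloat_of_isMult hp (((rn_isMult p x).mono h.le).sub hk) (hHe.trans ?_)
    have h1 : 1 / 2 * (2 : ℝ) ^ H = 2 ^ k := by rw [hHk, two_zpow_add]; norm_num; ring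
    rw [h1]
    rcases le_total k k' with hc | hc
    · have := (hk'.mono hc).abs_le_sub (by lia) hbk
      linarith
    · rcases hc.lt_or_eq with hc | rfl
      · have h2 : (2 : ℝ) ^ (k' + p) ≤ 2 ^ (k - 1 + p) := two_zpow_le (by lia)
        have h3 : (2 : ℝ) ^ (k + p) = 2 * 2 ^ (k - 1 + p) := by
          rw [show k + (p : ℤ) = 1 + (k - 1 + p) by ring, two_zpow_add]; norm_num
        have h4 : (2 : ℝ) ^ k ≤ 2 ^ (k - 1 + p) := two_zpow_le (by lia)
        linarith
      · have := hk'.abs_le_sub (by lia) hbk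
        linarith

lemma isFloat_rn_add_sub_of_le {p : ℕ} (hp : 1 ≤ p) {a b : ℝ} (ha : IsFloat p a)
    (hb : IsFloat p b) (h : |b| ≤ |a|) : IsFloat p (rn p (a + b) - a) := by
  obtain ⟨k, hk, hlt⟩ := ha.exists_isMult
  exact isFloat_rn_add_sub hp hk hlt hb (h.trans_lt hlt)

@[simp] lemma twoSum_fst (p : ℕ) (a b : ℝ) : (twoSum p a b).1 = rn p (a + b) := rfl

lemma uro_le_inv_pow {p n : ℕ} (h : n ≤ p) : uro p ≤ 1 / 2 ^ n := by
  unfold uro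
  calc (2 : ℝ) ^ (-(p : ℤ)) ≤ 2 ^ (-(n : ℤ)) := two_zpow_le (by lia)
    _ = 1 / 2 ^ n := by rw [zpow_neg, zpow_natCast, one_div]

/-- 2Sum is error-free (Knuth). -/
lemma twoSum_snd {p : ℕ} (hp : 3 ≤ p) {a b : ℝ} (ha : IsFloat p a) (hb : IsFloat p b) :
    (twoSum p a b).2 = a + b - rn p (a + b) := by
  have hp1 : 1 ≤ p := by lia
  have herr := isFloat_add_err hp1 ha hb
  simp only [twoSum]
  set s := rn p (a + b) with hs
  have hsf : IsFloat p s := isFloat_rn hp1 _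
  rcases le_or_gt |a| |b| with h | h
  · have h1 : IsFloat p (s - b) := by
      have := isFloat_rn_add_sub_of_le hp1 hb ha h
      rwa [add_comm b a] at this
    rw [rn_of_isFloat hp1 h1, sub_sub_cancel, rn_of_isFloat hp1 hb, sub_self, rn_zero, add_zero,
      show a - (s - b) = a + b - s by ring, rn_of_isFloat hp1 herr, rn_of_isFloat hp1 herr]
  · by_cases hf : IsFloat p (a + b)
    · have hs' : s = a + b := rn_of_isFloat hp1 hf
      rw [hs', add_sub_cancel_right, rn_of_isFloat hp1 ha, add_sub_cancel_left,
        rn_of_isFloat hp1 hb]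
      simp [rn_zero]
    · have hbx : |b| < |a + b| := by
        by_contra hc
        push Not at hc
        exact hf (isFloat_add_of_le hp1 ha hb (hc.trans h.le) hc)
      have hbs : |-b| ≤ |s| := by
        rw [abs_neg]; exact le_abs_rn_of_le hp1 hb.abs hbx.le
      set x' := rn p (s - b) with hx'
      have hx'f : IsFloat p x' := isFloat_rn hp1 _
      have h1 : IsFloat p (s - x') := by
        have := (isFloat_rn_add_sub_of_le hp1 hsf hb.neg hbs).neg
        rwa [neg_sub, ← sub_eq_add_neg] at this
      have h2 : IsFloat p (b - (s - x')) := by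
        have := (isFloat_add_err hp1 hsf hb.neg).neg
        rw [← sub_eq_add_neg, ← hx'] at this
        rwa [show b - (s - x') = -(s - b - x') by ring]
      have h3 : |a - x'| ≤ 1 / 2 * |a| := by
        have e1 : |x' - (s - b)| ≤ |a - (s - b)| := abs_rn_sub_le_float hp1 _ ha
        have e2 : |a - (s - b)| ≤ uro p * |a + b| := by
          have := abs_rn_sub_le_uro p (a + b)
          rw [abs_sub_comm] at this
          rwa [show a - (s - b) = a + b - s by ring]
        have e3 : |a - x'| ≤ |a - (s - b)| + |x' - (s - b)| := by
          rw [abs_sub_comm x']; exact abs_sub_le _ _ _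
        have e4 : |a + b| ≤ 2 * |a| := by linarith [abs_add_le a b]
        have e5 : uro p ≤ 1 / 8 := (uro_le_inv_pow hp).trans (by norm_num)
        nlinarith [abs_nonneg a, abs_nonneg (a + b), uro_pos p]
      have h4 : IsFloat p (a - x') := by
        refine isFloat_sub_of_le hp1 ha hx'f (by linarith [abs_nonneg a]) ?_
        have := abs_sub_abs_le_abs_sub a x'
        linarith
      rw [rn_of_isFloat hp1 h1, rn_of_isFloat hp1 h2, rn_of_isFloat hp1 h4,
        show a - x' + (b - (s - x')) = a + b - s by ring, rn_of_isFloat hp1 herr]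

/-! ### Fast2Sum without an ordering hypothesis -/

lemma uro_le (p : ℕ) (hp : 8 ≤ p) : uro p ≤ 1 / 256 :=
  (uro_le_inv_pow hp).trans (by norm_num)

@[simp] lemma fastTwoSum_fst (p : ℕ) (a b : ℝ) : (fastTwoSum p a b).1 = rn p (a + b) := rfl

lemma fastTwoSum_snd (p : ℕ) (a b : ℝ) :
    (fastTwoSum p a b).2 = rn p (b - rn p (rn p (a + b) - a)) := rfl

/-- The computed error of Fast2Sum is close to the true one. -/
lemma abs_fastTwoSum_snd_sub_le {p : ℕ} (hp : 8 ≤ p) {a b : ℝ} (ha : IsFloat p a) :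
    |(fastTwoSum p a b).2 - (a + b - rn p (a + b))| ≤ 3.1 * uro p * |b| := by
  have hp1 : 1 ≤ p := by lia
  have hu := uro_le p hp
  have hu0 := uro_pos p
  rw [fastTwoSum_snd]
  set s := rn p (a + b)
  set z := rn p (s - a) with hz
  have h1 : |a + b - s| ≤ |b| := abs_add_sub_rn_le_left hp1 ha b
  have h2 : |s - a| ≤ 2 * |b| := by
    have : s - a = b - (a + b - s) := by ring
    rw [this]; linarith [abs_sub b (a + b - s)]
  have h3 : |z - (s - a)| ≤ uro p * (2 * |b|) :=
    (abs_rn_sub_le_uro p _).trans (mul_le_mul_of_nonneg_left h2 hu0.le)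
  have h4 : |b - z| ≤ |b| + uro p * (2 * |b|) := by
    have : b - z = (a + b - s) - (z - (s - a)) := by ring
    rw [this]; linarith [abs_sub (a + b - s) (z - (s - a))]
  have h5 : |rn p (b - z) - (b - z)| ≤ uro p * (|b| + uro p * (2 * |b|)) :=
    (abs_rn_sub_le_uro p _).trans (mul_le_mul_of_nonneg_left h4 hu0.le)
  have h6 : rn p (b - z) - (a + b - s) = (rn p (b - z) - (b - z)) - (z - (s - a)) := by ring
  rw [h6]
  have h7 := abs_sub (rn p (b - z) - (b - z)) (z - (s - a))
  have h8 : uro p * (uro p * (2 * |b|)) ≤ 1 / 256 * (uro p * (2 * |b|)) :=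
    mul_le_mul_of_nonneg_right hu (by positivity)
  have h9 : 0 ≤ uro p * |b| := by positivity
  linarith

lemma abs_fastTwoSum_snd_le {p : ℕ} (hp : 8 ≤ p) {a b : ℝ} (ha : IsFloat p a) :
    |(fastTwoSum p a b).2| ≤ 1.02 * |b| := by
  have h := abs_fastTwoSum_snd_sub_le hp (b := b) ha
  have h1 : |a + b - rn p (a + b)| ≤ |b| := abs_add_sub_rn_le_left (by lia) ha b
  have h2 := abs_sub_abs_le_abs_sub (fastTwoSum p a b).2 (a + b - rn p (a + b))
  have hu := mul_le_mul_of_nonneg_right (uro_le p hp) (abs_nonneg b)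
  linarith [abs_nonneg b]

lemma abs_fastTwoSum_snd_le_uro {p : ℕ} (hp : 8 ≤ p) {a b : ℝ} :
    |(fastTwoSum p a b).2| ≤ 1.01 * uro p * (|a| + 2 * |b|) := by
  have hu := uro_le p hp
  have hu0 := uro_pos p
  rw [fastTwoSum_snd]
  set s := rn p (a + b)
  set z := rn p (s - a) with hz
  have h0 := abs_add_le a b
  have h1 : |a + b - s| ≤ uro p * (|a| + |b|) := by
    rw [abs_sub_comm]
    exact (abs_rn_sub_le_uro p _).trans (mul_le_mul_of_nonneg_left h0 hu0.le)
  have h2 : |s - a| ≤ |b| + uro p * (|a| + |b|) := by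
    have : s - a = b - (a + b - s) := by ring
    rw [this]; linarith [abs_sub b (a + b - s)]
  have h3 : |z - (s - a)| ≤ uro p * (|b| + uro p * (|a| + |b|)) :=
    (abs_rn_sub_le_uro p _).trans (mul_le_mul_of_nonneg_left h2 hu0.le)
  have h4 : |b - z| ≤ uro p * (|a| + |b|) + uro p * (|b| + uro p * (|a| + |b|)) := by
    have : b - z = (a + b - s) - (z - (s - a)) := by ring
    rw [this]; linarith [abs_sub (a + b - s) (z - (s - a))]
  have h5 := abs_rn_le p (b - z)
  have h6 : (1 + uro p) * |b - z| ≤ (1 + 1 / 256) * |b - z| :=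
    mul_le_mul_of_nonneg_right (by linarith) (abs_nonneg _)
  have h8 : uro p * (uro p * (|a| + |b|)) ≤ 1 / 256 * (uro p * (|a| + |b|)) :=
    mul_le_mul_of_nonneg_right hu (by positivity)
  have h9 : 0 ≤ uro p * |b| := by positivity
  have h10 : 0 ≤ uro p * |a| := by positivity
  linarith

/-- Fast2Sum is error-free under Dekker's condition. -/
lemma fastTwoSum_snd_eq {p : ℕ} (hp : 1 ≤ p) {k : ℤ} {a b : ℝ} (hk : IsMult k a)
    (ha : |a| < 2 ^ (k + p)) (hb : IsFloat p b) (hbk : |b| < 2 ^ (k + p)) :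
    (fastTwoSum p a b).2 = a + b - rn p (a + b) := by
  have h := isFloat_rn_add_sub hp hk ha hb hbk
  have h2 := isFloat_add_err hp (isFloat_of_isMult hp hk ha.le) hb
  rw [fastTwoSum_snd, rn_of_isFloat hp h, show b - (rn p (a + b) - a) = a + b - rn p (a + b) by ring,
    rn_of_isFloat hp h2]

/-! ### Sums of absolute values -/

/-- The sum of the absolute values of the entries of a list. -/
def nrm (l : List ℝ) : ℝ := (l.map abs).sum

@[simp] lemma nrm_nil : nrm [] = 0 := by simp [nrm]

@[simp] lemma nrm_cons (a : ℝ) (l : List ℝ) : nrm (a :: l) = |a| + nrm l := by simp [nrm]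

@[simp] lemma nrm_append (l m : List ℝ) : nrm (l ++ m) = nrm l + nrm m := by simp [nrm]

lemma nrm_nonneg (l : List ℝ) : 0 ≤ nrm l := by
  induction l with
  | nil => simp
  | cons a l ih => rw [nrm_cons]; positivity

lemma abs_sum_le_nrm (l : List ℝ) : |l.sum| ≤ nrm l := by
  induction l with
  | nil => simp
  | cons a l ih => rw [nrm_cons, List.sum_cons]; linarith [abs_add_le a l.sum]

@[simp] lemma nrm_replicate_zero (n : ℕ) : nrm (List.replicate n 0) = 0 := by
  induction n with
  | zero => simp
  | succ n ih => simp [List.replicate_succ, ih]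

lemma nrm_take_add_drop (k : ℕ) (l : List ℝ) : nrm (l.take k) + nrm (l.drop k) = nrm l := by
  rw [← nrm_append, List.take_append_drop]

lemma nrm_drop_le (k : ℕ) (l : List ℝ) : nrm (l.drop k) ≤ nrm l := by
  linarith [nrm_take_add_drop k l, nrm_nonneg (l.take k)]

lemma nrm_drop_anti {j k : ℕ} (h : j ≤ k) (l : List ℝ) : nrm (l.drop k) ≤ nrm (l.drop j) := by
  obtain ⟨n, rfl⟩ := Nat.exists_eq_add_of_le h
  rw [← List.drop_drop]
  exact nrm_drop_le _ _

lemma nrm_map_neg (l : List ℝ) : nrm (l.map (fun a => -a)) = nrm l := by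
  induction l with
  | nil => simp
  | cons a l ih => simp [ih]

lemma nrm_perm {l m : List ℝ} (h : l.Perm m) : nrm l = nrm m := (h.map abs).sum_eq

/-! ### VecSumErrBranch -/

/-- The next output term of the loop of VecSumErrBranch. Either the list is used up, or the entries
of an initial segment `pre ++ [e]` are consumed, the sum over `pre` being exact. -/
lemma vecSumErrBranchLoop_succ {p : ℕ} (hp : 3 ≤ p) (m : ℕ) (es : List ℝ) (err : ℝ)
    (herr : IsFloat p err) (hes : ∀ a ∈ es, IsFloat p a) :
    (IsFloat p (err + es.sum) ∧ vecSumErrBranchLoop p (m + 1) err es = [err + es.sum]) ∨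
    ∃ pre e post, es = pre ++ e :: post ∧
      vecSumErrBranchLoop p (m + 1) err es =
        rn p (err + pre.sum + e) ::
          vecSumErrBranchLoop p m (err + pre.sum + e - rn p (err + pre.sum + e)) post ∧
      IsFloat p (err + pre.sum + e - rn p (err + pre.sum + e)) ∧
      |err + pre.sum + e - rn p (err + pre.sum + e)| ≤ |e| := by
  have hp1 : 1 ≤ p := by lia
  induction es generalizing err with
  | nil => left; simpa [vecSumErrBranchLoop] using herr
  | cons e es ih =>
    have he : IsFloat p e := hes e (by simp)
    have hes' : ∀ a ∈ es, IsFloat p a := fun a ha => hes a (by simp [ha])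
    rw [vecSumErrBranchLoop]
    split_ifs with h0
    · rw [twoSum_snd hp herr he] at h0
      have h1 : (twoSum p err e).1 = err + e := by rw [twoSum_fst]; linarith
      have h2 : IsFloat p (err + e) := by rw [← h1]; exact isFloat_rn hp1 _
      rw [h1]
      rcases ih (err + e) h2 hes' with ⟨hf, h⟩ | ⟨pre, e', post, hes, h⟩
      · left
        rw [List.sum_cons, ← add_assoc]
        exact ⟨hf, h⟩
      · right
        refine ⟨e :: pre, e', post, by simp [hes], ?_⟩
        rw [List.sum_cons, ← add_assoc err e]
        exact h
    · right
      refine ⟨[], e, es, by simp, ?_⟩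
      rw [twoSum_snd hp herr he]
      simp only [twoSum_fst, List.sum_nil, add_zero, true_and]
      exact ⟨isFloat_add_err hp1 herr he, abs_add_sub_rn_le_left hp1 herr e⟩

/-- The amplification `(1 + u) / (1 - u)` of absolute sums by VecSumErrBranch. -/
def amp (p : ℕ) : ℝ := (1 + uro p) / (1 - uro p)

lemma amp_pos {p : ℕ} (hp : 8 ≤ p) : 0 < amp p := by
  have := uro_le p hp
  have := uro_pos p
  unfold amp
  apply div_pos <;> linarith

lemma amp_le {p : ℕ} (hp : 8 ≤ p) : amp p ≤ 1.008 := by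
  have := uro_le p hp
  unfold amp
  rw [div_le_iff₀ (by linarith)]
  linarith

lemma amp_eq {p : ℕ} (hp : 8 ≤ p) : (1 + uro p) + amp p * uro p = amp p := by
  have := uro_le p hp
  unfold amp
  field_simp [show 1 - uro p ≠ 0 by linarith]
  ring

lemma one_le_amp {p : ℕ} (hp : 8 ≤ p) : 1 ≤ amp p := by
  have := uro_le p hp
  have := uro_pos p
  unfold amp
  rw [le_div_iff₀ (by linarith)]
  linarith

lemma abs_sub_rn_le (p : ℕ) (x : ℝ) : |x - rn p x| ≤ uro p * |x| := by
  rw [abs_sub_comm]; exact abs_rn_sub_le_uro p x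

lemma nrm_vecSumErrBranchLoop_le {p : ℕ} (hp : 8 ≤ p) (m : ℕ) (es : List ℝ) (err : ℝ)
    (herr : IsFloat p err) (hes : ∀ a ∈ es, IsFloat p a) :
    nrm (vecSumErrBranchLoop p m err es) ≤ amp p * (|err| + nrm es) := by
  have hA := amp_pos hp
  induction m generalizing err es with
  | zero =>
    rw [vecSumErrBranchLoop, nrm_nil]
    have := nrm_nonneg es
    positivity
  | succ m ih =>
    rcases vecSumErrBranchLoop_succ (by lia) m es err herr hes with
      ⟨-, h⟩ | ⟨pre, e, post, rfl, h, hf, -⟩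
    · rw [h, nrm_cons, nrm_nil, add_zero]
      have h1 := one_le_amp hp
      have h2 := abs_add_le err es.sum
      have h3 := abs_sum_le_nrm es
      have h4 := nrm_nonneg es
      have h5 := abs_nonneg err
      nlinarith
    · rw [h, nrm_cons]
      set q := err + pre.sum + e
      have h1 := ih post (q - rn p q) hf (fun a ha => hes a (by simp [ha]))
      have h2 := abs_rn_le p q
      have h3 := mul_le_mul_of_nonneg_left (abs_sub_rn_le p q) hA.le
      have h4 := amp_eq hp
      have h5 : |q| ≤ |err| + nrm pre + |e| := by
        have := abs_add_le (err + pre.sum) e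
        have := abs_add_le err pre.sum
        have := abs_sum_le_nrm pre
        linarith
      have h6 := mul_le_mul_of_nonneg_left h5 hA.le
      rw [nrm_append, nrm_cons]
      have h7 : (1 + uro p) * |q| + amp p * (uro p * |q|) = amp p * |q| := by
        rw [← mul_assoc, ← add_mul, h4]
      linarith

lemma isFloat_vecSumErrBranchLoop {p : ℕ} (hp : 3 ≤ p) (m : ℕ) (es : List ℝ) (err : ℝ)
    (herr : IsFloat p err) (hes : ∀ a ∈ es, IsFloat p a) :
    ∀ a ∈ vecSumErrBranchLoop p m err es, IsFloat p a := by
  induction m generalizing err es with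
  | zero => simp [vecSumErrBranchLoop]
  | succ m ih =>
    rcases vecSumErrBranchLoop_succ hp m es err herr hes with
      ⟨hf, h⟩ | ⟨pre, e, post, rfl, h, hf, -⟩
    · rw [h]; simpa using hf
    · rw [h]
      intro a ha
      rcases List.mem_cons.1 ha with rfl | ha
      · exact isFloat_rn (by lia) _
      · exact ih post _ hf (fun a ha => hes a (by simp [ha])) a ha

lemma length_vecSumErrBranchLoop_le (p m : ℕ) (es : List ℝ) (err : ℝ) :
    (vecSumErrBranchLoop p m err es).length ≤ m := by
  induction es generalizing err m with
  | nil => cases m <;> simp [vecSumErrBranchLoop]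
  | cons e es ih =>
    cases m with
    | zero => simp [vecSumErrBranchLoop]
    | succ m =>
      rw [vecSumErrBranchLoop]
      split_ifs
      · exact ih _ _
      · simpa using ih _ _

/-- Adding the head of a list to `x` does not increase the absolute sum. -/
lemma headD_drop_one_bound (l : List ℝ) (x : ℝ) :
    |x + l.headD 0| + nrm (l.drop 1) ≤ |x| + nrm l := by
  cases l with
  | nil => simp
  | cons a l => simpa [← add_assoc] using abs_add_le x a

/-- What one emission of VecSumErrBranch leaves over. -/
lemma emission_bounds {p : ℕ} (err e : ℝ) (pre post : List ℝ) :
    |err + pre.sum + e - rn p (err + pre.sum + e)| + nrm post ≤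
      uro p * (|err + (pre ++ e :: post).headD 0| + nrm ((pre ++ e :: post).drop 1))
        + nrm ((pre ++ e :: post).drop 1) := by
  set q := err + pre.sum + e with hq
  have hu0 := uro_pos p
  have hq1 : |q| + nrm post ≤ |err + (pre ++ e :: post).headD 0|
      + nrm ((pre ++ e :: post).drop 1) ∧ nrm post ≤ nrm ((pre ++ e :: post).drop 1) := by
    cases pre with
    | nil => simp [hq]
    | cons a pre =>
      simp only [List.cons_append, List.headD_cons, List.drop_succ_cons, List.drop_zero,
        nrm_append, nrm_cons]
      have h1 := abs_add_le (err + a) (pre.sum + e)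
      have h2 := abs_add_le pre.sum e
      have h3 := abs_sum_le_nrm pre
      have h9 : q = err + a + (pre.sum + e) := by rw [hq, List.sum_cons]; ring
      rw [h9]
      have := nrm_nonneg pre
      constructor <;> linarith [abs_nonneg e]
  have h1 := abs_sub_rn_le p q
  have h2 := nrm_nonneg post
  have h3 := mul_le_mul_of_nonneg_left
    (show |q| ≤ |err + (pre ++ e :: post).headD 0| + nrm ((pre ++ e :: post).drop 1) by
      linarith [hq1.1]) hu0.le
  linarith [hq1.2]

lemma nrm_drop_post_le (pre post : List ℝ) (e : ℝ) (k : ℕ) :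
    nrm (post.drop k) ≤ nrm ((pre ++ e :: post).drop (k + 1)) := by
  have : (pre ++ e :: post).drop (pre.length + 1 + k) = post.drop k := by
    rw [show pre.length + 1 + k = pre.length + (1 + k) by ring, List.drop_append]
    simp [List.drop_eq_nil_of_le, add_comm 1 k]
  rw [← this]
  exact nrm_drop_anti (by lia) _

/-- The main estimate for VecSumErrBranch. If `c k` bounds the entries from number `k` on, then
what remains after `k` output terms is at most `b k`, where `b (k + 1) = u * b k + c (k + 1)`. -/
lemma vecSumErrBranchLoop_bounds {p : ℕ} (hp : 8 ≤ p) (m : ℕ) (es : List ℝ) (err : ℝ)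
    (herr : IsFloat p err) (hes : ∀ a ∈ es, IsFloat p a) (c b : ℕ → ℝ)
    (hc : ∀ k, nrm (es.drop k) ≤ c k)
    (hb1 : uro p * (|err + es.headD 0| + c 1) + c 1 ≤ b 1)
    (hb : ∀ k, 1 ≤ k → uro p * b k + c (k + 1) ≤ b (k + 1)) :
    ∃ y rest, vecSumErrBranchLoop p (m + 1) err es = y :: rest ∧
      (∀ k, nrm (rest.drop k) ≤ amp p * b (k + 1)) ∧
      |err + es.sum - y| ≤ b 1 ∧ |err + es.sum - y| ≤ nrm es ∧
      |err + es.sum - (y + rest.sum)| ≤ b (m + 1) := by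
  have hu0 := uro_pos p
  have hA := amp_pos hp
  have hc0 : ∀ k, 0 ≤ c k := fun k => (nrm_nonneg _).trans (hc k)
  have hb0 : ∀ k, 0 ≤ b (k + 1) := by
    intro k
    induction k with
    | zero =>
      have := hc0 1
      have : 0 ≤ uro p * (|err + es.headD 0| + c 1) := by positivity
      simpa using (by linarith : 0 ≤ b 1)
    | succ k ih => have := hb (k + 1) (by lia); have := hc0 (k + 1 + 1); nlinarith
  induction m generalizing err es b c with
  | zero =>
    rcases vecSumErrBranchLoop_succ (by lia) 0 es err herr hes with
      ⟨-, h⟩ | ⟨pre, e, post, rfl, h, hf, hle⟩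
    · refine ⟨_, _, h, fun k => ?_, ?_, ?_, ?_⟩
      · simpa using mul_nonneg hA.le (hb0 k)
      · simpa using hb0 0
      · simpa using nrm_nonneg es
      · simpa using hb0 0
    · rw [vecSumErrBranchLoop] at h
      have hst := emission_bounds (p := p) err e pre post
      set q := err + pre.sum + e with hq
      have h2 : err + (pre ++ e :: post).sum - rn p q = (q - rn p q) + post.sum := by
        rw [hq]; simp; ring
      have h3 := abs_add_le (q - rn p q) post.sum
      have h4 := abs_sum_le_nrm post
      have h5 := mul_le_mul_of_nonneg_left (hc 1) hu0.le
      have h1 : |err + (pre ++ e :: post).sum - rn p q| ≤ b 1 := by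
        rw [h2]; linarith [hc 1]
      refine ⟨_, _, h, fun k => ?_, h1, ?_, ?_⟩
      · simpa using mul_nonneg hA.le (hb0 k)
      · rw [h2, nrm_append, nrm_cons]
        linarith [nrm_nonneg pre]
      · simpa using h1
  | succ m ih =>
    rcases vecSumErrBranchLoop_succ (by lia) (m + 1) es err herr hes with
      ⟨-, h⟩ | ⟨pre, e, post, rfl, h, hf, hle⟩
    · refine ⟨_, _, h, fun k => ?_, ?_, ?_, ?_⟩
      · simpa using mul_nonneg hA.le (hb0 k)
      · simpa using hb0 0
      · simpa using nrm_nonneg es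
      · simpa using hb0 (m + 1)
    · have hst := emission_bounds (p := p) err e pre post
      set q := err + pre.sum + e with hq
      have h2 : err + (pre ++ e :: post).sum - rn p q = (q - rn p q) + post.sum := by
        rw [hq]; simp; ring
      have h3 := abs_add_le (q - rn p q) post.sum
      have h4 := abs_sum_le_nrm post
      have h5 := mul_le_mul_of_nonneg_left (hc 1) hu0.le
      have hst' : |q - rn p q| + nrm post ≤ b 1 := by linarith [hc 1]
      have hpost : ∀ a ∈ post, IsFloat p a := fun a ha => hes a (by simp [ha])
      have hc' : ∀ k, nrm (post.drop k) ≤ c (k + 1) :=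
        fun k => (nrm_drop_post_le pre post e k).trans (hc (k + 1))
      have hhd := headD_drop_one_bound post (q - rn p q)
      have hn := nrm_vecSumErrBranchLoop_le hp (m + 1) post _ hf hpost
      obtain ⟨y, rest, hy, ht, -, -, hr⟩ := ih post (q - rn p q) hf hpost
        (fun k => nrm (post.drop k)) (fun k => b (k + 1)) (fun k => le_rfl)
        (by
          have := mul_le_mul_of_nonneg_left (hhd.trans hst') hu0.le
          linarith [hb 1 le_rfl, hc' 1])
        (fun k hk => by linarith [hb (k + 1) (by lia), hc' (k + 1)])
        (fun k => nrm_nonneg _) (fun k => hb0 (k + 1))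
      refine ⟨_, _, h, fun k => ?_, ?_, ?_, ?_⟩
      · rw [hy]
        cases k with
        | zero =>
          rw [← hy]
          exact hn.trans (mul_le_mul_of_nonneg_left hst' hA.le)
        | succ k => exact ht k
      · rw [h2]; linarith
      · rw [h2, nrm_append, nrm_cons]
        linarith [nrm_nonneg pre]
      · rw [hy, List.sum_cons, show err + (pre ++ e :: post).sum - (rn p q + (y + rest.sum))
          = q - rn p q + post.sum - (y + rest.sum) by rw [← h2]; ring]
        exact hr

lemma lead_cons (a : ℝ) (l : List ℝ) : lead (a :: l) = a := rfl

/-- The estimate of `vecSumErrBranchLoop_bounds` for the output filled up with zeros. -/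
lemma vecSumErrBranch_bounds {p : ℕ} (hp : 8 ≤ p) (m : ℕ) (es : List ℝ) (err : ℝ)
    (herr : IsFloat p err) (hes : ∀ a ∈ es, IsFloat p a) (c b : ℕ → ℝ)
    (hc : ∀ k, nrm (es.drop k) ≤ c k)
    (hb1 : uro p * (|err + es.headD 0| + c 1) + c 1 ≤ b 1)
    (hb : ∀ k, 1 ≤ k → uro p * b k + c (k + 1) ≤ b (k + 1)) :
    (∀ a ∈ vecSumErrBranch p (err :: es) (m + 1), IsFloat p a) ∧
      (∀ k, 1 ≤ k → nrm ((vecSumErrBranch p (err :: es) (m + 1)).drop k) ≤ amp p * b k) ∧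
      |err + es.sum - lead (vecSumErrBranch p (err :: es) (m + 1))| ≤ b 1 ∧
      |err + es.sum - lead (vecSumErrBranch p (err :: es) (m + 1))| ≤ nrm es ∧
      |err + es.sum - (vecSumErrBranch p (err :: es) (m + 1)).sum| ≤ b (m + 1) := by
  have hf := isFloat_vecSumErrBranchLoop (by lia : 3 ≤ p) (m + 1) es err herr hes
  obtain ⟨y, rest, h, h1, h2, h3, h4⟩ := vecSumErrBranchLoop_bounds hp m es err herr hes c b hc hb1 hb
  simp only [vecSumErrBranch]
  rw [h] at hf ⊢
  simp only [List.cons_append, lead_cons]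
  refine ⟨?_, ?_, h2, h3, ?_⟩
  · intro a ha
    rw [← List.cons_append, List.mem_append] at ha
    rcases ha with ha | ha
    · exact hf a ha
    · rw [List.eq_of_mem_replicate ha]; exact isFloat_zero p
  · intro k hk
    obtain ⟨k, rfl⟩ := Nat.exists_eq_add_of_le' hk
    refine le_trans ?_ (h1 k)
    rw [List.drop_succ_cons, List.drop_append, nrm_append]
    simp
  · simpa using h4

lemma length_vecSumErrBranch (p m : ℕ) (es : List ℝ) : (vecSumErrBranch p es m).length = m := by
  cases es with
  | nil => simp [vecSumErrBranch]
  | cons a es =>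
    have := length_vecSumErrBranchLoop_le p m es a
    simp only [vecSumErrBranch, List.length_append, List.length_replicate]
    lia

/-- A leading zero is skipped by the loop of VecSumErrBranch. -/
lemma vecSumErrBranchLoop_zero_cons {p : ℕ} (hp : 3 ≤ p) (m : ℕ) {e : ℝ} {es : List ℝ}
    (he : IsFloat p e) :
    vecSumErrBranchLoop p (m + 1) 0 (e :: es) = vecSumErrBranchLoop p (m + 1) e es := by
  rw [vecSumErrBranchLoop, twoSum_snd hp (isFloat_zero p) he, twoSum_fst, zero_add,
    rn_of_isFloat (by lia) he]
  simp

/-- Entries that are zero do not influence the loop of VecSumErrBranch. -/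
lemma vecSumErrBranchLoop_cons_zero {p : ℕ} (hp : 3 ≤ p) (m : ℕ) {e : ℝ} {es : List ℝ}
    (he : IsFloat p e) :
    vecSumErrBranchLoop p (m + 1) e (0 :: es) = vecSumErrBranchLoop p (m + 1) e es := by
  rw [vecSumErrBranchLoop, twoSum_snd hp he (isFloat_zero p), twoSum_fst, add_zero,
    rn_of_isFloat (by lia) he]
  simp

/-! ### VecSum -/

lemma vecSum_cons_of_eq {p : ℕ} (hp : 3 ≤ p) {a s : ℝ} {l es : List ℝ} (ha : IsFloat p a)
    (hs : IsFloat p s) (h : vecSum p l = s :: es) :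
    vecSum p (a :: l) = rn p (a + s) :: (a + s - rn p (a + s)) :: es := by
  rw [vecSum, h]
  simp [twoSum_snd hp ha hs]

/-- VecSum is error-free: the sum of the entries is kept. -/
lemma vecSum_spec {p : ℕ} (hp : 3 ≤ p) (a : ℝ) (l : List ℝ) (hf : ∀ x ∈ a :: l, IsFloat p x) :
    ∃ s es, vecSum p (a :: l) = s :: es ∧ (∀ x ∈ s :: es, IsFloat p x) ∧
      s + es.sum = a + l.sum ∧ es.length = l.length := by
  induction l generalizing a with
  | nil => exact ⟨a, [], by simp [vecSum], by simpa using hf, by simp, rfl⟩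
  | cons b l ih =>
    obtain ⟨s, es, h, hfl, hsum, hlen⟩ := ih b (fun x hx => hf x (List.mem_cons_of_mem _ hx))
    have ha : IsFloat p a := hf a (by simp)
    have hs : IsFloat p s := hfl s (by simp)
    refine ⟨_, _, vecSum_cons_of_eq hp ha hs h, ?_, ?_, by simp [hlen]⟩
    · intro x hx
      simp only [List.mem_cons] at hx
      rcases hx with rfl | rfl | hx
      · exact isFloat_rn (by lia) _
      · exact isFloat_add_err (by lia) ha hs
      · exact hfl x (by simp [hx])
    · simp only [List.sum_cons] at hsum ⊢
      linarith

/-! ### One accumulation step of the multiplication -/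

/-- The bounds for a Fast2Sum: the true error `δ`, the computed error `r`, their difference. -/
lemma fastTwoSum_step {p : ℕ} (hp : 8 ≤ p) {a v τ : ℝ} (ha : IsFloat p a)
    (hτ : 1.01 * uro p * (|a| + 2 * |v|) ≤ τ) :
    |a + v - rn p (a + v)| ≤ |v| ∧ |a + v - rn p (a + v)| ≤ τ ∧
      |(fastTwoSum p a v).2| ≤ 1.02 * |v| ∧ |(fastTwoSum p a v).2| ≤ τ ∧
      |(fastTwoSum p a v).2 - (a + v - rn p (a + v))| ≤ 3.1 * uro p * |v| := by
  have hu := uro_pos p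
  refine ⟨abs_add_sub_rn_le_left (by lia) ha v, le_trans ?_ hτ, abs_fastTwoSum_snd_le hp ha,
    (abs_fastTwoSum_snd_le_uro hp).trans hτ, abs_fastTwoSum_snd_sub_le hp ha⟩
  have h1 := abs_sub_rn_le p (a + v)
  have h2 := mul_le_mul_of_nonneg_left (abs_add_le a v) hu.le
  have h3 : 0 ≤ uro p * |a| := by positivity
  have h4 : 0 ≤ uro p * |v| := by positivity
  linarith

/-- The bounds for a rounded addition of a remainder `r` to a bin with contents `a`. -/
lemma rn_add_step {p : ℕ} (hp : 8 ≤ p) {a r A I τ : ℝ} (ha : IsFloat p a) (hA : |a| ≤ A)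
    (hI : |r| ≤ I) (hτ : 1.03 * uro p * (A + 2 * I) ≤ τ) :
    |a + r - rn p (a + r)| ≤ |r| ∧ |a + r - rn p (a + r)| ≤ τ ∧
      |rn p (a + r)| ≤ 1.01 * (A + I) := by
  have hu := uro_pos p
  have hu1 := uro_le p hp
  have h2 := abs_add_le a r
  refine ⟨abs_add_sub_rn_le_left (by lia) ha r, ?_, ?_⟩
  · have h1 := abs_sub_rn_le p (a + r)
    have h3 := mul_le_mul_of_nonneg_left (show |a + r| ≤ A + I by linarith) hu.le
    have h4 : 0 ≤ uro p * A := mul_nonneg hu.le ((abs_nonneg _).trans hA)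
    have h5 : 0 ≤ uro p * I := mul_nonneg hu.le ((abs_nonneg _).trans hI)
    linarith
  · have h1 := abs_rn_le p (a + r)
    have h3 := mul_le_mul_of_nonneg_right hu1 (abs_nonneg (a + r))
    linarith [abs_nonneg (a + r)]

/-- What is known about the changes `Δ i` of the bins number `sh + i` in one accumulation of a
product `v` with error `e`. The numbers `τ i` bound the remainders that leave the bins, and `ε i`
bounds `e` in case it enters bin `i` or a later one. -/
structure MoveBounds (v e : ℝ) (τ ε Δ : ℕ → ℝ) : Prop where
  triv : |Δ 0| + |Δ 1| + |Δ 2| + |Δ 3| ≤ 6.2 * (|v| + |e|)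
  triv_each : ∀ i < 4, |Δ i| ≤ 2.1 * (|v| + |e|)
  tail0 : |Δ 0| + |Δ 1| + |Δ 2| + |Δ 3| ≤ |v| + 5 * τ 0 + 6.2 * |e|
  tail1 : |Δ 1| + |Δ 2| + |Δ 3| ≤ τ 0 + 3 * τ 1 + 6.2 * ε 1
  tail2 : |Δ 2| + |Δ 3| ≤ τ 1 + 3 * τ 2 + 6.2 * ε 2
  tail3 : |Δ 3| ≤ τ 2 + 3 * τ 3 + 6.2 * ε 3
  zero : |Δ 0| ≤ |v| + τ 0
  one : |Δ 1| ≤ τ 0 + 2 * τ 1 + |e|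
  err_triv : |Δ 0 + Δ 1 + Δ 2 + Δ 3 - (v + e)| ≤ 1.1 * (|v| + |e|)

/-- The state of the bins before an accumulation at bin `sh`, with bounds. -/
structure BinBounds (p : ℕ) (B : ℕ → ℝ) (A inc ε τ : ℕ → ℝ) : Prop where
  isFloat : ∀ k, IsFloat p (B k)
  le : ∀ k, |B k| ≤ A k
  rem : ∀ k, 1.03 * uro p * (A k + 2 * inc k + 2 * ε k) ≤ τ k
  inc_le : ∀ k, τ k ≤ inc (k + 1)
  anti : ∀ k, τ (k + 1) ≤ τ k
  eps_nonneg : ∀ k, 0 ≤ ε k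
  inc_nonneg : ∀ k, 0 ≤ inc k

lemma BinBounds.step {p : ℕ} {B A inc ε τ : ℕ → ℝ} (h : BinBounds p B A inc ε τ)
    (k : ℕ) {v : ℝ} (hv : |v| ≤ inc k) : 1.01 * uro p * (|B k| + 2 * |v|) ≤ τ k := by
  have hu := uro_pos p
  refine le_trans ?_ (h.rem k)
  have h1 : |B k| + 2 * |v| ≤ A k + 2 * inc k + 2 * ε k := by
    linarith [h.le k, h.eps_nonneg k]
  have h2 := mul_le_mul_of_nonneg_left h1 hu.le
  have h3 : 0 ≤ uro p * (A k + 2 * inc k + 2 * ε k) :=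
    mul_nonneg hu.le (le_trans (by positivity) h1)
  linarith

lemma BinBounds.step_add {p : ℕ} (hp : 8 ≤ p) {B A inc ε τ : ℕ → ℝ} (h : BinBounds p B A inc ε τ)
    (k : ℕ) {r : ℝ} (hr : |r| ≤ inc k) :
    |B k + r - rn p (B k + r)| ≤ |r| ∧ |B k + r - rn p (B k + r)| ≤ τ k ∧
      |rn p (B k + r)| ≤ 1.01 * (A k + inc k) := by
  have hu := uro_pos p
  refine rn_add_step hp (h.isFloat k) (h.le k) hr (le_trans ?_ (h.rem k))
  have := mul_nonneg hu.le (h.eps_nonneg k)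
  linarith

lemma BinBounds.step_after {p : ℕ} {B A inc ε τ : ℕ → ℝ}
    (h : BinBounds p B A inc ε τ) (k : ℕ) {b e : ℝ} (hb : |b| ≤ 1.01 * (A k + inc k))
    (he : |e| ≤ ε k) : 1.01 * uro p * (|b| + 2 * |e|) ≤ τ k := by
  have hu := uro_pos p
  refine le_trans ?_ (h.rem k)
  have h1 := mul_le_mul_of_nonneg_left (show |b| + 2 * |e| ≤ 1.01 * (A k + inc k) + 2 * ε k by
    linarith) hu.le
  have h2 : 0 ≤ uro p * A k := mul_nonneg hu.le ((abs_nonneg _).trans (h.le k))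
  have h3 := mul_nonneg hu.le (h.inc_nonneg k)
  have h4 := mul_nonneg hu.le (h.eps_nonneg k)
  linarith

/-- What is lost in an accumulation that adds `e` to bin `sh + 1`: at most `ρ`, the defect of the
Fast2Sum with the product itself, up to small remainders. -/
def MoveErr (p : ℕ) (v e ρ : ℝ) (τ Δ : ℕ → ℝ) : Prop :=
  |Δ 0 + Δ 1 + Δ 2 + Δ 3 - (v + e)| ≤ ρ + τ 1 + τ 2 + 6.4 * uro p * |e|

set_option maxHeartbeats 1000000 in
/-- The first branch of the accumulation: the error `e` enters bin `sh + 1`, and the remainders end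
in bin `sh + 2`. -/
lemma accumulate_first {p : ℕ} (hp : 8 ≤ p) {B A inc ε τ : ℕ → ℝ} (h : BinBounds p B A inc ε τ)
    (sh : ℕ) {v e : ℝ} (hv1 : |v| ≤ inc sh)
    (he1 : |e| ≤ ε (sh + 1)) :
    let s₀ := fastTwoSum p (B sh) v
    let b₁ := rn p (B (sh + 1) + s₀.2)
    let s₁ := fastTwoSum p b₁ e
    let b₂ := rn p (B (sh + 2) + s₁.2)
    let Δ : ℕ → ℝ := fun i => if i = 0 then s₀.1 - B sh else if i = 1 then s₁.1 - B (sh + 1) else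
      if i = 2 then b₂ - B (sh + 2) else 0
    MoveBounds v e (fun i => τ (sh + i)) (fun i => ε (sh + i)) Δ ∧
    MoveErr p v e |(fastTwoSum p (B sh) v).2 - (B sh + v - rn p (B sh + v))|
      (fun i => τ (sh + i)) Δ := by
  intro s₀ b₁ s₁ b₂ Δ
  have hu := uro_pos p
  have hu1 := uro_le p hp
  have hp1 : 1 ≤ p := by lia
  obtain ⟨a1, a2, a3, a4, a5⟩ := fastTwoSum_step hp (h.isFloat sh) (h.step sh hv1)
  obtain ⟨c1, c2, c3⟩ := h.step_add hp (sh + 1) (a4.trans (h.inc_le sh))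
  obtain ⟨d1, d2, d3, d4, d5⟩ := fastTwoSum_step hp (isFloat_rn hp1 (B (sh + 1) + s₀.2))
    (h.step_after (sh + 1) c3 he1)
  obtain ⟨f1, f2, f3⟩ := h.step_add hp (sh + 2) (d4.trans (h.inc_le (sh + 1)))
  set r₀ := (fastTwoSum p (B sh) v).2 with hr0
  set δ₀ := B sh + v - rn p (B sh + v) with hδ0
  set e₁ := B (sh + 1) + r₀ - rn p (B (sh + 1) + r₀) with he1'
  set δ₁ := b₁ + e - rn p (b₁ + e) with hδ1
  set r₁ := (fastTwoSum p b₁ e).2 with hr1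
  set e₂ := B (sh + 2) + r₁ - rn p (B (sh + 2) + r₁) with he2'
  have D0 : Δ 0 = v - δ₀ := by simp [Δ, s₀, hδ0]; ring
  have D1 : Δ 1 = r₀ - e₁ + e - δ₁ := by simp [Δ, s₀, s₁, hδ1, he1', b₁, hr0]; ring
  have D2 : Δ 2 = r₁ - e₂ := by simp [Δ, s₁, he2', b₂, hr1]; ring
  have D3 : Δ 3 = 0 := by simp [Δ]
  have n0 : |Δ 0| ≤ |v| + |δ₀| := by rw [D0]; exact abs_sub _ _
  have n1 : |Δ 1| ≤ |r₀| + |e₁| + |e| + |δ₁| := by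
    rw [D1]
    linarith [abs_sub (r₀ - e₁ + e) δ₁, abs_add_le (r₀ - e₁) e, abs_sub r₀ e₁]
  have n2 : |Δ 2| ≤ |r₁| + |e₂| := by rw [D2]; exact abs_sub _ _
  have n3 : |Δ 3| = 0 := by rw [D3, abs_zero]
  have n4 : |Δ 0 + Δ 1 + Δ 2 + Δ 3 - (v + e)| ≤ |r₀ - δ₀| + |e₁| + |r₁ - δ₁| + |e₂| := by
    rw [D0, D1, D2, D3, show v - δ₀ + (r₀ - e₁ + e - δ₁) + (r₁ - e₂) + 0 - (v + e) =
      (r₀ - δ₀) - e₁ + (r₁ - δ₁) - e₂ by ring]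
    linarith [abs_sub ((r₀ - δ₀) - e₁ + (r₁ - δ₁)) e₂, abs_add_le ((r₀ - δ₀) - e₁) (r₁ - δ₁),
      abs_sub (r₀ - δ₀) e₁]
  have t1 := h.anti sh
  have t2 := h.anti (sh + 1)
  have t3 := h.anti (sh + 2)
  have g1 := h.eps_nonneg (sh + 1)
  have g2 := h.eps_nonneg (sh + 2)
  have g3 := h.eps_nonneg (sh + 3)
  have p0 := abs_nonneg v
  have p1 := abs_nonneg e
  have p2 := abs_nonneg δ₁
  have p3 := abs_nonneg e₂
  have q1 := mul_le_mul_of_nonneg_right hu1 p0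
  have q2 := mul_le_mul_of_nonneg_right hu1 p1
  have q3 := mul_nonneg hu.le p1
  have t4 : 0 ≤ τ (sh + 2 + 1) := le_trans (by
    have := (abs_nonneg _).trans (h.le (sh + 2 + 1))
    have := h.inc_nonneg (sh + 2 + 1)
    have := h.eps_nonneg (sh + 2 + 1)
    positivity) (h.rem (sh + 2 + 1))
  clear_value Δ δ₀ e₁ δ₁ r₁ e₂ r₀
  refine ⟨⟨?_, ?_, ?_, ?_, ?_, ?_, ?_, ?_, ?_⟩, ?_⟩
  · linarith
  · intro i hi
    interval_cases i <;> linarith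
  · simp only [add_zero]; linarith
  · simp only [add_zero]; linarith
  · linarith
  · have t3' : τ (sh + 3) ≤ τ (sh + 2) := t3
    have t4' : 0 ≤ τ (sh + 3) := t4
    linarith
  · simp only [add_zero]; linarith
  · simp only [add_zero]; linarith
  · linarith
  · unfold MoveErr; linarith

set_option maxHeartbeats 1000000 in
/-- The second branch of the accumulation: the error `e` enters bin `sh + 1`, and the remainders end
in bin `sh + 3`. -/
lemma accumulate_second {p : ℕ} (hp : 8 ≤ p) {B A inc ε τ : ℕ → ℝ} (h : BinBounds p B A inc ε τ)
    (sh : ℕ) {v e : ℝ} (hv1 : |v| ≤ inc sh)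
    (he1 : |e| ≤ ε (sh + 1)) :
    let s₀ := fastTwoSum p (B sh) v
    let b₁ := rn p (B (sh + 1) + s₀.2)
    let s₁ := fastTwoSum p b₁ e
    let s₂ := fastTwoSum p (B (sh + 2)) s₁.2
    let b₃ := rn p (B (sh + 3) + s₂.2)
    let Δ : ℕ → ℝ := fun i => if i = 0 then s₀.1 - B sh else if i = 1 then s₁.1 - B (sh + 1) else
      if i = 2 then s₂.1 - B (sh + 2) else b₃ - B (sh + 3)
    MoveBounds v e (fun i => τ (sh + i)) (fun i => ε (sh + i)) Δ ∧
    MoveErr p v e |(fastTwoSum p (B sh) v).2 - (B sh + v - rn p (B sh + v))|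
      (fun i => τ (sh + i)) Δ := by
  intro s₀ b₁ s₁ s₂ b₃ Δ
  have hu := uro_pos p
  have hu1 := uro_le p hp
  have hp1 : 1 ≤ p := by lia
  obtain ⟨a1, a2, a3, a4, a5⟩ := fastTwoSum_step hp (h.isFloat sh) (h.step sh hv1)
  obtain ⟨c1, c2, c3⟩ := h.step_add hp (sh + 1) (a4.trans (h.inc_le sh))
  obtain ⟨d1, d2, d3, d4, d5⟩ := fastTwoSum_step hp (isFloat_rn hp1 (B (sh + 1) + s₀.2))
    (h.step_after (sh + 1) c3 he1)
  obtain ⟨f1, f2, f3, f4, f5⟩ := fastTwoSum_step hp (h.isFloat (sh + 2))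
    (h.step (sh + 2) (d4.trans (h.inc_le (sh + 1))))
  obtain ⟨g1, g2, g3⟩ := h.step_add hp (sh + 3) (f4.trans (h.inc_le (sh + 2)))
  set r₀ := (fastTwoSum p (B sh) v).2 with hr0
  set δ₀ := B sh + v - rn p (B sh + v) with hδ0
  set e₁ := B (sh + 1) + r₀ - rn p (B (sh + 1) + r₀) with he1'
  set δ₁ := b₁ + e - rn p (b₁ + e) with hδ1
  set r₁ := (fastTwoSum p b₁ e).2 with hr1
  set δ₂ := B (sh + 2) + r₁ - rn p (B (sh + 2) + r₁) with hδ2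
  set r₂ := (fastTwoSum p (B (sh + 2)) r₁).2 with hr2
  set e₃ := B (sh + 3) + r₂ - rn p (B (sh + 3) + r₂) with he3'
  have D0 : Δ 0 = v - δ₀ := by simp [Δ, s₀, hδ0]; ring
  have D1 : Δ 1 = r₀ - e₁ + e - δ₁ := by simp [Δ, s₀, s₁, hδ1, he1', b₁, hr0]; ring
  have D2 : Δ 2 = r₁ - δ₂ := by simp [Δ, s₁, s₂, hδ2, hr1]; ring
  have D3 : Δ 3 = r₂ - e₃ := by simp [Δ, s₁, s₂, b₃, he3', hr2, hr1]; ring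
  have n0 : |Δ 0| ≤ |v| + |δ₀| := by rw [D0]; exact abs_sub _ _
  have n1 : |Δ 1| ≤ |r₀| + |e₁| + |e| + |δ₁| := by
    rw [D1]
    linarith [abs_sub (r₀ - e₁ + e) δ₁, abs_add_le (r₀ - e₁) e, abs_sub r₀ e₁]
  have n2 : |Δ 2| ≤ |r₁| + |δ₂| := by rw [D2]; exact abs_sub _ _
  have n3 : |Δ 3| ≤ |r₂| + |e₃| := by rw [D3]; exact abs_sub _ _
  have n4 : |Δ 0 + Δ 1 + Δ 2 + Δ 3 - (v + e)| ≤
      |r₀ - δ₀| + |e₁| + |r₁ - δ₁| + |r₂ - δ₂| + |e₃| := by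
    rw [D0, D1, D2, D3, show v - δ₀ + (r₀ - e₁ + e - δ₁) + (r₁ - δ₂) + (r₂ - e₃) - (v + e) =
      (r₀ - δ₀) - e₁ + (r₁ - δ₁) + (r₂ - δ₂) - e₃ by ring]
    linarith [abs_sub ((r₀ - δ₀) - e₁ + (r₁ - δ₁) + (r₂ - δ₂)) e₃,
      abs_add_le ((r₀ - δ₀) - e₁ + (r₁ - δ₁)) (r₂ - δ₂), abs_add_le ((r₀ - δ₀) - e₁) (r₁ - δ₁),
      abs_sub (r₀ - δ₀) e₁]
  have t1 := h.anti sh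
  have t2 := h.anti (sh + 1)
  have t3 : τ (sh + 3) ≤ τ (sh + 2) := h.anti (sh + 2)
  have k1 := h.eps_nonneg (sh + 1)
  have k2 := h.eps_nonneg (sh + 2)
  have k3 := h.eps_nonneg (sh + 3)
  have p0 := abs_nonneg v
  have p1 := abs_nonneg e
  have p2 := abs_nonneg r₁
  have p3 := abs_nonneg e₃
  have q1 := mul_le_mul_of_nonneg_right hu1 p0
  have q2 := mul_le_mul_of_nonneg_right hu1 p1
  have q4 := mul_le_mul_of_nonneg_right hu1 p2
  have q3 := mul_nonneg hu.le p1
  have q5 := mul_le_mul_of_nonneg_left d3 hu.le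
  clear_value Δ δ₀ e₁ δ₁ r₁ δ₂ r₂ e₃ r₀
  refine ⟨⟨?_, ?_, ?_, ?_, ?_, ?_, ?_, ?_, ?_⟩, ?_⟩
  · linarith
  · intro i hi
    interval_cases i <;> linarith
  · simp only [add_zero]; linarith
  · simp only [add_zero]; linarith
  · linarith
  · linarith
  · simp only [add_zero]; linarith
  · simp only [add_zero]; linarith
  · linarith
  · unfold MoveErr; linarith

set_option maxHeartbeats 1000000 in
/-- The third branch of the accumulation: the error `e` is so far from the product that it enters only
bin `sh + 2`. -/
lemma accumulate_third {p : ℕ} (hp : 8 ≤ p) {B A inc ε τ : ℕ → ℝ} (h : BinBounds p B A inc ε τ)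
    (sh : ℕ) {v e : ℝ} (hv1 : |v| ≤ inc sh)
    (he1 : |e| ≤ ε (sh + 2)) (hε : ε (sh + 2) ≤ ε (sh + 1)) :
    let s₀ := fastTwoSum p (B sh) v
    let s₁ := fastTwoSum p (B (sh + 1)) s₀.2
    let b₂ := rn p (B (sh + 2) + s₁.2)
    let s₂ := fastTwoSum p b₂ e
    let b₃ := rn p (B (sh + 3) + s₂.2)
    let Δ : ℕ → ℝ := fun i => if i = 0 then s₀.1 - B sh else if i = 1 then s₁.1 - B (sh + 1) else
      if i = 2 then s₂.1 - B (sh + 2) else b₃ - B (sh + 3)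
    MoveBounds v e (fun i => τ (sh + i)) (fun i => ε (sh + i)) Δ ∧
    |Δ 0 + Δ 1 + Δ 2 + Δ 3 - (v + e)| ≤ 2 * τ (sh + 2) + 6.4 * uro p * (|v| + |e|) := by
  intro s₀ s₁ b₂ s₂ b₃ Δ
  have hu := uro_pos p
  have hu1 := uro_le p hp
  have hp1 : 1 ≤ p := by lia
  obtain ⟨a1, a2, a3, a4, a5⟩ := fastTwoSum_step hp (h.isFloat sh) (h.step sh hv1)
  obtain ⟨f1, f2, f3, f4, f5⟩ := fastTwoSum_step hp (h.isFloat (sh + 1))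
    (h.step (sh + 1) (a4.trans (h.inc_le sh)))
  obtain ⟨c1, c2, c3⟩ := h.step_add hp (sh + 2) (f4.trans (h.inc_le (sh + 1)))
  obtain ⟨d1, d2, d3, d4, d5⟩ := fastTwoSum_step hp (isFloat_rn hp1 (B (sh + 2) + s₁.2))
    (h.step_after (sh + 2) c3 he1)
  obtain ⟨g1, g2, g3⟩ := h.step_add hp (sh + 3) (d4.trans (h.inc_le (sh + 2)))
  set r₀ := (fastTwoSum p (B sh) v).2 with hr0
  set δ₀ := B sh + v - rn p (B sh + v) with hδ0
  set δ₁ := B (sh + 1) + r₀ - rn p (B (sh + 1) + r₀) with hδ1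
  set r₁ := (fastTwoSum p (B (sh + 1)) r₀).2 with hr1
  set e₂ := B (sh + 2) + r₁ - rn p (B (sh + 2) + r₁) with he2'
  set δ₂ := b₂ + e - rn p (b₂ + e) with hδ2
  set r₂ := (fastTwoSum p b₂ e).2 with hr2
  set e₃ := B (sh + 3) + r₂ - rn p (B (sh + 3) + r₂) with he3'
  have D0 : Δ 0 = v - δ₀ := by simp [Δ, s₀, hδ0]; ring
  have D1 : Δ 1 = r₀ - δ₁ := by simp [Δ, s₀, s₁, hδ1, hr0]; ring
  have D2 : Δ 2 = r₁ - e₂ + e - δ₂ := by simp [Δ, s₁, s₂, hδ2, he2', b₂, hr1, hr0, s₀]; ring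
  have D3 : Δ 3 = r₂ - e₃ := by simp [Δ, s₂, b₃, he3', hr2]; ring
  have n0 : |Δ 0| ≤ |v| + |δ₀| := by rw [D0]; exact abs_sub _ _
  have n2 : |Δ 2| ≤ |r₁| + |e₂| + |e| + |δ₂| := by
    rw [D2]
    linarith [abs_sub (r₁ - e₂ + e) δ₂, abs_add_le (r₁ - e₂) e, abs_sub r₁ e₂]
  have n1 : |Δ 1| ≤ |r₀| + |δ₁| := by rw [D1]; exact abs_sub _ _
  have n3 : |Δ 3| ≤ |r₂| + |e₃| := by rw [D3]; exact abs_sub _ _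
  have n4 : |Δ 0 + Δ 1 + Δ 2 + Δ 3 - (v + e)| ≤
      |r₀ - δ₀| + |r₁ - δ₁| + |e₂| + |r₂ - δ₂| + |e₃| := by
    rw [D0, D1, D2, D3, show v - δ₀ + (r₀ - δ₁) + (r₁ - e₂ + e - δ₂) + (r₂ - e₃) - (v + e) =
      (r₀ - δ₀) + (r₁ - δ₁) - e₂ + (r₂ - δ₂) - e₃ by ring]
    linarith [abs_sub ((r₀ - δ₀) + (r₁ - δ₁) - e₂ + (r₂ - δ₂)) e₃,
      abs_add_le ((r₀ - δ₀) + (r₁ - δ₁) - e₂) (r₂ - δ₂), abs_add_le (r₀ - δ₀) (r₁ - δ₁),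
      abs_sub ((r₀ - δ₀) + (r₁ - δ₁)) e₂]
  have t1 := h.anti sh
  have t2 : τ (sh + 2) ≤ τ (sh + 1) := h.anti (sh + 1)
  have t3 : τ (sh + 3) ≤ τ (sh + 2) := h.anti (sh + 2)
  have k1 := h.eps_nonneg (sh + 1)
  have k2 := h.eps_nonneg (sh + 2)
  have k3 := h.eps_nonneg (sh + 3)
  have p0 := abs_nonneg v
  have p1 := abs_nonneg e
  have p2 := abs_nonneg r₀
  have p3 := abs_nonneg e₃
  have p4 := abs_nonneg δ₂
  have q1 := mul_le_mul_of_nonneg_right hu1 p0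
  have q2 := mul_le_mul_of_nonneg_right hu1 p1
  have q4 := mul_le_mul_of_nonneg_right hu1 p2
  have q3 := mul_nonneg hu.le p1
  have q6 := mul_nonneg hu.le p0
  have q5 := mul_le_mul_of_nonneg_left a3 hu.le
  clear_value Δ δ₀ e₂ δ₁ r₁ δ₂ r₂ e₃ r₀
  refine ⟨⟨?_, ?_, ?_, ?_, ?_, ?_, ?_, ?_, ?_⟩, ?_⟩
  · linarith
  · intro i hi
    interval_cases i <;> linarith
  · simp only [add_zero]; linarith
  · simp only [add_zero]; linarith
  · linarith
  · linarith
  · simp only [add_zero]; linarith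
  · simp only [add_zero]; linarith
  · linarith
  · linarith

/-- The bins `B'` arise from the bins `B` by changes `Δ i` of the bins number `sh + i`, `i < 4`. -/
structure ShiftedBy (B B' : ℕ → ℝ) (sh : ℕ) (Δ : ℕ → ℝ) : Prop where
  eq_of_lt : ∀ k < sh, B' k = B k
  eq_of_ge : ∀ k, sh + 4 ≤ k → B' k = B k
  sub_eq : ∀ i < 4, B' (sh + i) - B (sh + i) = Δ i

/-- The accumulation of a product `v` with error `e`: bounds for the changes of the bins and for
the part of `v + e` that gets lost. -/
lemma accumulate_spec {p β : ℕ} (hp : 8 ≤ p) (hβ : β ≤ p) {B A inc ε τ : ℕ → ℝ} (h : BinBounds p B A inc ε τ)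
    (hε : ∀ k, ε (k + 1) ≤ ε k) (sh : ℕ) (l : ℤ) {v e : ℝ} (hv : |v| ≤ inc sh)
    (he1 : l < β - ((p : ℤ) - β - 1) → |e| ≤ ε (sh + 1))
    (he2 : β - ((p : ℤ) - β - 1) ≤ l → |e| ≤ ε (sh + 2)) :
    ∃ Δ : ℕ → ℝ, ShiftedBy B (accumulate p β B v e sh l) sh Δ ∧
      (∀ k, IsFloat p (accumulate p β B v e sh l k)) ∧
      MoveBounds v e (fun i => τ (sh + i)) (fun i => ε (sh + i)) Δ ∧
      (l < β - ((p : ℤ) - β - 1) → MoveErr p v e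
        |(fastTwoSum p (B sh) v).2 - (B sh + v - rn p (B sh + v))| (fun i => τ (sh + i)) Δ) ∧
      (β - ((p : ℤ) - β - 1) ≤ l →
        |Δ 0 + Δ 1 + Δ 2 + Δ 3 - (v + e)| ≤ 2 * τ (sh + 2) + 6.4 * uro p * (|v| + |e|)) := by
  have hp1 : 1 ≤ p := by lia
  simp only [accumulate]
  split_ifs with h1 h2
  · have hl : l < β - ((p : ℤ) - β - 1) := by
      lia
    obtain ⟨m1, m2⟩ := accumulate_first hp h sh hv (he1 hl)
    refine ⟨_, ⟨?_, ?_, ?_⟩, ?_, m1, fun _ => m2, fun h => absurd hl (not_lt.2 h)⟩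
    · intro k hk
      rw [Function.update_of_ne (by lia), Function.update_of_ne (by lia),
        Function.update_of_ne (by lia)]
    · intro k hk
      rw [Function.update_of_ne (by lia), Function.update_of_ne (by lia),
        Function.update_of_ne (by lia)]
    · intro i hi
      interval_cases i <;> simp
    · intro k
      simp only [Function.update_apply]
      split_ifs
      · exact isFloat_rn hp1 _
      · exact isFloat_rn hp1 _
      · exact isFloat_rn hp1 _
      · exact h.isFloat k
  · obtain ⟨m1, m2⟩ := accumulate_second hp h sh hv (he1 h2)
    refine ⟨_, ⟨?_, ?_, ?_⟩, ?_, m1, fun _ => m2, fun h => absurd h2 (not_lt.2 h)⟩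
    · intro k hk
      rw [Function.update_of_ne (by lia), Function.update_of_ne (by lia),
        Function.update_of_ne (by lia), Function.update_of_ne (by lia)]
    · intro k hk
      rw [Function.update_of_ne (by lia), Function.update_of_ne (by lia),
        Function.update_of_ne (by lia), Function.update_of_ne (by lia)]
    · intro i hi
      interval_cases i <;> simp
    · intro k
      simp only [Function.update_apply]
      split_ifs
      · exact isFloat_rn hp1 _
      · exact isFloat_rn hp1 _
      · exact isFloat_rn hp1 _
      · exact isFloat_rn hp1 _
      · exact h.isFloat k
  · obtain ⟨m1, m2⟩ := accumulate_third hp h sh hv (he2 (not_lt.1 h2)) (hε (sh + 1))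
    refine ⟨_, ⟨?_, ?_, ?_⟩, ?_, m1, fun h => absurd h h2, fun _ => m2⟩
    · intro k hk
      rw [Function.update_of_ne (by lia), Function.update_of_ne (by lia),
        Function.update_of_ne (by lia), Function.update_of_ne (by lia)]
    · intro k hk
      rw [Function.update_of_ne (by lia), Function.update_of_ne (by lia),
        Function.update_of_ne (by lia), Function.update_of_ne (by lia)]
    · intro i hi
      interval_cases i <;> simp
    · intro k
      simp only [Function.update_apply]
      split_ifs
      · exact isFloat_rn hp1 _
      · exact isFloat_rn hp1 _
      · exact isFloat_rn hp1 _
      · exact isFloat_rn hp1 _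
      · exact h.isFloat k

/-- The bins from number `K` on change by at most `c` altogether. -/
def TailChange (K : ℕ) (B B' : ℕ → ℝ) (c : ℝ) : Prop :=
  ∀ S : Finset ℕ, (∀ k ∈ S, K ≤ k) → ∑ k ∈ S, |B' k - B k| ≤ c

lemma TailChange.mono {K : ℕ} {B B' : ℕ → ℝ} {c c' : ℝ} (h : TailChange K B B' c) (hc : c ≤ c') :
    TailChange K B B' c' := fun S hS => (h S hS).trans hc

lemma TailChange.trans {K : ℕ} {B B' B'' : ℕ → ℝ} {c c' : ℝ} (h : TailChange K B B' c)
    (h' : TailChange K B' B'' c') : TailChange K B B'' (c + c') := by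
  intro S hS
  refine le_trans ?_ (add_le_add (h S hS) (h' S hS))
  rw [← Finset.sum_add_distrib]
  refine Finset.sum_le_sum fun k _ => ?_
  rw [add_comm]
  exact abs_sub_le _ _ _

lemma TailChange.abs_le {K k : ℕ} {B B' : ℕ → ℝ} {c : ℝ} (h : TailChange K B B' c) (hk : K ≤ k) :
    |B' k - B k| ≤ c := by
  simpa using h {k} (by simpa using hk)

lemma TailChange.refl {K : ℕ} {B : ℕ → ℝ} {c : ℝ} (hc : 0 ≤ c) : TailChange K B B c := by
  intro S _
  simpa using hc

lemma ShiftedBy.tailChange {B B' Δ : ℕ → ℝ} {sh : ℕ} (h : ShiftedBy B B' sh Δ) (K : ℕ) :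
    TailChange K B B' (∑ i ∈ Finset.range 4, if K ≤ sh + i then |Δ i| else 0) := by
  intro S hS
  have h1 : ∑ k ∈ S, |B' k - B k| = ∑ k ∈ S with k ∈ Finset.Ico sh (sh + 4), |B' k - B k| := by
    rw [Finset.sum_filter]
    refine Finset.sum_congr rfl fun k _ => ?_
    split_ifs with hk
    · rfl
    · simp only [Finset.mem_Ico, not_and_or, not_le, not_lt] at hk
      rcases hk with hk | hk
      · rw [h.eq_of_lt k hk, sub_self, abs_zero]
      · rw [h.eq_of_ge k hk, sub_self, abs_zero]
  have h2 : ∑ i ∈ Finset.range 4, (if K ≤ sh + i then |Δ i| else 0)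
      = ∑ k ∈ Finset.Ico sh (sh + 4), if K ≤ k then |B' k - B k| else 0 := by
    rw [Finset.sum_Ico_eq_sum_range]
    simp only [add_tsub_cancel_left]
    refine Finset.sum_congr rfl fun i hi => ?_
    rw [h.sub_eq i (Finset.mem_range.1 hi)]
  rw [h1, h2, ← Finset.sum_filter]
  refine Finset.sum_le_sum_of_subset_of_nonneg ?_ fun _ _ _ => abs_nonneg _
  intro k hk
  simp only [Finset.mem_filter] at hk ⊢
  exact ⟨hk.2, hS k hk.1⟩

lemma ShiftedBy.sum_eq {B B' Δ : ℕ → ℝ} {sh : ℕ} (h : ShiftedBy B B' sh Δ) {n : ℕ}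
    (hn : sh + 4 ≤ n) : ∑ k ∈ Finset.range n, (B' k - B k) = Δ 0 + Δ 1 + Δ 2 + Δ 3 := by
  obtain ⟨m, rfl⟩ := Nat.exists_eq_add_of_le hn
  rw [Finset.sum_range_add, Finset.sum_range_add]
  have h1 : ∑ k ∈ Finset.range sh, (B' k - B k) = 0 :=
    Finset.sum_eq_zero fun k hk => by rw [h.eq_of_lt k (Finset.mem_range.1 hk), sub_self]
  have h2 : ∑ k ∈ Finset.range m, (B' (sh + 4 + k) - B (sh + 4 + k)) = 0 :=
    Finset.sum_eq_zero fun k _ => by rw [h.eq_of_ge _ (by lia), sub_self]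
  rw [h1, h2, zero_add, add_zero,
    Finset.sum_congr rfl fun i hi => h.sub_eq i (Finset.mem_range.1 hi)]
  simp [Finset.sum_range_succ]

/-- The effect of one accumulation (or of several): `h 0` and `h 1` bound the changes of bins `0`
and `1`, and `h K` the change of the bins from number `K` on; the sum of all bins
changes by `val` up to `err`. -/
structure OpCost (B B' : ℕ → ℝ) (h : ℕ → ℝ) (val err : ℝ) : Prop where
  zero : |B' 0 - B 0| ≤ h 0
  one : |B' 1 - B 1| ≤ h 1
  tail : ∀ K, 2 ≤ K → K ≤ 5 → TailChange K B B' (h K)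
  sum : ∃ N, ∀ n, N ≤ n → |∑ k ∈ Finset.range n, (B' k - B k) - val| ≤ err

lemma OpCost.trans {B B' B'' h h' : ℕ → ℝ} {val val' err err' : ℝ} (H : OpCost B B' h val err)
    (H' : OpCost B' B'' h' val' err') :
    OpCost B B'' (fun K => h K + h' K) (val + val') (err + err') := by
  refine ⟨?_, ?_, fun K h2 h5 => (H.tail K h2 h5).trans (H'.tail K h2 h5), ?_⟩
  · have h1 := abs_sub_le (B'' 0) (B' 0) (B 0)
    linarith [H.zero, H'.zero]
  · have h1 := abs_sub_le (B'' 1) (B' 1) (B 1)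
    linarith [H.one, H'.one]
  · obtain ⟨N, hN⟩ := H.sum
    obtain ⟨N', hN'⟩ := H'.sum
    refine ⟨max N N', fun n hn => ?_⟩
    have e1 := hN n (le_of_max_le_left hn)
    have e2 := hN' n (le_of_max_le_right hn)
    have e3 : ∑ k ∈ Finset.range n, (B'' k - B k) - (val + val') =
        (∑ k ∈ Finset.range n, (B' k - B k) - val) +
          (∑ k ∈ Finset.range n, (B'' k - B' k) - val') := by
      simp only [Finset.sum_sub_distrib]; ring
    rw [e3]
    exact (abs_add_le _ _).trans (add_le_add e1 e2)

lemma OpCost.refl {B h : ℕ → ℝ} {val err : ℝ} (hh : ∀ K, 0 ≤ h K) (hv : |val| ≤ err) :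
    OpCost B B h val err := by
  refine ⟨by simpa using hh 0, by simpa using hh 1, fun K _ _ => TailChange.refl (hh K),
    0, fun n _ => by simpa using hv⟩

lemma OpCost.mono {B B' h h' : ℕ → ℝ} {val val' err err' : ℝ} (H : OpCost B B' h val err)
    (hh : ∀ K ≤ 5, h K ≤ h' K) (hv : |val - val'| + err ≤ err') : OpCost B B' h' val' err' := by
  refine ⟨H.zero.trans (hh 0 (by lia)), H.one.trans (hh 1 (by lia)),
    fun K h2 h5 => (H.tail K h2 h5).mono (hh K h5), ?_⟩
  obtain ⟨N, hN⟩ := H.sum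
  refine ⟨N, fun n hn => ?_⟩
  have h1 := hN n hn
  have h2 := abs_sub_le (∑ k ∈ Finset.range n, (B' k - B k)) val val'
  linarith

/-- The two kinds of bounds for the change of the bins from number `K` on: by the size of the
product, and by the bounds for the remainders. -/
lemma tail_le_of_moveBounds {B B' Δ τ ε : ℕ → ℝ} {sh : ℕ} {v e : ℝ} (hs : ShiftedBy B B' sh Δ)
    (hm : MoveBounds v e (fun i => τ (sh + i)) (fun i => ε (sh + i)) Δ)
    (hτ : ∀ k, τ (k + 1) ≤ τ k) (hτ0 : ∀ k, 0 ≤ τ k) (hε0 : ∀ k, 0 ≤ ε k) (K : ℕ) :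
    TailChange K B B' (6.2 * (|v| + |e|)) ∧
    (K ≤ sh → TailChange K B B' (|v| + 5 * τ K + 6.2 * |e|)) ∧
    (sh + 1 ≤ K → TailChange K B B' (τ (K - 1) + 3 * τ K + 6.2 * ε K)) := by
  have h := hs.tailChange K
  simp only [Finset.sum_range_succ, Finset.range_zero, Finset.sum_empty, zero_add, add_zero] at h
  have p0 := abs_nonneg (Δ 0)
  have p1 := abs_nonneg (Δ 1)
  have p2 := abs_nonneg (Δ 2)
  have p3 := abs_nonneg (Δ 3)
  have hanti : Antitone τ := antitone_nat_of_succ_le hτ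
  refine ⟨h.mono (le_trans ?_ hm.triv), fun hK => h.mono ?_, fun hK => ?_⟩
  · split_ifs <;> linarith
  · have := hm.tail0
    have := hanti hK
    simp only [add_zero] at *
    split_ifs <;> linarith
  · obtain ⟨j, rfl⟩ := Nat.exists_eq_add_of_le hK
    have h0 : ¬ (sh + 1 + j ≤ sh) := by lia
    rw [if_neg h0] at h
    have e1 := hτ0 (sh + 1 + j - 1)
    have e2 := hτ0 (sh + 1 + j)
    have e3 := hε0 (sh + 1 + j)
    refine h.mono ?_
    match j with
    | 0 =>
      have := hm.tail1
      simp only [add_zero, add_tsub_cancel_right] at *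
      simpa using this
    | 1 =>
      have := hm.tail2
      simp only [show ¬ (sh + 1 + 1 ≤ sh + 1) by lia, if_false, show sh + 1 + 1 = sh + 2 by lia,
        le_refl, if_true, show sh + 2 ≤ sh + 3 by lia, show sh + 2 - 1 = sh + 1 by lia] at *
      linarith
    | 2 =>
      have := hm.tail3
      simp only [show ¬ (sh + 1 + 2 ≤ sh + 1) by lia, if_false, show sh + 1 + 2 = sh + 3 by lia,
        le_refl, if_true, show ¬ (sh + 3 ≤ sh + 2) by lia, show sh + 3 - 1 = sh + 2 by lia] at *
      linarith
    | j + 3 =>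
      simp only [show ¬ (sh + 1 + (j + 3) ≤ sh + 1) by lia, if_false,
        show ¬ (sh + 1 + (j + 3) ≤ sh + 2) by lia, show ¬ (sh + 1 + (j + 3) ≤ sh + 3) by lia]
      linarith

/-! ### The products in a multiplication as one list of operations -/

/-- The index pairs of the products formed by `mul`, in order. -/
def mulPairs (m n r : ℕ) : List (ℕ × ℕ) :=
  (List.range (min m (r + 1))).flatMap
    (fun i => (List.range (min n (r - i + 1))).map (fun j => (i, j)))

/-- The accumulation of the product with indices `q`. -/
def mulOp (p β : ℕ) (T : ℤ) (x y : List ℝ) (r : ℕ) (B : ℕ → ℝ) (q : ℕ × ℕ) : ℕ → ℝ :=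
  accumulateProd p β T B (x.getD q.1 0) (y.getD q.2 0) (rn p (x.getD q.1 0 * y.getD q.2 0))
    (if q.1 + q.2 < r then (twoProd p (x.getD q.1 0) (y.getD q.2 0)).2 else 0)

lemma foldl_congr_mem {α β : Type*} {f g : β → α → β} {l : List α}
    (h : ∀ b, ∀ a ∈ l, f b a = g b a) (b : β) : l.foldl f b = l.foldl g b := by
  induction l generalizing b with
  | nil => rfl
  | cons a l ih =>
    rw [List.foldl_cons, List.foldl_cons, h b a (by simp)]
    exact ih (fun b a ha => h b a (by simp [ha])) _

lemma mulBins_eq (p β : ℕ) (T : ℤ) (x y : List ℝ) (r : ℕ) :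
    mulBins p β T x y r =
      (mulPairs x.length y.length r).foldl (mulOp p β T x y r) (binInit p β T) := by
  rw [mulBins, mulPairs, List.foldl_flatMap]
  refine foldl_congr_mem (fun B i hi => ?_) _
  have hi' : i ≤ r := by have := List.mem_range.1 hi; lia
  rw [List.foldl_map]
  have hin : ∀ B, (List.range (min y.length (r - i))).foldl (fun B j =>
      accumulateProd p β T B (x.getD i 0) (y.getD j 0)
        (twoProd p (x.getD i 0) (y.getD j 0)).1 (twoProd p (x.getD i 0) (y.getD j 0)).2) B
      = (List.range (min y.length (r - i))).foldl (fun B j => mulOp p β T x y r B (i, j)) B := by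
    refine foldl_congr_mem fun B j hj => ?_
    have hj' : i + j < r := by have := List.mem_range.1 hj; lia
    simp [mulOp, hj', twoProd]
  simp only [hin]
  split_ifs with hJ
  · have h1 : min y.length (r - i) = r - i := by lia
    have h2 : min y.length (r - i + 1) = r - i + 1 := by lia
    rw [h1, h2, List.range_succ, List.foldl_append]
    simp [mulOp, show i + (r - i) = r by lia]
  · rw [show min y.length (r - i + 1) = min y.length (r - i) by lia]

/-- A sequence of operations whose costs stay within the budget `C` keeps every property that the
single operation has as long as the accumulated cost is within the budget. -/
lemma foldl_opCost {p : ℕ} {op : (ℕ → ℝ) → ℕ × ℕ → ℕ → ℝ} {h : ℕ × ℕ → ℕ → ℝ}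
    {val err : ℕ × ℕ → ℝ} {C : ℕ → ℝ} (I : ℕ → ℝ) (hh : ∀ q K, 0 ≤ h q K) (l : List (ℕ × ℕ))
    (hop : ∀ q ∈ l, ∀ B, (∀ k, IsFloat p (B k)) → |B 0 - I 0| ≤ C 0 → |B 1 - I 1| ≤ C 1 →
      (∀ K, 2 ≤ K → K ≤ 5 → TailChange K I B (C K)) →
      (∀ k, IsFloat p (op B q k)) ∧ OpCost B (op B q) (h q) (val q) (err q))
    (B : ℕ → ℝ) (acc : ℕ → ℝ) (v0 e0 : ℝ) (hB : ∀ k, IsFloat p (B k)) (hacc : OpCost I B acc v0 e0)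
    (hC : ∀ K ≤ 5, acc K + (l.map (fun q => h q K)).sum ≤ C K) :
    (∀ k, IsFloat p (l.foldl op B k)) ∧
      OpCost I (l.foldl op B) (fun K => acc K + (l.map (fun q => h q K)).sum)
        (v0 + (l.map val).sum) (e0 + (l.map err).sum) := by
  induction l generalizing B acc v0 e0 with
  | nil => simpa using ⟨hB, hacc⟩
  | cons q l ih =>
    have hnn : ∀ K, 0 ≤ (l.map (fun q => h q K)).sum := fun K =>
      List.sum_nonneg (by simp only [List.mem_map]; rintro _ ⟨q, -, rfl⟩; exact hh q K)
    have hle : ∀ K ≤ 5, acc K ≤ C K := fun K hK => by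
      have h1 := hC K hK
      have h2 := hnn K
      have h3 := hh q K
      simp only [List.map_cons, List.sum_cons] at h1
      linarith
    obtain ⟨h1, h2⟩ := hop q (by simp) B hB (hacc.zero.trans (hle 0 (by lia)))
      (hacc.one.trans (hle 1 (by lia))) (fun K h2 h5 => (hacc.tail K h2 h5).mono (hle K h5))
    have := ih (fun q hq => hop q (by simp [hq])) (op B q) (fun K => acc K + h q K) (v0 + val q)
      (e0 + err q) h1 (hacc.trans h2)
      (fun K hK => by have := hC K hK; simp only [List.map_cons, List.sum_cons] at this; linarith)
    simpa [add_assoc] using this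

/-! ### Bounds for the bins of a multiplication -/

/-- The ratio `2 ^ (-β)` of the weights of consecutive bins. -/
def binRatio (β : ℕ) : ℝ := (2 : ℝ) ^ (-(β : ℤ))

lemma binRatio_pos (β : ℕ) : 0 < binRatio β := two_zpow_pos _

lemma binRatio_le {p β : ℕ} (h1 : β + 2 ≤ p) (h2 : p + 4 ≤ 2 * β) : binRatio β ≤ 1 / 64 := by
  unfold binRatio
  calc (2 : ℝ) ^ (-(β : ℤ)) ≤ 2 ^ (-6 : ℤ) := two_zpow_le (by lia)
    _ = 1 / 64 := by norm_num

lemma binRatio_sq_le {p β : ℕ} (h2 : p + 4 ≤ 2 * β) : binRatio β ^ 2 ≤ uro p / 16 := by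
  unfold binRatio uro
  calc ((2 : ℝ) ^ (-(β : ℤ))) ^ 2 = 2 ^ (-(β : ℤ) + -(β : ℤ)) := by rw [two_zpow_add]; ring
    _ ≤ 2 ^ (-(p : ℤ) + -4) := two_zpow_le (by lia)
    _ = _ := by rw [two_zpow_add]; norm_num; ring

lemma uro_le_binRatio {p β : ℕ} (h1 : β + 2 ≤ p) : uro p ≤ binRatio β / 4 := by
  unfold binRatio uro
  calc (2 : ℝ) ^ (-(p : ℤ)) ≤ 2 ^ (-(β : ℤ) + -2) := two_zpow_le (by lia)
    _ = _ := by rw [two_zpow_add]; norm_num; ring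

lemma binRatio_pow (β k : ℕ) : binRatio β ^ k = (2 : ℝ) ^ (-((k : ℤ) * β)) := by
  unfold binRatio
  rw [← zpow_natCast, ← zpow_mul]
  congr 1
  ring

lemma uro_mul_binInit (p β : ℕ) (T : ℤ) (k : ℕ) :
    uro p * binInit p β T k = 3 / 4 * binRatio β ^ (k + 1) * 2 ^ T := by
  rw [binRatio_pow, binInit, uro,
    show T - ((k : ℤ) + 1) * β + p - 1 = (p : ℤ) + (T + (-(((k + 1 : ℕ) : ℤ) * β) + -1)) by
      push_cast; ring, two_zpow_add, two_zpow_add T, two_zpow_add _ (-1), zpow_neg]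
  have := (two_zpow_pos (p : ℤ)).ne'
  field_simp
  norm_num

lemma binInit_pos (p β : ℕ) (T : ℤ) (k : ℕ) : 0 < binInit p β T k := by
  unfold binInit; positivity

lemma isFloat_binInit {p : ℕ} (hp : 8 ≤ p) (β : ℕ) (T : ℤ) (k : ℕ) :
    IsFloat p (binInit p β T k) := by
  refine isFloat_of_isMult (k := T - ((k : ℤ) + 1) * β + p - 1 - 1) (by lia) ⟨3, ?_⟩ ?_
  · rw [binInit]
    generalize T - ((k : ℤ) + 1) * β + p - 1 = z
    rw [sub_eq_add_neg, two_zpow_add]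
    norm_num; ring
  · rw [abs_of_pos (binInit_pos _ _ _ _), binInit]
    set z := T - ((k : ℤ) + 1) * β + p - 1
    have h1 : (2 : ℝ) ^ (z + 1) ≤ 2 ^ (z - 1 + p) := two_zpow_le (by lia)
    have h2 : (2 : ℝ) ^ (z + 1) = 2 * 2 ^ z := by rw [two_zpow_add]; norm_num; ring
    have := two_zpow_pos z
    linarith

/-- The bounds for the remainders that leave bin `k`, for products of size `P` and contents
of the bins from number `k ≥ 2` on at most `R k * u * P`. -/
def remBound (u D P : ℝ) (R : ℕ → ℝ) : ℕ → ℝ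
  | 0 => 1.3 * D * P
  | 1 => 3.7 * D ^ 2 * P
  | 2 => 3.02 * D ^ 3 * P + 1.03 * u * (R 2 * u * P)
  | k + 3 => 1.03 * (3.25 * D ^ (k + 4) * P + 2 * u * remBound u D P R (k + 2)
      + u * (R (k + 3) * u * P))

/-- The bounds for what enters bin `k ≥ 1`. -/
def incBound (u D P : ℝ) (R : ℕ → ℝ) (i₀ : ℝ) : ℕ → ℝ
  | 0 => i₀
  | 1 => 1.45 * D * P
  | 2 => 4 * D ^ 2 * P
  | k + 3 => 4 * D ^ (k + 3) * P + remBound u D P R (k + 2)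

/-- The bounds for the error terms of the products that enter bin `k`. -/
def epsBound (D P : ℝ) : ℕ → ℝ
  | 0 => 0.26 * D * P
  | 1 => 0.26 * D * P
  | 2 => 0.36 * D ^ 2 * P
  | k + 3 => D ^ (k + 3) * P

/-- The bounds for the contents of bin `k`. -/
def contBound (u D P : ℝ) (R : ℕ → ℝ) (c₀ : ℝ) : ℕ → ℝ
  | 0 => c₀
  | 1 => 7.9 * D * P
  | k + 2 => R (k + 2) * u * P

/-- The relations between the unit roundoff `u`, the ratio `D` of the bins, the leading product `P`,
the unit `W` of the bins, and the bounds `R` for their contents. -/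
structure BinSetting (u D P W : ℝ) (R : ℕ → ℝ) : Prop where
  u_pos : 0 < u
  u_le : u ≤ 1 / 256
  D_pos : 0 < D
  D_le : D ≤ 1 / 64
  sq_le : D ^ 2 ≤ u / 16
  le_D : u ≤ D / 4
  W_pos : 0 < W
  W_le : W ≤ P
  R_nonneg : ∀ k, 0 ≤ R k
  R_anti : ∀ k, R (k + 1) ≤ R k
  R_two : R 2 ≤ 16
  R_three : R 3 ≤ 0.9 * R 2

namespace BinSetting

variable {u D P W : ℝ} {R : ℕ → ℝ}

lemma P_pos (h : BinSetting u D P W R) : 0 < P := h.W_pos.trans_le h.W_le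

lemma rem_nonneg (h : BinSetting u D P W R) (k : ℕ) : 0 ≤ remBound u D P R k := by
  have hu := h.u_pos
  have hD := h.D_pos
  have hP := h.P_pos
  have h2 := h.R_nonneg 2
  match k with
  | 0 => unfold remBound; positivity
  | 1 => unfold remBound; positivity
  | 2 => unfold remBound; positivity
  | k + 3 =>
    have := rem_nonneg h (k + 2)
    have := h.R_nonneg (k + 3)
    unfold remBound; positivity

lemma usq_le (h : BinSetting u D P W R) : u * u ≤ D ^ 2 / 16 := by
  have h1 := mul_le_mul h.le_D h.le_D h.u_pos.le (by linarith [h.D_pos])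
  linarith

lemma rem_anti (h : BinSetting u D P W R) (k : ℕ) :
    remBound u D P R (k + 1) ≤ remBound u D P R k := by
  have hu := h.u_pos
  have hD := h.D_pos
  have hP := h.P_pos
  match k with
  | 0 =>
    simp only [remBound]
    have : D ^ 2 * P ≤ 1 / 64 * D * P := by
      apply mul_le_mul_of_nonneg_right _ hP.le
      nlinarith [h.D_le]
    have := mul_pos hD hP
    linarith
  | 1 =>
    simp only [remBound]
    have h1 : D ^ 3 ≤ 1 / 64 * D ^ 2 := by
      rw [pow_succ, mul_comm]; exact mul_le_mul_of_nonneg_right h.D_le (by positivity)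
    have h2 := mul_le_mul h.R_two h.usq_le (by positivity) (by norm_num)
    have h3 : 3.02 * D ^ 3 + 1.03 * (R 2 * (u * u)) ≤ 3.7 * D ^ 2 := by
      have : 0 < D ^ 2 := by positivity
      linarith
    nlinarith [mul_le_mul_of_nonneg_right h3 hP.le]
  | 2 =>
    simp only [remBound]
    have h1 : D ^ 4 * P ≤ 1 / 64 * (D ^ 3 * P) := by
      rw [← mul_assoc, pow_succ, mul_comm (D ^ 3)]
      exact mul_le_mul_of_nonneg_right
        (mul_le_mul_of_nonneg_right h.D_le (by positivity)) hP.le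
    have hX : 0 ≤ R 2 * u * P := by have := h.R_nonneg 2; positivity
    have h2 := mul_le_mul_of_nonneg_right h.u_le
      (show 0 ≤ 3.02 * D ^ 3 * P + 1.03 * u * (R 2 * u * P) by positivity)
    have h3 : u * (R 3 * u * P) ≤ 0.9 * (u * (R 2 * u * P)) := by
      have := mul_le_mul_of_nonneg_right h.R_three (show 0 ≤ u * u * P by positivity)
      linarith
    have h4 : 0 < D ^ 3 * P := by positivity
    have h5 : 0 ≤ u * (R 2 * u * P) := by positivity
    simp only [zero_add]
    linarith
  | k + 3 =>
    have ih := rem_anti h (k + 2)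
    have e1 : remBound u D P R (k + 3 + 1) = 1.03 * (3.25 * D ^ (k + 1 + 4) * P
      + 2 * u * remBound u D P R (k + 2 + 1) + u * (R (k + 3 + 1) * u * P)) := rfl
    have e2 : remBound u D P R (k + 3) = 1.03 * (3.25 * D ^ (k + 4) * P
      + 2 * u * remBound u D P R (k + 2) + u * (R (k + 3) * u * P)) := rfl
    have h1 : D ^ (k + 1 + 4) * P ≤ D ^ (k + 4) * P :=
      mul_le_mul_of_nonneg_right
        (pow_le_pow_of_le_one hD.le (by linarith [h.D_le]) (by lia)) hP.le
    have h2 := mul_le_mul_of_nonneg_left ih hu.le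
    have h3 := mul_le_mul_of_nonneg_right (h.R_anti (k + 3)) (show 0 ≤ u * u * P by positivity)
    have h4 : 0 ≤ remBound u D P R (k + 2 + 1) := h.rem_nonneg _
    rw [e1]
    refine le_trans ?_ e2.ge
    generalize remBound u D P R (k + 2 + 1) = Y at *
    linarith

lemma eps_nonneg (h : BinSetting u D P W R) (k : ℕ) : 0 ≤ epsBound D P k := by
  have hD := h.D_pos
  have hP := h.P_pos
  match k with
  | 0 => unfold epsBound; positivity
  | 1 => unfold epsBound; positivity
  | 2 => unfold epsBound; positivity
  | k + 3 => unfold epsBound; positivity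

lemma eps_anti (h : BinSetting u D P W R) (k : ℕ) : epsBound D P (k + 1) ≤ epsBound D P k := by
  have hD := h.D_pos
  have hP := h.P_pos
  match k with
  | 0 => simp [epsBound]
  | 1 =>
    simp only [epsBound]
    have : D ^ 2 * P ≤ 1 / 64 * D * P := by
      apply mul_le_mul_of_nonneg_right _ hP.le
      nlinarith [h.D_le]
    have := mul_pos hD hP
    linarith
  | 2 =>
    simp only [epsBound, zero_add]
    have h1 : D ^ 3 * P ≤ 1 / 64 * (D ^ 2 * P) := by
      rw [← mul_assoc, pow_succ, mul_comm (D ^ 2)]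
      exact mul_le_mul_of_nonneg_right
        (mul_le_mul_of_nonneg_right h.D_le (by positivity)) hP.le
    have : 0 < D ^ 2 * P := by positivity
    linarith
  | k + 3 =>
    rw [show k + 3 + 1 = (k + 1) + 3 by ring, epsBound, epsBound]
    exact mul_le_mul_of_nonneg_right
        (pow_le_pow_of_le_one hD.le (by linarith [h.D_le]) (by lia)) hP.le

/-- Bins whose contents, relative to the starting values, are bounded by `contBound` satisfy the
hypotheses for an accumulation. -/
lemma binBounds {p β : ℕ} {T : ℤ} (hu : uro p = u) (hD' : binRatio β = D) (hW : (2 : ℝ) ^ T = W)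
    (h : BinSetting u D P W R) {B : ℕ → ℝ} (hB : ∀ k, IsFloat p (B k)) {c₀ i₀ : ℝ} (hi₀ : 0 ≤ i₀)
    (hc : ∀ k, |B k - binInit p β T k| ≤ contBound u D P R c₀ k)
    (h0 : u * (c₀ + 2 * i₀) ≤ 0.503 * D * P) :
    BinBounds p B (fun k => binInit p β T k + contBound u D P R c₀ k) (incBound u D P R i₀)
      (epsBound D P) (remBound u D P R) := by
  have hup := h.u_pos
  have hD := h.D_pos
  have hP := h.P_pos
  have hI : ∀ k, u * binInit p β T k ≤ 3 / 4 * (D ^ (k + 1) * P) := by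
    intro k
    have := uro_mul_binInit p β T k
    rw [hu, hD', hW] at this
    rw [this, mul_assoc]
    exact mul_le_mul_of_nonneg_left (mul_le_mul_of_nonneg_left h.W_le (by positivity))
      (by norm_num)
  have huD : ∀ k, u * (D ^ k * P) ≤ 1 / 4 * (D ^ (k + 1) * P) := by
    intro k
    have := mul_le_mul_of_nonneg_right h.le_D (show 0 ≤ D ^ k * P by positivity)
    rw [pow_succ]; linarith
  have huu : ∀ k, u * (D ^ k * P) ≤ 1 / 256 * (D ^ k * P) := fun k =>
    mul_le_mul_of_nonneg_right h.u_le (by positivity)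
  refine ⟨hB, ?_, ?_, ?_, h.rem_anti, h.eps_nonneg, ?_⟩
  · intro k
    have h1 := abs_sub_abs_le_abs_sub (B k) (binInit p β T k)
    rw [abs_of_pos (binInit_pos _ _ _ _)] at h1
    linarith [hc k]
  · intro k
    rw [hu]
    match k with
    | 0 =>
      simp only [incBound, epsBound, remBound, contBound]
      have h1 := hI 0
      have h2 := huu 1
      have h3 : 0 < D * P := by positivity
      simp only [zero_add, pow_one] at h1 h2
      linarith
    | 1 =>
      simp only [incBound, epsBound, remBound, contBound]
      have h1 := hI 1
      have h2 := huD 1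
      have h3 : 0 < D ^ 2 * P := by positivity
      simp only [Nat.reduceAdd, pow_one] at h1 h2
      linarith
    | 2 =>
      simp only [incBound, epsBound, remBound, contBound]
      have h1 := hI 2
      have h2 := huD 2
      have h3 : 0 < D ^ 3 * P := by positivity
      simp only [Nat.reduceAdd, zero_add] at h1 h2 ⊢
      linarith
    | k + 3 =>
      have e1 : contBound u D P R c₀ (k + 3) = R (k + 3) * u * P := rfl
      have e2 : epsBound D P (k + 3) = D ^ (k + 3) * P := rfl
      rw [e1, e2, incBound, remBound]
      have h1 := hI (k + 3)
      have h2 := huD (k + 3)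
      have h3 : 0 < D ^ (k + 3 + 1) * P := by positivity
      rw [show k + 4 = k + 3 + 1 by ring]
      have h4 := mul_nonneg hup.le (h.rem_nonneg (k + 2))
      linarith
  · intro k
    match k with
    | 0 =>
      simp only [incBound, remBound]
      have h3 : 0 < D * P := by positivity
      linarith
    | 1 =>
      simp only [incBound, remBound]
      have h3 : 0 < D ^ 2 * P := by positivity
      linarith
    | k + 2 =>
      rw [show k + 2 + 1 = k + 3 by ring, incBound]
      have : 0 < D ^ (k + 3) * P := by positivity
      linarith
  · intro k
    match k with
    | 0 => simpa [incBound] using hi₀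
    | 1 => simp only [incBound]; positivity
    | 2 => simp only [incBound]; positivity
    | k + 3 =>
      have := h.rem_nonneg (k + 2)
      simp only [incBound]; positivity

end BinSetting

/-! ### The accumulation of a single product -/

/-- The rounded product of two floating-point numbers and its error term, if `c` holds. -/
lemma product_facts {p : ℕ} (hp : 8 ≤ p) {a b : ℝ} (ha : a ≠ 0) (hb : b ≠ 0) (c : Prop)
    [Decidable c] :
    let v := rn p (a * b)
    let e := if c then (twoProd p a b).2 else 0
    2 ^ (expo a + expo b) ≤ |a * b| ∧ |v| ≤ 4 * 2 ^ (expo a + expo b) ∧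
    |v| ≤ (1 + uro p) * |a * b| ∧ |e| ≤ 2 * uro p * 2 ^ (expo a + expo b) ∧
    |e| ≤ 1.01 * uro p * |a * b| ∧ |a * b - (v + e)| ≤ uro p * |a * b| ∧
    (c → |a * b - (v + e)| ≤ uro p * (uro p * |a * b|)) := by
  intro v e
  have hp1 : 1 ≤ p := by lia
  have hu := uro_pos p
  have hu1 := uro_le p hp
  have h1 : (2 : ℝ) ^ (expo a + expo b) ≤ |a * b| := by
    rw [two_zpow_add, abs_mul]
    exact mul_le_mul (zpow_expo_le ha) (zpow_expo_le hb) (two_zpow_pos _).le (abs_nonneg _)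
  have h2 : |a * b| < 2 ^ (expo a + expo b + 2) := by
    rw [show expo a + expo b + 2 = (expo a + 1) + (expo b + 1) by ring, two_zpow_add, abs_mul]
    exact mul_lt_mul'' (lt_zpow_expo a) (lt_zpow_expo b) (abs_nonneg _) (abs_nonneg _)
  have h4 : (2 : ℝ) ^ (expo a + expo b + 2) = 4 * 2 ^ (expo a + expo b) := by
    rw [two_zpow_add]; norm_num; ring
  have h3 : |v| ≤ 4 * 2 ^ (expo a + expo b) := by
    rw [← h4]; exact abs_rn_le_of_le hp1 (isFloat_two_zpow hp1 _) h2.le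
  have h5 : |a * b - v| ≤ 2 * uro p * 2 ^ (expo a + expo b) := by
    have := abs_rn_sub_le_of_lt (p := p) (k := expo a + expo b + 1)
      (h2.trans_eq (by rw [show expo a + expo b + 1 + 1 = expo a + expo b + 2 by ring]))
    rw [abs_sub_comm, two_zpow_add] at this
    norm_num at this ⊢
    linarith
  have h6 := abs_sub_rn_le p (a * b)
  have h7 : 0 ≤ uro p * |a * b| := by positivity
  have h8 : 0 < uro p * 2 ^ (expo a + expo b) := mul_pos hu (two_zpow_pos _)
  refine ⟨h1, h3, abs_rn_le p _, ?_⟩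
  by_cases hc : c
  · have he : e = rn p (a * b - v) := by simp [e, hc, twoProd, v]
    have hf : IsFloat p (2 * uro p * 2 ^ (expo a + expo b)) := by
      have : 2 * uro p * 2 ^ (expo a + expo b) = (2 : ℝ) ^ (expo a + expo b - p + 1) := by
        rw [show expo a + expo b - p + 1 = 1 + -(p : ℤ) + (expo a + expo b) by ring,
          two_zpow_add _ (expo a + expo b), two_zpow_add 1, uro, zpow_one]
      rw [this]; exact isFloat_two_zpow hp1 _
    have h9 : |a * b - (v + e)| ≤ uro p * (uro p * |a * b|) := by
      rw [he, ← sub_sub]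
      exact (abs_sub_rn_le p _).trans (mul_le_mul_of_nonneg_left h6 hu.le)
    refine ⟨?_, ?_, ?_, fun _ => h9⟩
    · rw [he]; exact abs_rn_le_of_le hp1 hf h5
    · rw [he]
      have := abs_rn_le p (a * b - v)
      have := mul_le_mul_of_nonneg_right hu1 (abs_nonneg (a * b - v))
      have h6' : |a * b - v| ≤ uro p * |a * b| := h6
      linarith
    · refine h9.trans ?_
      have := mul_le_mul_of_nonneg_right hu1 h7
      linarith
  · have he : e = 0 := by simp [e, hc]
    rw [he, abs_zero, add_zero]
    exact ⟨by linarith, by linarith, h6, fun h => absurd h hc⟩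

/-- The bound for what a single operation adds to the bins from number `K ≥ 2` on, in terms of
the bounds for the remainders. -/
def opBound (u D P : ℝ) (R : ℕ → ℝ) (K : ℕ) : ℝ :=
  max (4.05 * D ^ K * P + 5 * remBound u D P R K)
    (remBound u D P R (K - 1) + 3 * remBound u D P R K + 6.2 * epsBound D P K)

lemma BinSetting.opBound_nonneg {u D P W : ℝ} {R : ℕ → ℝ} (h : BinSetting u D P W R) (K : ℕ) :
    0 ≤ opBound u D P R K := by
  have hD := h.D_pos
  have hP := h.P_pos
  have := h.rem_nonneg K
  exact le_trans (by positivity) (le_max_left _ _)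

/-- The cost of an operation on a product of absolute value `X` other than the leading one. -/
def opCost (u D P : ℝ) (R : ℕ → ℝ) (X : ℝ) (K : ℕ) : ℝ :=
  if K ≤ 1 then 2.12 * X else min (6.25 * X) (opBound u D P R K)

/-- The part of a product of absolute value `X` that is lost in its accumulation. -/
def opErr (u D P : ℝ) (R : ℕ → ℝ) (X : ℝ) : ℝ :=
  min (1.12 * X) (2 * remBound u D P R 2 + 7.6 * u * X)

lemma accumulate_zero {p : ℕ} (hp : 8 ≤ p) (β : ℕ) {B : ℕ → ℝ} (hB : ∀ k, IsFloat p (B k))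
    (sh : ℕ) (l : ℤ) : accumulate p β B 0 0 sh l = B := by
  have hp1 : 1 ≤ p := by lia
  have h1 : ∀ k, (fastTwoSum p (B k) 0).1 = B k := fun k => by
    rw [fastTwoSum_fst, add_zero, rn_of_isFloat hp1 (hB k)]
  have h2 : ∀ k, (fastTwoSum p (B k) 0).2 = 0 := fun k => by
    rw [fastTwoSum_snd, add_zero, rn_of_isFloat hp1 (hB k), sub_self, rn_zero, sub_self, rn_zero]
  have h3 : ∀ k, rn p (B k) = B k := fun k => rn_of_isFloat hp1 (hB k)
  simp only [accumulate, h1, h2, add_zero, h3, Function.update_eq_self, ite_self]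

/-- The index and the remaining shift of the bin for a product. -/
lemma bin_index (β : ℕ) (hβ : 1 ≤ β) {d : ℤ} (hd : 0 ≤ d) :
    0 ≤ d - ((d / (β : ℤ)).toNat : ℤ) * β ∧ d - ((d / (β : ℤ)).toNat : ℤ) * β < β := by
  have h1 : ((d / (β : ℤ)).toNat : ℤ) = d / β := Int.toNat_of_nonneg (Int.ediv_nonneg hd (by lia))
  rw [h1]
  have h2 := Int.emod_nonneg d (show (β : ℤ) ≠ 0 by lia)
  have h3 := Int.emod_lt_of_pos d (show (0 : ℤ) < β by lia)
  have h4 := Int.emod_add_mul_ediv d β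
  rw [mul_comm (β : ℤ)] at h4
  constructor <;> linarith

/-- The weight of a product in terms of the ratio of the bins. -/
lemma weight_eq (β sh : ℕ) (l E T : ℤ) (h : l = T - E - sh * β) :
    (2 : ℝ) ^ E = binRatio β ^ sh * 2 ^ T * 2 ^ (-l) := by
  rw [binRatio_pow, ← two_zpow_add, ← two_zpow_add]
  congr 1
  lia

/-- The accumulation of a product other than the leading one. -/
lemma accumulateProd_other {p β : ℕ} {T : ℤ} {u D P W : ℝ} {R : ℕ → ℝ} (hp : 8 ≤ p)
    (hβ : β + 2 ≤ p) (hβ2 : p + 4 ≤ 2 * β) (hu : uro p = u) (hD : binRatio β = D)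
    (hW : (2 : ℝ) ^ T = W) (h : BinSetting u D P W R) {B : ℕ → ℝ} (hB : ∀ k, IsFloat p (B k))
    (hc : ∀ k, |B k - binInit p β T k| ≤ contBound u D P R (1.12 * P) k) {a b : ℝ}
    (hX : |a * b| ≤ 5.6 * u * P) (hfar : a * b ≠ 0 → expo a + expo b + p ≤ T + 3)
    (c : Prop) [Decidable c] :
    let B' := accumulateProd p β T B a b (rn p (a * b)) (if c then (twoProd p a b).2 else 0)
    (∀ k, IsFloat p (B' k)) ∧
      OpCost B B' (opCost u D P R |a * b|) (a * b) (opErr u D P R |a * b|) := by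
  intro B'
  have hup := h.u_pos
  have hu1 := h.u_le
  have hDp := h.D_pos
  have hP := h.P_pos
  by_cases hab : a * b = 0
  · have hB' : B' = B := by
      simp only [B', accumulateProd, hab, rn_zero, twoProd, sub_self, ite_self]
      exact accumulate_zero hp β hB _ _
    rw [hB']
    refine ⟨hB, OpCost.refl ?_ ?_⟩
    · intro K
      rw [hab, abs_zero, opCost]
      have := h.opBound_nonneg K
      split_ifs <;> simp [this]
    · rw [hab, abs_zero, opErr]
      have := h.rem_nonneg 2
      simp [this]
  have ha : a ≠ 0 := left_ne_zero_of_mul hab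
  have hb : b ≠ 0 := right_ne_zero_of_mul hab
  have hfar' := hfar hab
  obtain ⟨f1, f2, f3, f4, f5, f6, f7⟩ := product_facts hp ha hb c
  set v := rn p (a * b) with hv
  set e := (if c then (twoProd p a b).2 else 0) with he
  set X := |a * b| with hXdef
  have hX0 : 0 ≤ X := abs_nonneg _
  set d := T - expo a - expo b with hd
  have hd0 : 0 ≤ d := by lia
  set sh := (d / (β : ℤ)).toNat with hsh
  set l := d - (sh : ℤ) * β with hl
  obtain ⟨hl0, hlβ⟩ := bin_index β (by lia) hd0
  rw [← hsh, ← hl] at hl0 hlβ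
  have hB' : B' = accumulate p β B v e sh l := rfl
  have hg : (2 : ℝ) ^ (expo a + expo b) = D ^ sh * W * 2 ^ (-l) := by
    rw [← hD, ← hW]; exact weight_eq β sh l _ T (by lia)
  have hl1 : (2 : ℝ) ^ (-l) ≤ 1 := by
    calc (2 : ℝ) ^ (-l) ≤ 2 ^ (0 : ℤ) := two_zpow_le (by lia)
      _ = 1 := by norm_num
  rw [hu] at f3 f4 f5 f6 f7
  have huX : u * X ≤ 1 / 256 * X := mul_le_mul_of_nonneg_right hu1 hX0
  have hV : |v| ≤ 1.004 * X := by linarith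
  have hgD : (2 : ℝ) ^ (expo a + expo b) ≤ D ^ sh * P := by
    rw [hg]
    calc D ^ sh * W * 2 ^ (-l) ≤ D ^ sh * W * 1 :=
          mul_le_mul_of_nonneg_left hl1 (by have := h.W_pos; positivity)
      _ ≤ D ^ sh * P := by
          rw [mul_one]; exact mul_le_mul_of_nonneg_left h.W_le (by positivity)
  have hVD : |v| ≤ 4 * (D ^ sh * P) := f2.trans (by linarith)
  have heD : |e| ≤ 2 * u * (D ^ sh * P) :=
    f4.trans (mul_le_mul_of_nonneg_left hgD (by linarith))
  have huDP : u * P ≤ D / 4 * P := mul_le_mul_of_nonneg_right h.le_D hP.le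
  have hDP : 0 < D * P := by positivity
  have hvinc : |v| ≤ incBound u D P R (5.7 * u * P) sh := by
    match sh, hVD with
    | 0, _ => simp only [incBound]; have : 0 < u * P := by positivity
              linarith
    | 1, _ => simp only [incBound]; linarith
    | 2, hVD => simp only [incBound]; linarith
    | k + 3, hVD =>
      have := h.rem_nonneg (k + 2)
      simp only [incBound]; linarith
  have he2 : |e| ≤ 0.36 * D ^ 2 * P := by
    have h1 := mul_le_mul_of_nonneg_left hX hup.le
    have h2 := mul_le_mul_of_nonneg_right h.usq_le hP.le
    have : 0 < D ^ 2 * P := by positivity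
    linarith
  have hbb := h.binBounds hu hD hW hB (c₀ := 1.12 * P) (i₀ := 5.7 * u * P) (by positivity) hc (by
    have := mul_le_mul_of_nonneg_right hu1 (show 0 ≤ u * P by positivity)
    have : u * (u * P) ≤ 1 / 256 * (u * P) := by linarith
    linarith)
  have hcase : l < β - ((p : ℤ) - β - 1) → 1 ≤ sh := by
    intro h1
    by_contra h0
    have h0 : sh = 0 := by lia
    rw [h0] at hl
    simp only [Nat.cast_zero, zero_mul, sub_zero] at hl
    lia
  have he1' : l < β - ((p : ℤ) - β - 1) → |e| ≤ epsBound D P (sh + 1) := by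
    intro hl2
    have hD1 : u * (D ^ sh * P) ≤ 1 / 4 * (D ^ (sh + 1) * P) := by
      have := mul_le_mul_of_nonneg_right h.le_D (show 0 ≤ D ^ sh * P by positivity)
      rw [pow_succ]; linarith
    have h1sh := hcase hl2
    obtain ⟨k, hk⟩ := Nat.exists_eq_add_of_le' h1sh
    rw [hk] at hD1 heD ⊢
    match k with
    | 0 => simpa [epsBound] using he2
    | k + 1 =>
      rw [show k + 1 + 1 + 1 = k + 3 by ring] at *
      simp only [epsBound]
      have : 0 < D ^ (k + 3) * P := by positivity
      linarith
  have he2' : β - ((p : ℤ) - β - 1) ≤ l → |e| ≤ epsBound D P (sh + 2) := by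
    intro hl2
    have h1 : 2 * u * 2 ^ (expo a + expo b) ≤ D ^ (sh + 2) * P := by
      have h2 : 2 * u * (2 : ℝ) ^ (-l) ≤ D ^ 2 := by
        rw [← hu, ← hD, binRatio_pow, uro]
        calc 2 * (2 : ℝ) ^ (-(p : ℤ)) * 2 ^ (-l) = 2 ^ (1 + -(p : ℤ) + -l) := by
              rw [two_zpow_add, two_zpow_add]; norm_num
          _ ≤ 2 ^ (-(((2 : ℕ) : ℤ) * β)) := two_zpow_le (by push_cast; lia)
      have h3 := mul_le_mul_of_nonneg_left h2 (show 0 ≤ D ^ sh * W by have := h.W_pos; positivity)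
      have h4 := mul_le_mul_of_nonneg_left h.W_le (show 0 ≤ D ^ (sh + 2) by positivity)
      rw [pow_add] at h4 ⊢
      rw [hg]
      linarith
    match sh, f4.trans h1 with
    | 0, _ => simpa [epsBound] using he2
    | k + 1, h1 => rw [show k + 1 + 2 = k + 3 by ring] at *; simpa [epsBound] using h1
  obtain ⟨Δ, s1, s2, s3, s4, s5⟩ := accumulate_spec hp (by lia) hbb h.eps_anti sh l hvinc he1' he2'
  rw [← hB'] at s1 s2
  refine ⟨s2, ?_⟩
  have hX1 : 2.1 * (|v| + |e|) ≤ 2.12 * X := by linarith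
  have hpt : ∀ k, |B' k - B k| ≤ 2.12 * X := by
    intro k
    by_cases h1 : k < sh
    · rw [s1.eq_of_lt k h1, sub_self, abs_zero]; positivity
    by_cases h2 : sh + 4 ≤ k
    · rw [s1.eq_of_ge k h2, sub_self, abs_zero]; positivity
    obtain ⟨i, rfl⟩ := Nat.exists_eq_add_of_le (not_lt.1 h1)
    rw [s1.sub_eq i (by lia)]
    exact (s3.triv_each i (by lia)).trans hX1
  refine ⟨by simpa [opCost] using hpt 0, by simpa [opCost] using hpt 1, ?_, ?_⟩
  · intro K hK2 hK5
    obtain ⟨t1, t2, t3⟩ := tail_le_of_moveBounds s1 s3 h.rem_anti h.rem_nonneg h.eps_nonneg K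
    rw [opCost, if_neg (by lia)]
    rcases min_choice (6.25 * X) (opBound u D P R K) with hm | hm <;> rw [hm]
    · exact t1.mono (by linarith)
    · by_cases hKs : K ≤ sh
      · refine (t2 hKs).mono (le_trans ?_ (le_max_left _ _))
        have h1 : D ^ sh * P ≤ D ^ K * P := mul_le_mul_of_nonneg_right
          (pow_le_pow_of_le_one hDp.le (by linarith [h.D_le]) hKs) hP.le
        have h2 : |v| + 6.2 * |e| ≤ 4.05 * (D ^ sh * P) := by
          have := mul_le_mul_of_nonneg_right hu1 (show 0 ≤ D ^ sh * P by positivity)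
          have : 0 ≤ D ^ sh * P := by positivity
          linarith
        linarith
      · exact (t3 (by lia)).mono (le_max_right _ _)
  · refine ⟨sh + 4, fun n hn => ?_⟩
    rw [s1.sum_eq hn]
    have hres : |Δ 0 + Δ 1 + Δ 2 + Δ 3 - a * b| ≤
        |Δ 0 + Δ 1 + Δ 2 + Δ 3 - (v + e)| + |a * b - (v + e)| := by
      rw [abs_sub_comm (a * b)]; exact abs_sub_le _ _ _
    have hτ2 : remBound u D P R (sh + 2) ≤ remBound u D P R 2 :=
      antitone_nat_of_succ_le h.rem_anti (by lia)
    have huV : u * (|v| + |e|) ≤ 1.01 * (u * X) := by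
      have := mul_le_mul_of_nonneg_left (show |v| + |e| ≤ 1.01 * X by linarith) hup.le
      linarith
    refine le_min ?_ ?_
    · have := s3.err_triv
      linarith
    · rcases lt_or_ge l (β - ((p : ℤ) - β - 1)) with hl2 | hl2
      · have h1 := s4 hl2
        have h2 := hcase hl2
        rw [MoveErr, hu] at h1
        have h3 := abs_fastTwoSum_snd_sub_le hp (b := v) (hB sh)
        rw [hu] at h3
        have h4 : remBound u D P R (sh + 1) ≤ remBound u D P R 2 :=
          antitone_nat_of_succ_le h.rem_anti (by lia)
        have : 0 ≤ u * |v| := by positivity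
        have : 0 ≤ u * |e| := by positivity
        linarith
      · have h1 := s5 hl2
        rw [hu] at h1
        have : 0 ≤ u * X := by positivity
        linarith

/-- The accumulation of the leading product. The starting value of bin `0` has few bits, so that
the Fast2Sum is error-free. -/
lemma accumulateProd_lead {p β : ℕ} {T : ℤ} {u D P W : ℝ} {R : ℕ → ℝ} (hp : 8 ≤ p)
    (hβ : β + 2 ≤ p) (hβ2 : p + 4 ≤ 2 * β) (hu : uro p = u) (hD : binRatio β = D)
    (hW : (2 : ℝ) ^ T = W) (h : BinSetting u D P W R) {a b : ℝ} (hP : a * b = P)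
    (hT : expo a + expo b = T) (c : Prop) [Decidable c] (hc : c) :
    let B' := accumulateProd p β T (binInit p β T) a b (rn p (a * b))
      (if c then (twoProd p a b).2 else 0)
    (∀ k, IsFloat p (B' k)) ∧
      OpCost (binInit p β T) B' (fun K => if K = 0 then 1.0244 * P else if K = 1 then 1.67 * D * P
        else opBound u D P R K) P
        (remBound u D P R 1 + remBound u D P R 2 + 0.03 * u * P) := by
  intro B'
  have hp1 : 1 ≤ p := by lia
  have hup := h.u_pos
  have hu1 := h.u_le
  have hDp := h.D_pos
  have hP0 := h.P_pos
  have hab : a * b ≠ 0 := by rw [hP]; exact hP0.ne'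
  obtain ⟨f1, f2, f3, f4, f5, f6, f7⟩ :=
    product_facts hp (left_ne_zero_of_mul hab) (right_ne_zero_of_mul hab) c
  have f7 := f7 hc
  set v := rn p (a * b) with hv
  set e := (if c then (twoProd p a b).2 else 0) with he
  rw [hP, abs_of_pos hP0] at f3 f5 f6
  rw [hP, abs_of_pos hP0] at f7
  rw [hu] at f3 f4 f5 f6 f7
  have huP : u * P ≤ 1 / 256 * P := mul_le_mul_of_nonneg_right hu1 hP0.le
  have huP0 : 0 < u * P := by positivity
  have huDP : u * P ≤ D / 4 * P := mul_le_mul_of_nonneg_right h.le_D hP0.le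
  have huu : u * (u * P) ≤ 1 / 256 * (u * P) := mul_le_mul_of_nonneg_right hu1 huP0.le
  have hDP : 0 < D * P := by positivity
  have hDDP : D ^ 2 * P ≤ 1 / 64 * (D * P) := by
    have := mul_le_mul_of_nonneg_right h.D_le hDP.le
    nlinarith
  have hbb := h.binBounds hu hD hW (isFloat_binInit hp β T) (c₀ := 0) (i₀ := 1.004 * P)
    (by positivity) (by
      intro k
      rw [sub_self, abs_zero]
      match k with
      | 0 => simp [contBound]
      | 1 => simp only [contBound]; positivity
      | k + 2 => have := h.R_nonneg (k + 2); simp only [contBound]; positivity) (by linarith)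
  have hd : T - expo a - expo b = 0 := by lia
  have hB' : B' = accumulate p β (binInit p β T) v e 0 0 := by
    simp only [B', accumulateProd, hd]
    simp [v, e]
  have hcase : (0 : ℤ) < β - ((p : ℤ) - β - 1) := by lia
  obtain ⟨Δ, s1, s2, s3, s4, -⟩ := accumulate_spec hp (by lia) hbb h.eps_anti 0 0 (v := v) (e := e)
    (by simp only [incBound]; linarith) (fun _ => by simp only [epsBound]; linarith)
    (fun h => absurd hcase (not_lt.2 h))
  rw [← hB'] at s1 s2
  refine ⟨s2, ?_⟩
  have hD0 : remBound u D P R 0 = 1.3 * D * P := rfl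
  have hD1 : remBound u D P R 1 = 3.7 * D ^ 2 * P := rfl
  refine ⟨?_, ?_, ?_, ?_⟩
  · have h1 := s3.zero
    have h2 := s1.sub_eq 0 (by lia)
    simp only [add_zero, if_true] at *
    rw [h2]
    have := mul_le_mul_of_nonneg_right h.D_le hP0.le
    linarith
  · have h1 := s3.one
    have h2 := s1.sub_eq 1 (by lia)
    simp only [zero_add, if_true, one_ne_zero, if_false] at *
    rw [h2]
    linarith
  · intro K hK2 hK5
    rw [if_neg (by lia), if_neg (by lia)]
    obtain ⟨-, -, t3⟩ := tail_le_of_moveBounds s1 s3 h.rem_anti h.rem_nonneg h.eps_nonneg K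
    exact (t3 (by lia)).mono (le_max_right _ _)
  · refine ⟨4, fun n hn => ?_⟩
    rw [s1.sum_eq (by lia)]
    have h1 := s4 hcase
    have hdek : (fastTwoSum p (binInit p β T 0) v).2 =
        binInit p β T 0 + v - rn p (binInit p β T 0 + v) := by
      set z := T - β + p - 2 with hz
      have hI : binInit p β T 0 = 3 * 2 ^ z := by
        rw [binInit, show T - (((0 : ℕ) : ℤ) + 1) * β + p - 1 = z + 1 by rw [hz]; push_cast; ring,
          two_zpow_add]
        norm_num; ring
      have hz2 : (2 : ℝ) ^ (z + 2) ≤ 2 ^ (z + p) := two_zpow_le (by lia)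
      have hz4 : (2 : ℝ) ^ (z + 2) = 4 * 2 ^ z := by rw [two_zpow_add]; norm_num; ring
      have hz0 := two_zpow_pos z
      refine fastTwoSum_snd_eq (k := z) hp1 ⟨3, by rw [hI]; norm_num⟩ ?_ (isFloat_rn hp1 _) ?_
      · rw [hI, abs_of_pos (by positivity)]; linarith
      · refine f2.trans_lt ?_
        rw [hT]
        calc 4 * (2 : ℝ) ^ T = 2 ^ (T + 2) := by rw [two_zpow_add]; norm_num; ring
          _ < 2 ^ (z + p) := two_zpow_lt (by lia)
    rw [MoveErr, hu, hdek, sub_self, abs_zero] at h1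
    simp only [zero_add] at h1
    have hres : |Δ 0 + Δ 1 + Δ 2 + Δ 3 - P| ≤
        |Δ 0 + Δ 1 + Δ 2 + Δ 3 - (v + e)| + |P - (v + e)| := by
      rw [abs_sub_comm P]; exact abs_sub_le _ _ _
    have := mul_le_mul_of_nonneg_left f5 hup.le
    linarith

/-! ### Sums over index pairs -/

lemma sum_le_of_subset_union {α : Type*} [DecidableEq α] {F A B : Finset α} (h : F ⊆ A ∪ B)
    {f : α → ℝ} (hf : ∀ q, 0 ≤ f q) : ∑ q ∈ F, f q ≤ ∑ q ∈ A, f q + ∑ q ∈ B, f q := by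
  rw [← Finset.sum_union_inter]
  have h1 := Finset.sum_le_sum_of_subset_of_nonneg h (fun q _ _ => hf q)
  have h2 : 0 ≤ ∑ q ∈ A ∩ B, f q := Finset.sum_nonneg fun q _ => hf q
  linarith

lemma sum_rect_le {a b : ℕ → ℝ} (ha : ∀ i, 0 ≤ a i) (hb : ∀ i, 0 ≤ b i) {s t : Finset ℕ}
    {A B : ℝ} (hA : ∑ i ∈ s, a i ≤ A) (hB : ∑ j ∈ t, b j ≤ B) :
    ∑ q ∈ s ×ˢ t, a q.1 * b q.2 ≤ A * B := by
  rw [Finset.sum_product, ← Finset.sum_mul_sum]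
  exact mul_le_mul hA hB (Finset.sum_nonneg fun i _ => hb i)
    ((Finset.sum_nonneg fun i _ => ha i).trans hA)

/-- The sequence `a` is nonnegative, and its sum from `k` to `m` is at most `A k`. -/
structure TailBounds (m : ℕ) (a : ℕ → ℝ) (A : ℕ → ℝ) : Prop where
  nonneg : ∀ i, 0 ≤ a i
  tail : ∀ k ≤ 4, ∑ i ∈ Finset.Ico k m, a i ≤ A k

lemma TailBounds.rect_le {m n : ℕ} {a b A B : ℕ → ℝ} (ha : TailBounds m a A)
    (hb : TailBounds n b B) {j k : ℕ} (hj : j ≤ 4) (hk : k ≤ 4) :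
    ∑ q ∈ Finset.Ico j m ×ˢ Finset.Ico k n, a q.1 * b q.2 ≤ A j * B k :=
  sum_rect_le ha.nonneg hb.nonneg (ha.tail j hj) (hb.tail k hk)

lemma TailBounds.row_le {m n : ℕ} {a b A B : ℕ → ℝ} (ha : TailBounds m a A)
    (hb : TailBounds n b B) {k : ℕ} (hk : k ≤ 4) :
    ∑ q ∈ ({0} : Finset ℕ) ×ˢ Finset.Ico k n, a q.1 * b q.2 ≤ a 0 * B k :=
  sum_rect_le ha.nonneg hb.nonneg (by simp) (hb.tail k hk)

lemma sum_pairs_one_le {m n : ℕ} {a b A B : ℕ → ℝ} (ha : TailBounds m a A)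
    (hb : TailBounds n b B) {F : Finset (ℕ × ℕ)} (hF : F ⊆ Finset.range m ×ˢ Finset.range n)
    (h : ∀ q ∈ F, q ≠ (0, 0)) :
    ∑ q ∈ F, a q.1 * b q.2 ≤ a 0 * B 1 + A 1 * B 0 := by
  have hf : ∀ q : ℕ × ℕ, 0 ≤ a q.1 * b q.2 := fun q => mul_nonneg (ha.nonneg _) (hb.nonneg _)
  refine (sum_le_of_subset_union (A := {0} ×ˢ Finset.Ico 1 n)
    (B := Finset.Ico 1 m ×ˢ Finset.Ico 0 n) ?_ hf).trans
    (add_le_add (TailBounds.row_le ha hb (by lia)) (TailBounds.rect_le ha hb (by lia) (by lia)))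
  rintro ⟨i, j⟩ hq
  have h1 := hF hq
  have h2 := h _ hq
  simp only [Finset.mem_union, Finset.mem_product, Finset.mem_singleton, Finset.mem_Ico,
    Finset.mem_range, ne_eq, Prod.mk.injEq] at *
  lia

lemma sum_pairs_three_le {m n : ℕ} {a b A B : ℕ → ℝ} (ha : TailBounds m a A)
    (hb : TailBounds n b B) {F : Finset (ℕ × ℕ)} (hF : F ⊆ Finset.range m ×ˢ Finset.range n)
    (h : ∀ q ∈ F, 3 ≤ q.1 + q.2) :
    ∑ q ∈ F, a q.1 * b q.2 ≤ a 0 * B 3 + A 1 * B 2 + A 2 * B 1 + A 3 * B 0 := by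
  have hf : ∀ q : ℕ × ℕ, 0 ≤ a q.1 * b q.2 := fun q => mul_nonneg (ha.nonneg _) (hb.nonneg _)
  have hsub : F ⊆ (({0} ×ˢ Finset.Ico 3 n ∪ Finset.Ico 1 m ×ˢ Finset.Ico 2 n) ∪
      Finset.Ico 2 m ×ˢ Finset.Ico 1 n) ∪ Finset.Ico 3 m ×ˢ Finset.Ico 0 n := by
    rintro ⟨i, j⟩ hq
    have h1 := hF hq
    have h2 := h _ hq
    simp only [Finset.mem_union, Finset.mem_product, Finset.mem_singleton, Finset.mem_Ico,
      Finset.mem_range] at *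
    lia
  refine (sum_le_of_subset_union hsub hf).trans (add_le_add ?_ (TailBounds.rect_le ha hb (by lia) (by lia)))
  refine (sum_le_of_subset_union subset_rfl hf).trans (add_le_add ?_ (TailBounds.rect_le ha hb (by lia) (by lia)))
  exact (sum_le_of_subset_union subset_rfl hf).trans
    (add_le_add (TailBounds.row_le ha hb (by lia)) (TailBounds.rect_le ha hb (by lia) (by lia)))

lemma sum_pairs_four_le {m n : ℕ} {a b A B : ℕ → ℝ} (ha : TailBounds m a A)
    (hb : TailBounds n b B) {F : Finset (ℕ × ℕ)} (hF : F ⊆ Finset.range m ×ˢ Finset.range n)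
    (h : ∀ q ∈ F, 4 ≤ q.1 + q.2) :
    ∑ q ∈ F, a q.1 * b q.2 ≤ a 0 * B 4 + A 1 * B 3 + A 2 * B 2 + A 3 * B 1 + A 4 * B 0 := by
  have hf : ∀ q : ℕ × ℕ, 0 ≤ a q.1 * b q.2 := fun q => mul_nonneg (ha.nonneg _) (hb.nonneg _)
  have hsub : F ⊆ ((({0} ×ˢ Finset.Ico 4 n ∪ Finset.Ico 1 m ×ˢ Finset.Ico 3 n) ∪
      Finset.Ico 2 m ×ˢ Finset.Ico 2 n) ∪ Finset.Ico 3 m ×ˢ Finset.Ico 1 n) ∪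
      Finset.Ico 4 m ×ˢ Finset.Ico 0 n := by
    rintro ⟨i, j⟩ hq
    have h1 := hF hq
    have h2 := h _ hq
    simp only [Finset.mem_union, Finset.mem_product, Finset.mem_singleton, Finset.mem_Ico,
      Finset.mem_range] at *
    lia
  refine (sum_le_of_subset_union hsub hf).trans (add_le_add ?_ (TailBounds.rect_le ha hb (by lia) (by lia)))
  refine (sum_le_of_subset_union subset_rfl hf).trans (add_le_add ?_ (TailBounds.rect_le ha hb (by lia) (by lia)))
  refine (sum_le_of_subset_union subset_rfl hf).trans (add_le_add ?_ (TailBounds.rect_le ha hb (by lia) (by lia)))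
  exact (sum_le_of_subset_union subset_rfl hf).trans
    (add_le_add (TailBounds.row_le ha hb (by lia)) (TailBounds.rect_le ha hb (by lia) (by lia)))

/-- The pairs outside the first row and column, apart from those with `i + j ≤ 4`. -/
lemma sum_pairs_inner_le {m n : ℕ} {a b A B : ℕ → ℝ} (ha : TailBounds m a A)
    (hb : TailBounds n b B) {F : Finset (ℕ × ℕ)} (hF : F ⊆ Finset.range m ×ˢ Finset.range n)
    (h : ∀ q ∈ F, 1 ≤ q.1 ∧ 1 ≤ q.2 ∧ 5 ≤ q.1 + q.2) :
    ∑ q ∈ F, a q.1 * b q.2 ≤ A 1 * B 4 + A 2 * B 3 + A 3 * B 2 + A 4 * B 1 := by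
  have hf : ∀ q : ℕ × ℕ, 0 ≤ a q.1 * b q.2 := fun q => mul_nonneg (ha.nonneg _) (hb.nonneg _)
  have hsub : F ⊆ ((Finset.Ico 1 m ×ˢ Finset.Ico 4 n ∪ Finset.Ico 2 m ×ˢ Finset.Ico 3 n) ∪
      Finset.Ico 3 m ×ˢ Finset.Ico 2 n) ∪ Finset.Ico 4 m ×ˢ Finset.Ico 1 n := by
    rintro ⟨i, j⟩ hq
    have h1 := hF hq
    have h2 := h _ hq
    simp only [Finset.mem_union, Finset.mem_product, Finset.mem_Ico, Finset.mem_range] at *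
    lia
  refine (sum_le_of_subset_union hsub hf).trans (add_le_add ?_ (TailBounds.rect_le ha hb (by lia) (by lia)))
  refine (sum_le_of_subset_union subset_rfl hf).trans (add_le_add ?_ (TailBounds.rect_le ha hb (by lia) (by lia)))
  exact (sum_le_of_subset_union subset_rfl hf).trans
    (add_le_add (TailBounds.rect_le ha hb (by lia) (by lia)) (TailBounds.rect_le ha hb (by lia) (by lia)))

/-- Splitting a sum of minima: `Q` for the pairs in `S`, the product for the others. -/
lemma sum_min_le {F S : Finset (ℕ × ℕ)} {f : ℕ × ℕ → ℝ} {Q M N : ℝ} (hQ : 0 ≤ Q)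
    (hS : ((F.filter (· ∈ S)).card : ℝ) ≤ N) (hM : ∑ q ∈ F.filter (· ∉ S), f q ≤ M) :
    ∑ q ∈ F, min (f q) Q ≤ N * Q + M := by
  rw [← Finset.sum_filter_add_sum_filter_not F (· ∈ S)]
  refine add_le_add ?_ (le_trans (Finset.sum_le_sum fun q _ => min_le_left _ _) hM)
  calc ∑ q ∈ F with q ∈ S, min (f q) Q ≤ ∑ q ∈ F with q ∈ S, Q :=
        Finset.sum_le_sum fun q _ => min_le_right _ _
    _ = ((F.filter (· ∈ S)).card : ℝ) * Q := by rw [Finset.sum_const, nsmul_eq_mul]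
    _ ≤ N * Q := mul_le_mul_of_nonneg_right hS hQ

/-- The pairs of `mulPairs` as a set. -/
def pairSet (m n r : ℕ) : Finset (ℕ × ℕ) :=
  (Finset.range m ×ˢ Finset.range n).filter (fun q => q.1 + q.2 ≤ r)

lemma mem_mulPairs {m n r : ℕ} (q : ℕ × ℕ) :
    q ∈ mulPairs m n r ↔ q.1 < m ∧ q.2 < n ∧ q.1 + q.2 ≤ r := by
  obtain ⟨i, j⟩ := q
  simp only [mulPairs, List.mem_flatMap, List.mem_range, List.mem_map, Prod.mk.injEq]
  constructor
  · rintro ⟨i', hi', j', hj', rfl, rfl⟩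
    lia
  · intro h
    exact ⟨i, by lia, j, by lia, rfl, rfl⟩

lemma nodup_mulPairs (m n r : ℕ) : (mulPairs m n r).Nodup := by
  rw [mulPairs, List.nodup_flatMap]
  refine ⟨fun i _ => (List.nodup_range).map fun j j' h => by simpa using h, ?_⟩
  refine (List.nodup_range (n := min m (r + 1))).imp fun {i i'} h => ?_
  simp only [Function.onFun, List.disjoint_left, List.mem_map]
  rintro _ ⟨j, -, rfl⟩ ⟨j', -, h'⟩
  exact h (by simpa using (Prod.ext_iff.1 h').1.symm)

lemma mulPairs_eq_cons {m n r : ℕ} (hm : 1 ≤ m) (hn : 1 ≤ n) :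
    ∃ t, mulPairs m n r = (0, 0) :: t := by
  obtain ⟨m', hm'⟩ := Nat.exists_eq_add_of_le' (show 1 ≤ min m (r + 1) by lia)
  obtain ⟨n', hn'⟩ := Nat.exists_eq_add_of_le' (show 1 ≤ min n (r - 0 + 1) by lia)
  rw [mulPairs, hm', List.range_succ_eq_map, List.flatMap_cons, hn', List.range_succ_eq_map]
  exact ⟨_, rfl⟩

lemma sum_map_eq_sum_finset {α : Type*} [DecidableEq α] {l : List α} (hl : l.Nodup) {F : Finset α}
    (hF : ∀ q, q ∈ F ↔ q ∈ l) (f : α → ℝ) : (l.map f).sum = ∑ q ∈ F, f q := by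
  have : F = l.toFinset := by ext q; simp [hF]
  rw [this, List.sum_toFinset f hl]

lemma nrm_drop_eq (x : List ℝ) (k : ℕ) :
    nrm (x.drop k) = ∑ i ∈ Finset.Ico k x.length, |x.getD i 0| := by
  induction x generalizing k with
  | nil => simp
  | cons a x ih =>
    cases k with
    | zero =>
      have h := ih 0
      simp only [List.drop_zero] at h
      rw [List.drop_zero, nrm_cons, h, List.length_cons, ← Finset.range_eq_Ico,
        ← Finset.range_eq_Ico, Finset.sum_range_succ']
      simp [add_comm]
    | succ k =>
      rw [List.drop_succ_cons, ih, List.length_cons, ← Finset.sum_Ico_add' _ k x.length 1]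
      simp

lemma sum_eq_sum_getD (x : List ℝ) : x.sum = ∑ i ∈ Finset.range x.length, x.getD i 0 := by
  induction x with
  | nil => simp
  | cons a x ih => rw [List.sum_cons, List.length_cons, Finset.sum_range_succ', ih]; simp [add_comm]

/-! ### Shapes of expansions and the parameters of a multiplication -/

/-- The shape of an expansion with positive leading term: relative to the leading term and in units
of the unit roundoff, the terms from number `k` on have absolute sum at most `a k`. -/
structure Shape (p : ℕ) (x : List ℝ) (a₁ a₂ a₃ a₄ : ℝ) : Prop where
  isFloat : ∀ a ∈ x, IsFloat p a
  pos : 0 < lead x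
  tail₁ : nrm (x.drop 1) ≤ a₁ * uro p * lead x
  tail₂ : nrm (x.drop 2) ≤ a₂ * uro p * lead x
  tail₃ : nrm (x.drop 3) ≤ a₃ * uro p * lead x
  tail₄ : nrm (x.drop 4) ≤ a₄ * uro p * lead x

/-- The numerical data in the analysis of a multiplication: the shapes `x`, `y` of the factors, a
bound `ν` for `u` times the number of terms, bounds `R k` for the contents of the bins from number `k`
on, and bounds `t k` for the remainders that leave bin `k`. They are relative to the leading product and
in units of `u`, except `t k` for `k ≥ 3`, whose unit is `u ^ 2`. The estimate `u ≤ 1 / 256` is used to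
turn `u ^ 2` into `u / 256`. -/
structure MulParams where
  (x₁ x₂ x₃ x₄ y₁ y₂ y₃ y₄ ν R₂ R₃ R₄ R₅ t₂ t₃ t₄ t₅ : ℝ)

namespace MulParams

variable (m : MulParams)

/-- Bound for the products other than the leading one. -/
def M₁ : ℝ := m.y₁ + m.x₁ * (1 + m.y₁ / 256)

/-- Bound for the products with `3 ≤ i + j`. -/
def M₂ : ℝ := m.y₃ + (m.x₁ * m.y₂ + m.x₂ * m.y₁) / 256 + m.x₃ * (1 + m.y₁ / 256)

/-- Bound for the products with `4 ≤ i + j`. -/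
def M₃ : ℝ := m.y₄ + (m.x₁ * m.y₃ + m.x₂ * m.y₂ + m.x₃ * m.y₁) / 256 + m.x₄ * (1 + m.y₁ / 256)

/-- Bound for the products with `1 ≤ i`, `1 ≤ j` and `5 ≤ i + j`. -/
def M₄ : ℝ := (m.x₁ * m.y₄ + m.x₂ * m.y₃ + m.x₃ * m.y₂ + m.x₄ * m.y₁) / 256

/-- The bounds for the contents of the bins, as a function of the number of the bin. -/
def R (k : ℕ) : ℝ := if k ≤ 2 then m.R₂ else if k = 3 then m.R₃ else if k = 4 then m.R₄ else m.R₅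

/-- The error of the accumulation. -/
def accErr : ℝ := 3.7 / 16 + 11 * m.t₂ + 0.03 + 7.6 * m.M₁ / 256 + 1.12 * m.M₂

/-- The inequalities that make the bounds for the contents of the bins self-consistent. -/
structure Valid : Prop where
  x₁_nonneg : 0 ≤ m.x₁
  x₂_nonneg : 0 ≤ m.x₂
  x₃_nonneg : 0 ≤ m.x₃
  x₄_nonneg : 0 ≤ m.x₄
  y₁_nonneg : 0 ≤ m.y₁
  y₂_nonneg : 0 ≤ m.y₂
  y₃_nonneg : 0 ≤ m.y₃
  y₄_nonneg : 0 ≤ m.y₄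
  x₁_le : m.x₁ ≤ 5.6
  y₁_le : m.y₁ ≤ 5.6
  R₅_nonneg : 0 ≤ m.R₅
  R₅_le : m.R₅ ≤ m.R₄
  R₄_le : m.R₄ ≤ m.R₃
  R₃_le : m.R₃ ≤ 0.9 * m.R₂
  R₂_le : m.R₂ ≤ 16
  t₂_ge : 3.02 / 1024 + 1.03 * m.R₂ / 256 ≤ m.t₂
  t₃_ge : 1.03 * (3.25 / 256 + 2 * m.t₂ + m.R₃) ≤ m.t₃
  t₄_ge : 1.03 * (3.25 / 16384 + 2 * m.t₃ / 256 + m.R₄) ≤ m.t₄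
  t₅_ge : 1.03 * (3.25 / 1048576 + 2 * m.t₄ / 256 + m.R₅) ≤ m.t₅
  R₂_ge : 6 * (4.05 / 16 + 5 * m.t₂) + 6.25 * m.M₂ ≤ m.R₂
  R₂_ge' : 6 * ((3.7 + 6.2 * 0.36) / 16 + 3 * m.t₂) + 6.25 * m.M₂ ≤ m.R₂
  R₃_ge : 10 * (4.05 / 1024 + 5 * m.t₃ / 256) + 6.25 * m.M₃ ≤ m.R₃
  R₃_ge' : 10 * (m.t₂ + 3 * m.t₃ / 256 + 6.2 / 1024) + 6.25 * m.M₃ ≤ m.R₃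
  R₄_ge : m.ν * (4.05 / 256 + 5 * m.t₄) + 6.25 * m.M₄ ≤ m.R₄
  R₄_ge' : m.ν * (m.t₃ + 3 * m.t₄ + 6.2 / 256) + 6.25 * m.M₄ ≤ m.R₄
  R₅_ge : m.ν * (4.05 / 16384 + 5 * m.t₅) + 6.25 * m.M₄ ≤ m.R₅
  R₅_ge' : m.ν * (m.t₄ + 3 * m.t₅ + 6.2 / 16384) + 6.25 * m.M₄ ≤ m.R₅

variable {m}

lemma R_two : m.R 2 = m.R₂ := by simp [R]

lemma R_three : m.R 3 = m.R₃ := by simp [R]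

lemma R_four : m.R 4 = m.R₄ := by simp [R]

lemma R_five : m.R 5 = m.R₅ := by simp [R]

lemma Valid.R_nonneg (h : m.Valid) (k : ℕ) : 0 ≤ m.R k := by
  have h1 := h.R₅_nonneg
  have h2 := h.R₅_le
  have h3 := h.R₄_le
  have h4 := h.R₃_le
  unfold R
  split_ifs <;> linarith

lemma Valid.R_anti (h : m.Valid) (k : ℕ) : m.R (k + 1) ≤ m.R k := by
  have h1 := h.R₅_nonneg
  have h2 := h.R₅_le
  have h3 := h.R₄_le
  have h4 := h.R₃_le
  unfold R
  split_ifs <;> first | lia | linarith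

variable {u D P W : ℝ}

lemma Valid.binSetting (h : m.Valid) (hu : 0 < u) (hu1 : u ≤ 1 / 256) (hD : 0 < D)
    (hD1 : D ≤ 1 / 64) (hsq : D ^ 2 ≤ u / 16) (huD : u ≤ D / 4) (hW : 0 < W) (hWP : W ≤ P) :
    BinSetting u D P W m.R :=
  ⟨hu, hu1, hD, hD1, hsq, huD, hW, hWP, h.R_nonneg, h.R_anti, by simpa [R] using h.R₂_le,
    by simpa [R] using h.R₃_le⟩

/-- The numbers `t k` bound the remainders. -/
lemma Valid.rem_le (h : m.Valid) (hs : BinSetting u D P W m.R) :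
    remBound u D P m.R 1 ≤ 3.7 / 16 * (u * P) ∧ remBound u D P m.R 2 ≤ m.t₂ * (u * P) ∧
    remBound u D P m.R 3 ≤ m.t₃ * (u * (u * P)) ∧ remBound u D P m.R 4 ≤ m.t₄ * (u * (u * P)) ∧
    remBound u D P m.R 5 ≤ m.t₅ * (u * (u * P)) := by
  have hu := hs.u_pos
  have hu1 := hs.u_le
  have hD := hs.D_pos
  have hP := hs.P_pos
  have hU : 0 < u * P := by positivity
  have d2 : D ^ 2 * P ≤ 1 / 16 * (u * P) := by
    have := mul_le_mul_of_nonneg_right hs.sq_le hP.le; linarith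
  have dstep : ∀ k, D ^ (k + 1) * P ≤ 1 / 64 * (D ^ k * P) := fun k => by
    have := mul_le_mul_of_nonneg_right hs.D_le (show 0 ≤ D ^ k * P by positivity)
    rw [pow_succ]; linarith
  have d3 : D ^ 3 * P ≤ 1 / 1024 * (u * P) := by linarith [dstep 2]
  have d4 : D ^ 4 * P ≤ 1 / 256 * (u * (u * P)) := by
    have := mul_le_mul hs.sq_le hs.sq_le (by positivity) (by linarith)
    have := mul_le_mul_of_nonneg_right this hP.le
    have e : D ^ 4 = D ^ 2 * D ^ 2 := by ring
    rw [e]; linarith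
  have d5 : D ^ 5 * P ≤ 1 / 16384 * (u * (u * P)) := by linarith [dstep 4]
  have d6 : D ^ 6 * P ≤ 1 / 1048576 * (u * (u * P)) := by linarith [dstep 5]
  have hR2 : 0 ≤ m.R₂ := by simpa [R] using h.R_nonneg 2
  have hR3 : 0 ≤ m.R₃ := by simpa [R] using h.R_nonneg 3
  have hR4 : 0 ≤ m.R₄ := by simpa [R] using h.R_nonneg 4
  have huu : u * (u * P) ≤ 1 / 256 * (u * P) := mul_le_mul_of_nonneg_right hu1 hU.le
  have r2 : remBound u D P m.R 2 ≤ m.t₂ * (u * P) := by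
    have e : remBound u D P m.R 2 = 3.02 * D ^ 3 * P + 1.03 * u * (m.R₂ * u * P) := by
      simp [remBound, R]
    have h1 := mul_le_mul_of_nonneg_left huu hR2
    have h2 := mul_le_mul_of_nonneg_right h.t₂_ge hU.le
    rw [e]; linarith
  have r3 : remBound u D P m.R 3 ≤ m.t₃ * (u * (u * P)) := by
    have e : remBound u D P m.R 3 =
        1.03 * (3.25 * D ^ 4 * P + 2 * u * remBound u D P m.R 2 + u * (m.R 3 * u * P)) := rfl
    rw [R_three] at e
    have h1 := mul_le_mul_of_nonneg_left r2 hu.le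
    have h2 := mul_le_mul_of_nonneg_right h.t₃_ge (show 0 ≤ u * (u * P) by positivity)
    rw [e]; linarith
  have r4 : remBound u D P m.R 4 ≤ m.t₄ * (u * (u * P)) := by
    have e : remBound u D P m.R 4 =
        1.03 * (3.25 * D ^ 5 * P + 2 * u * remBound u D P m.R 3 + u * (m.R 4 * u * P)) := rfl
    rw [R_four] at e
    have ht3 : 0 ≤ m.t₃ := by linarith [h.t₃_ge, h.t₂_ge]
    have h1 := mul_le_mul_of_nonneg_left r3 hu.le
    have h3 := mul_le_mul_of_nonneg_left
      (mul_le_mul_of_nonneg_right hu1 (show 0 ≤ u * (u * P) by positivity)) ht3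
    have h2 := mul_le_mul_of_nonneg_right h.t₄_ge (show 0 ≤ u * (u * P) by positivity)
    rw [e]; linarith
  have r5 : remBound u D P m.R 5 ≤ m.t₅ * (u * (u * P)) := by
    have e : remBound u D P m.R 5 =
        1.03 * (3.25 * D ^ 6 * P + 2 * u * remBound u D P m.R 4 + u * (m.R 5 * u * P)) := rfl
    rw [R_five] at e
    have ht4 : 0 ≤ m.t₄ := by linarith [h.t₄_ge, h.t₃_ge, h.t₂_ge]
    have h1 := mul_le_mul_of_nonneg_left r4 hu.le
    have h3 := mul_le_mul_of_nonneg_left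
      (mul_le_mul_of_nonneg_right hu1 (show 0 ≤ u * (u * P) by positivity)) ht4
    have h2 := mul_le_mul_of_nonneg_right h.t₅_ge (show 0 ≤ u * (u * P) by positivity)
    rw [e]; linarith
  exact ⟨by simp only [remBound]; linarith, r2, r3, r4, r5⟩

/-- The budgets for the contents of the bins suffice: `6`, `10` and at most `ν / u` operations
contribute as much as their remainders allow, the others at most in proportion to the product. -/
lemma Valid.budget (h : m.Valid) (hs : BinSetting u D P W m.R) {N : ℝ} (hN0 : 0 ≤ N)
    (hN : N * u ≤ m.ν) :
    6 * opBound u D P m.R 2 + 6.25 * (m.M₂ * (u * P)) ≤ m.R₂ * (u * P) ∧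
    10 * opBound u D P m.R 3 + 6.25 * (m.M₃ * (u * P)) ≤ m.R₃ * (u * P) ∧
    N * opBound u D P m.R 4 + 6.25 * (m.M₄ * (u * P)) ≤ m.R₄ * (u * P) ∧
    N * opBound u D P m.R 5 + 6.25 * (m.M₄ * (u * P)) ≤ m.R₅ * (u * P) := by
  have hu := hs.u_pos
  have hu1 := hs.u_le
  have hD := hs.D_pos
  have hP := hs.P_pos
  have hU : 0 < u * P := by positivity
  have hUU : 0 < u * (u * P) := by positivity
  have d2 : D ^ 2 * P ≤ 1 / 16 * (u * P) := by
    have := mul_le_mul_of_nonneg_right hs.sq_le hP.le; linarith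
  have dstep : ∀ k, D ^ (k + 1) * P ≤ 1 / 64 * (D ^ k * P) := fun k => by
    have := mul_le_mul_of_nonneg_right hs.D_le (show 0 ≤ D ^ k * P by positivity)
    rw [pow_succ]; linarith
  have d3 : D ^ 3 * P ≤ 1 / 1024 * (u * P) := by linarith [dstep 2]
  have d4 : D ^ 4 * P ≤ 1 / 256 * (u * (u * P)) := by
    have := mul_le_mul hs.sq_le hs.sq_le (by positivity) (by linarith)
    have := mul_le_mul_of_nonneg_right this hP.le
    have e : D ^ 4 = D ^ 2 * D ^ 2 := by ring
    rw [e]; linarith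
  have d5 : D ^ 5 * P ≤ 1 / 16384 * (u * (u * P)) := by linarith [dstep 4]
  have huu : u * (u * P) ≤ 1 / 256 * (u * P) := mul_le_mul_of_nonneg_right hu1 hU.le
  obtain ⟨r1, r2, r3, r4, r5⟩ := h.rem_le hs
  have hR2 : 0 ≤ m.R₂ := by simpa [R] using h.R_nonneg 2
  have hR3 : 0 ≤ m.R₃ := by simpa [R] using h.R_nonneg 3
  have hR4 : 0 ≤ m.R₄ := by simpa [R] using h.R_nonneg 4
  have ht3 : 0 ≤ m.t₃ := by linarith [h.t₃_ge, h.t₂_ge]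
  have ht4 : 0 ≤ m.t₄ := by linarith [h.t₄_ge]
  have hr3 : m.t₃ * (u * (u * P)) ≤ m.t₃ * (1 / 256 * (u * P)) := mul_le_mul_of_nonneg_left huu ht3
  have hNU : N * (u * (u * P)) ≤ m.ν * (u * P) := by
    have := mul_le_mul_of_nonneg_right hN hU.le
    linarith
  refine ⟨?_, ?_, ?_, ?_⟩
  · rw [opBound]
    rcases max_choice (4.05 * D ^ 2 * P + 5 * remBound u D P m.R 2)
      (remBound u D P m.R (2 - 1) + 3 * remBound u D P m.R 2 + 6.2 * epsBound D P 2) with hm | hm <;>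
      rw [hm]
    · have := mul_le_mul_of_nonneg_right h.R₂_ge hU.le
      linarith
    · have := mul_le_mul_of_nonneg_right h.R₂_ge' hU.le
      simp only [epsBound, show 2 - 1 = 1 by lia]
      have e : remBound u D P m.R 1 = 3.7 * D ^ 2 * P := rfl
      rw [e]
      linarith
  · rw [opBound]
    rcases max_choice (4.05 * D ^ 3 * P + 5 * remBound u D P m.R 3)
      (remBound u D P m.R (3 - 1) + 3 * remBound u D P m.R 3 + 6.2 * epsBound D P 3) with hm | hm <;>
      rw [hm]
    · have := mul_le_mul_of_nonneg_right h.R₃_ge hU.le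
      linarith
    · have := mul_le_mul_of_nonneg_right h.R₃_ge' hU.le
      simp only [epsBound, show 3 - 1 = 2 by lia, zero_add]
      linarith
  · rw [opBound]
    rcases max_choice (4.05 * D ^ 4 * P + 5 * remBound u D P m.R 4)
      (remBound u D P m.R (4 - 1) + 3 * remBound u D P m.R 4 + 6.2 * epsBound D P 4) with hm | hm <;>
      rw [hm]
    · have h1 := mul_le_mul_of_nonneg_right h.R₄_ge hU.le
      have hq : 0 ≤ 4.05 / 256 + 5 * m.t₄ := by linarith
      have h2 := mul_le_mul_of_nonneg_left (show 4.05 * D ^ 4 * P + 5 * remBound u D P m.R 4 ≤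
        (4.05 / 256 + 5 * m.t₄) * (u * (u * P)) by linarith) hN0
      have h3 := mul_le_mul_of_nonneg_right hNU hq
      linarith
    · have h1 := mul_le_mul_of_nonneg_right h.R₄_ge' hU.le
      have hq : 0 ≤ m.t₃ + 3 * m.t₄ + 6.2 / 256 := by linarith
      simp only [epsBound, show 4 - 1 = 3 by lia, Nat.reduceAdd]
      have h2 := mul_le_mul_of_nonneg_left (show remBound u D P m.R 3 + 3 * remBound u D P m.R 4 +
        6.2 * (D ^ 4 * P) ≤ (m.t₃ + 3 * m.t₄ + 6.2 / 256) * (u * (u * P)) by linarith) hN0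
      have h3 := mul_le_mul_of_nonneg_right hNU hq
      linarith
  · have ht5 : 0 ≤ m.t₅ := by linarith [h.t₅_ge, h.R₅_nonneg]
    rw [opBound]
    rcases max_choice (4.05 * D ^ 5 * P + 5 * remBound u D P m.R 5)
      (remBound u D P m.R (5 - 1) + 3 * remBound u D P m.R 5 + 6.2 * epsBound D P 5) with hm | hm <;>
      rw [hm]
    · have h1 := mul_le_mul_of_nonneg_right h.R₅_ge hU.le
      have h2 := mul_le_mul_of_nonneg_left (show 4.05 * D ^ 5 * P + 5 * remBound u D P m.R 5 ≤
        (4.05 / 16384 + 5 * m.t₅) * (u * (u * P)) by linarith) hN0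
      have h3 := mul_le_mul_of_nonneg_right hNU (show 0 ≤ 4.05 / 16384 + 5 * m.t₅ by linarith)
      linarith
    · have h1 := mul_le_mul_of_nonneg_right h.R₅_ge' hU.le
      simp only [epsBound, show 5 - 1 = 4 by lia, Nat.reduceAdd]
      have h2 := mul_le_mul_of_nonneg_left (show remBound u D P m.R 4 + 3 * remBound u D P m.R 5 +
        6.2 * (D ^ 5 * P) ≤ (m.t₄ + 3 * m.t₅ + 6.2 / 16384) * (u * (u * P)) by linarith) hN0
      have h3 := mul_le_mul_of_nonneg_right hNU
        (show 0 ≤ m.t₄ + 3 * m.t₅ + 6.2 / 16384 by linarith)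
      linarith

end MulParams

/-! ### The bins after all products -/

lemma nrm_eq_of_lead_pos {x : List ℝ} (h : 0 < lead x) : nrm x = lead x + nrm (x.drop 1) := by
  cases x with
  | nil => simp [lead] at h
  | cons a l =>
    rw [lead_cons] at *
    rw [nrm_cons, abs_of_pos h]
    simp

namespace Shape

variable {p : ℕ} {x : List ℝ} {a₁ a₂ a₃ a₄ : ℝ}

lemma ne_nil (h : Shape p x a₁ a₂ a₃ a₄) : x ≠ [] := by
  rintro rfl
  exact absurd h.pos (by simp [lead])

lemma getD_zero (x : List ℝ) : x.getD 0 0 = lead x := by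
  cases x <;> simp [lead]

lemma nrm_eq (h : Shape p x a₁ a₂ a₃ a₄) : nrm x = lead x + nrm (x.drop 1) :=
  nrm_eq_of_lead_pos h.pos

lemma sum_eq (h : Shape p x a₁ a₂ a₃ a₄) : x.sum = lead x + (x.drop 1).sum := by
  cases x with
  | nil => exact absurd rfl h.ne_nil
  | cons a l => simp [lead_cons]

lemma abs_sum_sub_lead_le (h : Shape p x a₁ a₂ a₃ a₄) :
    |x.sum - lead x| ≤ a₁ * uro p * lead x := by
  rw [h.sum_eq, add_sub_cancel_left]
  exact (abs_sum_le_nrm _).trans h.tail₁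

lemma abs_getD_le (h : Shape p x a₁ a₂ a₃ a₄) {i : ℕ} (hi : 1 ≤ i) :
    |x.getD i 0| ≤ a₁ * uro p * lead x := by
  refine le_trans ?_ h.tail₁
  rw [nrm_drop_eq]
  by_cases hil : i < x.length
  · exact Finset.single_le_sum (f := fun i => |x.getD i 0|) (fun _ _ => abs_nonneg _)
      (Finset.mem_Ico.2 ⟨hi, hil⟩)
  · rw [List.getD_eq_default _ _ (not_lt.1 hil), abs_zero]
    exact Finset.sum_nonneg fun _ _ => abs_nonneg _

lemma expo_getD_le (h : Shape p x a₁ a₂ a₃ a₄) (ha : a₁ ≤ 5.6) {i : ℕ} (hi : 1 ≤ i)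
    (h0 : x.getD i 0 ≠ 0) : expo (x.getD i 0) + p ≤ expo (lead x) + 3 := by
  have h1 := h.abs_getD_le hi
  have h2 := lt_zpow_expo (lead x)
  rw [abs_of_pos h.pos] at h2
  have hu := uro_pos p
  have h3 : |x.getD i 0| < 2 ^ (expo (lead x) - p + 4) := by
    have e1 : (2 : ℝ) ^ (expo (lead x) + 1) = 2 * 2 ^ expo (lead x) := by
      rw [two_zpow_add]; norm_num; ring
    have e2 : (2 : ℝ) ^ (expo (lead x) - p + 4) = 16 * (uro p * 2 ^ expo (lead x)) := by
      rw [two_zpow_add, sub_eq_add_neg, two_zpow_add, uro]; norm_num; ring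
    have e3 : a₁ * uro p * lead x ≤ 5.6 * (uro p * lead x) := by
      have := mul_le_mul_of_nonneg_right ha (show 0 ≤ uro p * lead x from mul_nonneg hu.le h.pos.le)
      linarith
    have e4 := mul_lt_mul_of_pos_left h2 hu
    have e5 : 0 < uro p * 2 ^ expo (lead x) := mul_pos hu (two_zpow_pos _)
    rw [e1] at e4
    rw [e2]
    linarith
  have := expo_lt h0 h3
  lia

/-- The bounds for the tails as a function. -/
def tailFun (p : ℕ) (x : List ℝ) (a₁ a₂ a₃ a₄ : ℝ) : ℕ → ℝ
  | 0 => (1 + a₁ * uro p) * lead x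
  | 1 => a₁ * uro p * lead x
  | 2 => a₂ * uro p * lead x
  | 3 => a₃ * uro p * lead x
  | _ + 4 => a₄ * uro p * lead x

lemma tailBounds (h : Shape p x a₁ a₂ a₃ a₄) {m : ℕ} (hm : m ≤ x.length) :
    TailBounds m (fun i => |x.getD i 0|) (tailFun p x a₁ a₂ a₃ a₄) := by
  refine ⟨fun _ => abs_nonneg _, fun k hk => ?_⟩
  have h1 : ∑ i ∈ Finset.Ico k m, |x.getD i 0| ≤ nrm (x.drop k) := by
    rw [nrm_drop_eq]
    exact Finset.sum_le_sum_of_subset_of_nonneg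
      (Finset.Ico_subset_Ico_right hm) fun _ _ _ => abs_nonneg _
  refine h1.trans ?_
  interval_cases k
  · have := h.tail₁
    simp only [List.drop_zero, tailFun, h.nrm_eq]
    linarith
  · exact h.tail₁
  · exact h.tail₂
  · exact h.tail₃
  · exact h.tail₄

end Shape

namespace MulParams.Valid

variable {p : ℕ} {m : MulParams} {x y : List ℝ} {a b : ℕ}

lemma sum_pairs_three (hp : 8 ≤ p) (h : m.Valid) (hx : Shape p x m.x₁ m.x₂ m.x₃ m.x₄)
    (hy : Shape p y m.y₁ m.y₂ m.y₃ m.y₄) (ha : a ≤ x.length) (hb : b ≤ y.length)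
    {G : Finset (ℕ × ℕ)} (hG : G ⊆ Finset.range a ×ˢ Finset.range b)
    (h3 : ∀ q ∈ G, 3 ≤ q.1 + q.2) :
    ∑ q ∈ G, |x.getD q.1 0 * y.getD q.2 0| ≤ m.M₂ * (uro p * (lead x * lead y)) := by
  have := sum_pairs_three_le (hx.tailBounds ha) (hy.tailBounds hb) hG h3
  have hU : 0 < uro p * (lead x * lead y) := mul_pos (uro_pos p) (mul_pos hx.pos hy.pos)
  have huu := mul_le_mul_of_nonneg_right (uro_le p hp) hU.le
  set u := uro p
  set P := lead x * lead y with hP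
  simp only [abs_mul]
  refine this.trans ?_
  simp only [Shape.getD_zero, abs_of_pos hx.pos, Shape.tailFun, MulParams.M₂]
  have e1 := mul_le_mul_of_nonneg_left huu (mul_nonneg h.x₃_nonneg h.y₁_nonneg)
  have e2 := mul_le_mul_of_nonneg_left huu (mul_nonneg h.x₂_nonneg h.y₁_nonneg)
  have e3 := mul_le_mul_of_nonneg_left huu (mul_nonneg h.x₁_nonneg h.y₂_nonneg)
  have e : lead x * (m.y₃ * u * lead y) + m.x₁ * u * lead x * (m.y₂ * u * lead y) +
      m.x₂ * u * lead x * (m.y₁ * u * lead y) + m.x₃ * u * lead x * ((1 + m.y₁ * u) * lead y) =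
    m.y₃ * (u * P) + m.x₁ * m.y₂ * (u * (u * P)) + m.x₂ * m.y₁ * (u * (u * P)) +
      m.x₃ * (u * P) + m.x₃ * m.y₁ * (u * (u * P)) := by ring
  rw [e]
  linarith

lemma sum_pairs_four (hp : 8 ≤ p) (h : m.Valid) (hx : Shape p x m.x₁ m.x₂ m.x₃ m.x₄)
    (hy : Shape p y m.y₁ m.y₂ m.y₃ m.y₄) (ha : a ≤ x.length) (hb : b ≤ y.length)
    {G : Finset (ℕ × ℕ)} (hG : G ⊆ Finset.range a ×ˢ Finset.range b)
    (h3 : ∀ q ∈ G, 4 ≤ q.1 + q.2) :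
    ∑ q ∈ G, |x.getD q.1 0 * y.getD q.2 0| ≤ m.M₃ * (uro p * (lead x * lead y)) := by
  have := sum_pairs_four_le (hx.tailBounds ha) (hy.tailBounds hb) hG h3
  have hU : 0 < uro p * (lead x * lead y) := mul_pos (uro_pos p) (mul_pos hx.pos hy.pos)
  have huu := mul_le_mul_of_nonneg_right (uro_le p hp) hU.le
  set u := uro p
  set P := lead x * lead y with hP
  simp only [abs_mul]
  refine this.trans ?_
  simp only [Shape.getD_zero, abs_of_pos hx.pos, Shape.tailFun, MulParams.M₃]
  have e0 := mul_le_mul_of_nonneg_left huu (mul_nonneg h.x₄_nonneg h.y₁_nonneg)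
  have e1 := mul_le_mul_of_nonneg_left huu (mul_nonneg h.x₃_nonneg h.y₁_nonneg)
  have e2 := mul_le_mul_of_nonneg_left huu (mul_nonneg h.x₂_nonneg h.y₂_nonneg)
  have e3 := mul_le_mul_of_nonneg_left huu (mul_nonneg h.x₁_nonneg h.y₃_nonneg)
  have e : lead x * (m.y₄ * u * lead y) + m.x₁ * u * lead x * (m.y₃ * u * lead y) +
      m.x₂ * u * lead x * (m.y₂ * u * lead y) + m.x₃ * u * lead x * (m.y₁ * u * lead y) +
      m.x₄ * u * lead x * ((1 + m.y₁ * u) * lead y) =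
    m.y₄ * (u * P) + m.x₁ * m.y₃ * (u * (u * P)) + m.x₂ * m.y₂ * (u * (u * P)) +
      m.x₃ * m.y₁ * (u * (u * P)) + m.x₄ * (u * P) + m.x₄ * m.y₁ * (u * (u * P)) := by ring
  rw [e]
  linarith

end MulParams.Valid

/-- The budgets for the contents of the bins. -/
def budget (D P u : ℝ) (m : MulParams) (K : ℕ) : ℝ :=
  if K = 0 then 1.12 * P else if K = 1 then 7.9 * D * P else m.R K * (u * P)

set_option maxHeartbeats 1600000 in
/-- The bins after all products. The leading product is accumulated exactly up to the remainders;
the pairs of indices of the others are split into a few exceptional ones, which are charged with the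
remainders, and the rest, which are charged with their sizes. -/
lemma mulBins_spec {p β : ℕ} (hp : 8 ≤ p) (hβ : β + 2 ≤ p) (hβ2 : p + 4 ≤ 2 * β) {m : MulParams}
    (h : m.Valid) {x y : List ℝ} (hx : Shape p x m.x₁ m.x₂ m.x₃ m.x₄)
    (hy : Shape p y m.y₁ m.y₂ m.y₃ m.y₄) {r : ℕ} (hr : 1 ≤ r)
    (hν : ((min x.length (r + 1) + min y.length (r + 1) + 5 : ℕ) : ℝ) * uro p ≤ m.ν) :
    let T := expo (lead x) + expo (lead y)
    let P := lead x * lead y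
    (∀ k, IsFloat p (mulBins p β T x y r k)) ∧
      OpCost (binInit p β T) (mulBins p β T x y r) (budget (binRatio β) P (uro p) m)
        (∑ q ∈ pairSet x.length y.length r, x.getD q.1 0 * y.getD q.2 0)
        (m.accErr * (uro p * P)) := by
  intro T P
  have hx0 := hx.pos
  have hy0 := hy.pos
  have hP : 0 < P := mul_pos hx0 hy0
  set u := uro p with hu
  set D := binRatio β with hD
  have hup : 0 < u := uro_pos p
  have hu1 : u ≤ 1 / 256 := uro_le p hp
  have hW : (2 : ℝ) ^ T ≤ P := by
    have h1 := zpow_expo_le hx0.ne'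
    have h2 := zpow_expo_le hy0.ne'
    rw [abs_of_pos hx0] at h1
    rw [abs_of_pos hy0] at h2
    rw [two_zpow_add]
    exact mul_le_mul h1 h2 (two_zpow_pos _).le hx0.le
  have hs : BinSetting u D P (2 ^ T) m.R := h.binSetting hup hu1 (binRatio_pos β)
    (binRatio_le hβ hβ2) (binRatio_sq_le hβ2) (uro_le_binRatio hβ) (two_zpow_pos _) hW
  have hDp := hs.D_pos
  have hU : 0 < u * P := by positivity
  have hUD : u * P ≤ 1 / 4 * (D * P) := by
    have := mul_le_mul_of_nonneg_right hs.le_D hP.le; linarith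
  obtain ⟨n1, n2, n3, n4⟩ := And.intro h.x₁_nonneg (And.intro h.x₂_nonneg
    (And.intro h.x₃_nonneg h.x₄_nonneg))
  obtain ⟨k1, k2, k3, k4⟩ := And.intro h.y₁_nonneg (And.intro h.y₂_nonneg
    (And.intro h.y₃_nonneg h.y₄_nonneg))
  have huu : u * (u * P) ≤ 1 / 256 * (u * P) := mul_le_mul_of_nonneg_right hu1 hU.le
  -- The products.
  set X : ℕ × ℕ → ℝ := fun q => |x.getD q.1 0 * y.getD q.2 0| with hX
  have hXe : ∀ q, X q = |x.getD q.1 0| * |y.getD q.2 0| := fun q => abs_mul _ _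
  have hX0 : ∀ q, 0 ≤ X q := fun q => abs_nonneg _
  obtain ⟨l, hl⟩ := mulPairs_eq_cons (r := r) (List.length_pos_iff.2 hx.ne_nil)
    (List.length_pos_iff.2 hy.ne_nil)
  have hnd := nodup_mulPairs x.length y.length r
  rw [hl, List.nodup_cons] at hnd
  have hmem : ∀ q, q ∈ l ↔ q ≠ (0, 0) ∧ q.1 < x.length ∧ q.2 < y.length ∧ q.1 + q.2 ≤ r := by
    intro q
    rw [← mem_mulPairs, hl, List.mem_cons]
    constructor
    · intro hq
      exact ⟨by rintro rfl; exact hnd.1 hq, Or.inr hq⟩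
    · rintro ⟨h1, h2 | h2⟩
      exacts [absurd h2 h1, h2]
  set F := (pairSet x.length y.length r).erase (0, 0) with hF
  have hFl : ∀ q, q ∈ F ↔ q ∈ l := by
    intro q
    rw [hmem]
    simp only [hF, pairSet, Finset.mem_erase, Finset.mem_filter, Finset.mem_product,
      Finset.mem_range, and_assoc]
  set m' := min x.length (r + 1) with hm'
  set n' := min y.length (r + 1) with hn'
  have hFsub : F ⊆ Finset.range m' ×ˢ Finset.range n' := by
    intro q hq
    rw [hFl, hmem] at hq
    simp only [Finset.mem_product, Finset.mem_range]
    lia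
  have ha := hx.tailBounds (m := m') (min_le_left _ _)
  have hb := hy.tailBounds (m := n') (min_le_left _ _)
  have ex0 : |x.getD 0 0| = lead x := by rw [Shape.getD_zero, abs_of_pos hx0]
  -- Sums of products in units of `u * P`.
  have s1 : ∑ q ∈ F, X q ≤ m.M₁ * (u * P) := by
    have := sum_pairs_one_le ha hb hFsub (fun q hq => ((hmem q).1 ((hFl q).1 hq)).1)
    simp only [hXe]
    refine this.trans ?_
    simp only [ex0, Shape.tailFun, MulParams.M₁]
    have e1 : m.x₁ * u * lead x * ((1 + m.y₁ * u) * lead y) =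
      m.x₁ * (u * P) + m.x₁ * m.y₁ * (u * (u * P)) := by ring
    have e2 : lead x * (m.y₁ * u * lead y) = m.y₁ * (u * P) := by ring
    have := mul_le_mul_of_nonneg_left huu (mul_nonneg n1 k1)
    linarith
  have s3 : ∀ G ⊆ F, (∀ q ∈ G, 3 ≤ q.1 + q.2) → ∑ q ∈ G, X q ≤ m.M₂ * (u * P) := fun G hG h3 =>
    h.sum_pairs_three hp hx hy (min_le_left _ _) (min_le_left _ _) (hG.trans hFsub) h3
  have s4 : ∀ G ⊆ F, (∀ q ∈ G, 4 ≤ q.1 + q.2) → ∑ q ∈ G, X q ≤ m.M₃ * (u * P) := fun G hG h3 =>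
    h.sum_pairs_four hp hx hy (min_le_left _ _) (min_le_left _ _) (hG.trans hFsub) h3
  have s5 : ∀ G ⊆ F, (∀ q ∈ G, 1 ≤ q.1 ∧ 1 ≤ q.2 ∧ 5 ≤ q.1 + q.2) →
      ∑ q ∈ G, X q ≤ m.M₄ * (u * P) := by
    intro G hG h3
    have := sum_pairs_inner_le ha hb (hG.trans hFsub) h3
    simp only [hXe]
    refine this.trans ?_
    simp only [Shape.tailFun, MulParams.M₄]
    have e0 := mul_le_mul_of_nonneg_left huu (mul_nonneg n1 k4)
    have e1 := mul_le_mul_of_nonneg_left huu (mul_nonneg n2 k3)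
    have e2 := mul_le_mul_of_nonneg_left huu (mul_nonneg n3 k2)
    have e3 := mul_le_mul_of_nonneg_left huu (mul_nonneg n4 k1)
    have e : m.x₁ * u * lead x * (m.y₄ * u * lead y) + m.x₂ * u * lead x * (m.y₃ * u * lead y) +
        m.x₃ * u * lead x * (m.y₂ * u * lead y) + m.x₄ * u * lead x * (m.y₁ * u * lead y) =
      m.x₁ * m.y₄ * (u * (u * P)) + m.x₂ * m.y₃ * (u * (u * P)) + m.x₃ * m.y₂ * (u * (u * P)) +
        m.x₄ * m.y₁ * (u * (u * P)) := by ring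
    rw [e]
    linarith
  have hM1 : m.M₁ ≤ 11.33 := by
    have := mul_le_mul h.x₁_le h.y₁_le k1 (by norm_num)
    unfold MulParams.M₁
    linarith [h.x₁_le, h.y₁_le]
  -- The sums of the costs.
  have c1 : ∀ K, K ≤ 1 → ∑ q ∈ F, opCost u D P m.R (X q) K ≤ 2.12 * 11.33 * (u * P) := by
    intro K hK
    simp only [opCost, hK, if_true]
    rw [← Finset.mul_sum]
    have := mul_le_mul_of_nonneg_right hM1 hU.le
    linarith
  obtain ⟨b2, b3, b4, b5⟩ := h.budget hs (Nat.cast_nonneg _) hν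
  have hQ := hs.opBound_nonneg
  have hsplit : ∀ (K : ℕ) (S : Finset (ℕ × ℕ)) (N M : ℝ), 2 ≤ K →
      ((F.filter (· ∈ S)).card : ℝ) ≤ N → ∑ q ∈ F.filter (· ∉ S), X q ≤ M →
      ∑ q ∈ F, opCost u D P m.R (X q) K ≤ N * opBound u D P m.R K + 6.25 * M := by
    intro K S N M hK hN hM
    simp only [opCost, if_neg (show ¬ K ≤ 1 by lia)]
    refine sum_min_le (hQ K) hN ?_
    rw [← Finset.mul_sum]
    linarith
  have hF0 : ∀ q ∈ F, q ≠ (0, 0) := fun q hq => ((hmem q).1 ((hFl q).1 hq)).1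
  set S₂ : Finset (ℕ × ℕ) := {(0, 1), (0, 2), (1, 0), (1, 1), (2, 0)} with hS₂
  have hS2 : ∀ q ∈ F.filter (· ∉ S₂), 3 ≤ q.1 + q.2 := by
    rintro ⟨i, j⟩ hq
    rw [Finset.mem_filter] at hq
    have h0 := hF0 _ hq.1
    have h1 := hq.2
    simp only [hS₂, Finset.mem_insert, Finset.mem_singleton, Prod.mk.injEq, ne_eq] at h0 h1 ⊢
    lia
  have hcard : ∀ S : Finset (ℕ × ℕ), (F.filter (· ∈ S)).card ≤ S.card := fun S =>
    Finset.card_le_card fun q hq => (Finset.mem_filter.1 hq).2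
  have c2 : ∑ q ∈ F, opCost u D P m.R (X q) 2 ≤ 5 * opBound u D P m.R 2 + 6.25 * (m.M₂ * (u * P)) := by
    refine hsplit 2 S₂ _ _ le_rfl ?_ (s3 _ (Finset.filter_subset _ _) hS2)
    have : (F.filter (· ∈ S₂)).card ≤ 5 := (hcard S₂).trans (by rw [hS₂]; decide)
    exact_mod_cast this
  have c3 : ∑ q ∈ F, opCost u D P m.R (X q) 3 ≤ 9 * opBound u D P m.R 3 + 6.25 * (m.M₃ * (u * P)) := by
    set S₃ : Finset (ℕ × ℕ) := {(0, 1), (0, 2), (1, 0), (1, 1), (2, 0), (0, 3), (1, 2), (2, 1), (3, 0)}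
      with hS₃
    refine hsplit 3 S₃ _ _ (by lia) ?_ (s4 _ (Finset.filter_subset _ _) ?_)
    · have : (F.filter (· ∈ S₃)).card ≤ 9 := (hcard S₃).trans (by rw [hS₃]; decide)
      exact_mod_cast this
    · rintro ⟨i, j⟩ hq
      rw [Finset.mem_filter] at hq
      have h0 := hF0 _ hq.1
      have h1 := hq.2
      simp only [hS₃, Finset.mem_insert, Finset.mem_singleton, Prod.mk.injEq, ne_eq] at h0 h1 ⊢
      lia
  have c45 : ∀ K, 4 ≤ K → ∑ q ∈ F, opCost u D P m.R (X q) K ≤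
      ((m' + n' + 5 : ℕ) : ℝ) * opBound u D P m.R K - opBound u D P m.R K
        + 6.25 * (m.M₄ * (u * P)) := by
    intro K hK
    set S₄ : Finset (ℕ × ℕ) := {0} ×ˢ Finset.Ico 1 n' ∪ Finset.Ico 1 m' ×ˢ {0} ∪
      {(1, 1), (1, 2), (1, 3), (2, 1), (2, 2), (3, 1)} with hS₄
    have hN : ((F.filter (· ∈ S₄)).card : ℝ) ≤ ((m' + n' + 4 : ℕ) : ℝ) := by
      have h1 : S₄.card ≤ (n' - 1) + (m' - 1) + 6 := by
        refine (Finset.card_union_le _ _).trans (add_le_add ((Finset.card_union_le _ _).trans ?_)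
          (by decide))
        simp
      have := (hcard S₄).trans h1
      have : (F.filter (· ∈ S₄)).card ≤ m' + n' + 4 := by
        have hx1 : 1 ≤ m' := by have := List.length_pos_iff.2 hx.ne_nil; lia
        have hy1 : 1 ≤ n' := by have := List.length_pos_iff.2 hy.ne_nil; lia
        lia
      exact_mod_cast this
    refine (hsplit K S₄ _ _ (by lia) hN (s5 _ (Finset.filter_subset _ _) ?_)).trans ?_
    · rintro ⟨i, j⟩ hq
      rw [Finset.mem_filter] at hq
      have h0 := hF0 _ hq.1
      have h1 := hq.2
      have h2 := hFsub hq.1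
      simp only [hS₄, Finset.mem_union, Finset.mem_product, Finset.mem_insert,
        Finset.mem_singleton, Finset.mem_Ico, Prod.mk.injEq, ne_eq, Finset.mem_range] at h0 h1 h2 ⊢
      lia
    · push_cast
      linarith
  have hR2 := h.R₂_ge
  -- The leading product.
  have hlead := accumulateProd_lead hp hβ hβ2 rfl rfl rfl hs (a := lead x) (b := lead y) rfl rfl
    (0 + 0 < r) (by lia)
  obtain ⟨fl, ol⟩ := hlead
  have hop0 : mulOp p β T x y r (binInit p β T) (0, 0) = accumulateProd p β T (binInit p β T)
      (lead x) (lead y) (rn p (lead x * lead y))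
      (if 0 + 0 < r then (twoProd p (lead x) (lead y)).2 else 0) := by
    simp only [mulOp, Shape.getD_zero]
  rw [← hop0] at fl ol
  have hsum : ∀ f : ℕ × ℕ → ℝ, (l.map f).sum = ∑ q ∈ F, f q := fun f =>
    sum_map_eq_sum_finset hnd.2 hFl f
  have hcost0 : ∀ q K, 0 ≤ opCost u D P m.R (X q) K := by
    intro q K
    unfold opCost
    have := hX0 q
    split_ifs
    · positivity
    · exact le_min (by positivity) (hQ K)
  have hC : ∀ K ≤ 5, (if K = 0 then 1.0244 * P else if K = 1 then 1.67 * D * P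
      else opBound u D P m.R K) + (l.map (fun q => opCost u D P m.R (X q) K)).sum ≤
      budget D P u m K := by
    intro K hK
    rw [hsum]
    interval_cases K
    · have := c1 0 (by lia)
      have := mul_le_mul_of_nonneg_right hu1 hP.le
      simp only [budget, if_true]
      linarith
    · have := c1 1 (by lia)
      have : 0 < D * P := by positivity
      simp only [budget, if_true, one_ne_zero, if_false]
      linarith
    · simp only [budget, OfNat.ofNat_ne_zero, if_false, OfNat.ofNat_ne_one, MulParams.R_two]
      linarith
    · simp only [budget, OfNat.ofNat_ne_zero, if_false, OfNat.ofNat_ne_one, MulParams.R_three]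
      linarith
    · have := c45 4 le_rfl
      simp only [budget, OfNat.ofNat_ne_zero, if_false, OfNat.ofNat_ne_one, MulParams.R_four]
      linarith
    · have := c45 5 (by lia)
      simp only [budget, OfNat.ofNat_ne_zero, if_false, OfNat.ofNat_ne_one, MulParams.R_five]
      linarith
  have hmain := foldl_opCost (p := p) (op := mulOp p β T x y r)
    (h := fun q => opCost u D P m.R (X q)) (val := fun q => x.getD q.1 0 * y.getD q.2 0)
    (err := fun q => opErr u D P m.R (X q)) (C := budget D P u m) (binInit p β T) hcost0 l
    (by
      rintro ⟨i, j⟩ hq B hB h0 h1 hK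
      obtain ⟨q0, q1, q2, q3⟩ := (hmem _).1 hq
      refine accumulateProd_other hp hβ hβ2 rfl rfl rfl hs hB ?_ ?_ ?_ _
      · intro k
        match k with
        | 0 => simpa [budget, contBound] using h0
        | 1 => simpa [budget, contBound] using h1
        | k + 2 =>
          have h2 := (hK (min (k + 2) 5) (by lia) (by lia)).abs_le (min_le_left _ _)
          have h3 : budget D P u m (min (k + 2) 5) = m.R (k + 2) * (u * P) := by
            rw [budget, if_neg (by lia), if_neg (by lia)]
            congr 1
            unfold MulParams.R
            split_ifs <;> first | rfl | lia
          rw [h3] at h2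
          simpa [contBound, mul_assoc] using h2
      · rw [abs_mul]
        have e1 : m.x₁ * u * lead x * lead y ≤ 5.6 * u * P := by
          have := mul_le_mul_of_nonneg_right h.x₁_le hU.le
          linarith
        have e2 : lead x * (m.y₁ * u * lead y) ≤ 5.6 * u * P := by
          have := mul_le_mul_of_nonneg_right h.y₁_le hU.le
          linarith
        rcases Nat.eq_zero_or_pos i with hi | hi
        · subst hi
          have hj : 1 ≤ j := by
            by_contra hj
            exact q0 (by simp; lia)
          simp only [ex0]
          exact (mul_le_mul_of_nonneg_left (hy.abs_getD_le hj) hx0.le).trans e2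
        · have h1 := hx.abs_getD_le hi
          have h2 : |y.getD j 0| ≤ lead y := by
            rcases Nat.eq_zero_or_pos j with hj | hj
            · subst hj; rw [Shape.getD_zero, abs_of_pos hy0]
            · refine (hy.abs_getD_le hj).trans ?_
              have := mul_le_mul h.y₁_le hu1 hup.le (by norm_num)
              have := mul_le_mul_of_nonneg_right this hy0.le
              linarith
          exact (mul_le_mul h1 h2 (abs_nonneg _) ((abs_nonneg _).trans h1)).trans e1
      · intro hne
        have hxi := left_ne_zero_of_mul hne
        have hyj := right_ne_zero_of_mul hne
        simp only at hxi hyj ⊢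
        rcases Nat.eq_zero_or_pos i with hi | hi
        · subst hi
          have hj : 1 ≤ j := by
            by_contra hj
            exact q0 (by simp; lia)
          have := hy.expo_getD_le h.y₁_le hj hyj
          rw [Shape.getD_zero]
          lia
        · have h1 := hx.expo_getD_le h.x₁_le hi hxi
          rcases Nat.eq_zero_or_pos j with hj | hj
          · subst hj; rw [Shape.getD_zero]; lia
          · have h2 := hy.expo_getD_le h.y₁_le hj hyj
            lia)
    _ _ _ _ fl ol hC
  obtain ⟨r1, r2, -⟩ := h.rem_le hs
  have herr : ∑ q ∈ F, opErr u D P m.R (X q) ≤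
      10 * (m.t₂ * (u * P)) + 7.6 * (m.M₁ / 256 * (u * P)) + 1.12 * (m.M₂ * (u * P)) := by
    rw [← Finset.sum_filter_add_sum_filter_not F (· ∈ S₂)]
    have h2 : ∑ q ∈ F.filter (· ∉ S₂), opErr u D P m.R (X q) ≤ 1.12 * (m.M₂ * (u * P)) := by
      refine (Finset.sum_le_sum fun q _ => min_le_left _ _).trans ?_
      rw [← Finset.mul_sum]
      exact mul_le_mul_of_nonneg_left (s3 _ (Finset.filter_subset _ _) hS2) (by norm_num)
    have h1 : ∑ q ∈ F.filter (· ∈ S₂), opErr u D P m.R (X q) ≤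
        5 * (2 * remBound u D P m.R 2) + 7.6 * u * (m.M₁ * (u * P)) := by
      refine (Finset.sum_le_sum fun q _ => min_le_right _ _).trans ?_
      rw [Finset.sum_add_distrib, Finset.sum_const, nsmul_eq_mul, ← Finset.mul_sum]
      refine add_le_add (mul_le_mul_of_nonneg_right ?_ (by have := hs.rem_nonneg 2; linarith))
        (mul_le_mul_of_nonneg_left ?_ (by positivity))
      · have : (F.filter (· ∈ S₂)).card ≤ 5 := (hcard S₂).trans (by rw [hS₂]; decide)
        exact_mod_cast this
      · exact (Finset.sum_le_sum_of_subset_of_nonneg (Finset.filter_subset _ _)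
          fun q _ _ => hX0 q).trans s1
    have hM0 : 0 ≤ m.M₁ := by unfold MulParams.M₁; positivity
    have := mul_le_mul_of_nonneg_left huu hM0
    linarith
  have hval : ∑ q ∈ pairSet x.length y.length r, x.getD q.1 0 * y.getD q.2 0 =
      P + ∑ q ∈ F, x.getD q.1 0 * y.getD q.2 0 := by
    have h00 : ((0, 0) : ℕ × ℕ) ∈ pairSet x.length y.length r := by
      simp only [pairSet, Finset.mem_filter, Finset.mem_product, Finset.mem_range]
      have := List.length_pos_iff.2 hx.ne_nil
      have := List.length_pos_iff.2 hy.ne_nil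
      lia
    rw [hF, ← Finset.add_sum_erase _ _ h00]
    simp only [Shape.getD_zero]
    rfl
  rw [mulBins_eq, hl, List.foldl_cons]
  refine ⟨hmain.1, hmain.2.mono (fun K hK => hC K hK) ?_⟩
  rw [hval, hsum, hsum, sub_self, abs_zero]
  have e : m.accErr = 3.7 / 16 + 11 * m.t₂ + 0.03 + 7.6 * m.M₁ / 256 + 1.12 * m.M₂ := rfl
  rw [e]
  linarith

/-! ### Multiplication -/

namespace MulParams

variable (m : MulParams)

/-- Bound for the terms after the leading one of the product. -/
def b₁ : ℝ := 1.25 + 1.01 * m.R₂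

/-- Bound for the terms from number `2` on of the product. -/
def b₂ : ℝ := m.b₁ / 256 + 1.004 * m.R₃

/-- Bound for the terms from number `3` on of the product. -/
def b₃ : ℝ := m.b₂ / 256 + 1.004 * m.R₄

/-- Bound for the terms from number `4` on of the product. -/
def b₄ : ℝ := m.b₃ / 256 + 1.004 * m.R₅

/-- The error of the product that is due to the accumulation and to the bins. -/
def baseErr : ℝ := m.accErr + 1.25 + m.R₂ / 256

/-- The error of a product with at least four terms. -/
def valErr : ℝ := m.baseErr + m.R₅ + m.M₃ + m.b₄

/-- The error of a product with at least two terms. -/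
def valErr' : ℝ := m.baseErr + m.R₄ + m.M₂ + m.b₂

/-- The distance of the leading term of the product from the product of the leading terms. -/
def leadErr : ℝ := m.baseErr + m.R₄ + m.M₂ + m.M₁ + m.b₁

/-- The product has the shape `z`. -/
structure ShapeOut (z₁ z₂ z₃ z₄ : ℝ) : Prop where
  leadErr_le : m.leadErr ≤ 100
  le₁ : 1.008 * m.b₁ ≤ z₁ * (1 - m.leadErr / 256)
  le₂ : 1.008 * m.b₂ ≤ z₂ * (1 - m.leadErr / 256)
  le₃ : 1.008 * m.b₃ ≤ z₃ * (1 - m.leadErr / 256)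
  le₄ : 1.008 * m.b₄ ≤ z₄ * (1 - m.leadErr / 256)

/-- The bounds `b` as a function. -/
def b (k : ℕ) : ℝ := if k ≤ 1 then m.b₁ else if k = 2 then m.b₂ else if k = 3 then m.b₃ else m.b₄

variable {m}

lemma Valid.b_anti (h : m.Valid) : 0 ≤ m.b₄ ∧ m.b₄ ≤ m.b₃ ∧ m.b₃ ≤ m.b₂ ∧ m.b₂ ≤ m.b₁ := by
  have h1 := h.R₅_nonneg
  have h2 := h.R₅_le
  have h3 := h.R₄_le
  have h4 := h.R₃_le
  have e1 : m.b₁ = 1.25 + 1.01 * m.R₂ := rfl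
  have e2 : m.b₂ = m.b₁ / 256 + 1.004 * m.R₃ := rfl
  have e3 : m.b₃ = m.b₂ / 256 + 1.004 * m.R₄ := rfl
  have e4 : m.b₄ = m.b₃ / 256 + 1.004 * m.R₅ := rfl
  refine ⟨?_, ?_, ?_, ?_⟩ <;> linarith

lemma Valid.b_step (h : m.Valid) (k : ℕ) (hk : 1 ≤ k) :
    m.b k / 256 + 1.004 * m.R (k + 2) ≤ m.b (k + 1) := by
  obtain ⟨h4, h3, h2, h1⟩ := h.b_anti
  have e4 : m.b₄ = m.b₃ / 256 + 1.004 * m.R₅ := rfl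
  rcases (show k = 1 ∨ k = 2 ∨ k = 3 ∨ 4 ≤ k by lia) with rfl | rfl | rfl | hk
  · simp [b, R, b₂]
  · simp [b, R, b₃]
  · simp [b, R, b₄]
  · have e1 : m.b k = m.b₄ := by
      rw [b, if_neg (by lia), if_neg (by lia), if_neg (by lia)]
    have e2 : m.b (k + 1) = m.b₄ := by
      rw [b, if_neg (by lia), if_neg (by lia), if_neg (by lia)]
    have e3 : m.R (k + 2) = m.R₅ := by
      rw [R, if_neg (by lia), if_neg (by lia), if_neg (by lia)]
    rw [e1, e2, e3]
    linarith

end MulParams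

/-- The sum of the products that the multiplication with `r` terms leaves out. -/
lemma MulParams.Valid.sum_pairs_le {p : ℕ} {m : MulParams} {x y : List ℝ} (hp : 8 ≤ p)
    (h : m.Valid) (hx : Shape p x m.x₁ m.x₂ m.x₃ m.x₄) (hy : Shape p y m.y₁ m.y₂ m.y₃ m.y₄)
    {r : ℕ} (hr : 2 ≤ r) :
    let S := ∑ q ∈ pairSet x.length y.length r, x.getD q.1 0 * y.getD q.2 0
    |S - x.sum * y.sum| ≤ m.M₂ * (uro p * (lead x * lead y)) ∧
      (4 ≤ r → |S - x.sum * y.sum| ≤ m.M₃ * (uro p * (lead x * lead y))) := by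
  intro S
  have e : x.sum * y.sum = S + ∑ q ∈ (Finset.range x.length ×ˢ Finset.range y.length).filter
      (fun q => ¬ q.1 + q.2 ≤ r), x.getD q.1 0 * y.getD q.2 0 := by
    rw [sum_eq_sum_getD x, sum_eq_sum_getD y, Finset.sum_mul_sum, ← Finset.sum_product',
      ← Finset.sum_filter_add_sum_filter_not _ (fun q : ℕ × ℕ => q.1 + q.2 ≤ r)]
    rfl
  rw [e, sub_add_cancel_left, abs_neg]
  refine ⟨(Finset.abs_sum_le_sum_abs _ _).trans (h.sum_pairs_three hp hx hy le_rfl le_rfl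
    (Finset.filter_subset _ _) ?_), fun hr4 => (Finset.abs_sum_le_sum_abs _ _).trans
    (h.sum_pairs_four hp hx hy le_rfl le_rfl (Finset.filter_subset _ _) ?_)⟩ <;>
  · intro q hq
    rw [Finset.mem_filter] at hq
    lia

set_option maxHeartbeats 1600000 in
/-- The product of two expansions: its shape, its leading term and its value. The value is more precise
if there are at least four terms, since fewer partial products are left out. -/
lemma mul_spec {p β : ℕ} (hp : 8 ≤ p) (hβ : β + 2 ≤ p) (hβ2 : p + 4 ≤ 2 * β) {m : MulParams}
    (h : m.Valid) {x y : List ℝ} (hx : Shape p x m.x₁ m.x₂ m.x₃ m.x₄)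
    (hy : Shape p y m.y₁ m.y₂ m.y₃ m.y₄) {r : ℕ} (hr : 2 ≤ r)
    (hν : ((min x.length (r + 1) + min y.length (r + 1) + 5 : ℕ) : ℝ) * uro p ≤ m.ν)
    {z₁ z₂ z₃ z₄ : ℝ} (hz : m.ShapeOut z₁ z₂ z₃ z₄) :
    let U := uro p * (lead x * lead y)
    Shape p (mul p β x y r) z₁ z₂ z₃ z₄ ∧
      |lead (mul p β x y r) - lead x * lead y| ≤ m.leadErr * U ∧
      |(mul p β x y r).sum - x.sum * y.sum| ≤ m.valErr' * U ∧
      (4 ≤ r → |(mul p β x y r).sum - x.sum * y.sum| ≤ m.valErr * U) := by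
  intro U
  obtain ⟨hfl, hcost⟩ := mulBins_spec hp hβ hβ2 h hx hy (by lia : 1 ≤ r) hν
  set T := expo (lead x) + expo (lead y) with hT
  set P := lead x * lead y with hP
  set u := uro p with hu
  set D := binRatio β with hD
  set B := mulBins p β T x y r with hB
  set I := binInit p β T with hI
  have hup : 0 < u := uro_pos p
  have hu1 : u ≤ 1 / 256 := uro_le p hp
  have hPp : 0 < P := mul_pos hx.pos hy.pos
  have hUd : U = u * P := rfl
  have hU : 0 < U := mul_pos hup hPp
  have hUP : U ≤ 1 / 256 * P := mul_le_mul_of_nonneg_right hu1 hPp.le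
  have hDP : D * P ≤ 1 / 64 * P := mul_le_mul_of_nonneg_right (binRatio_le hβ hβ2) hPp.le
  have hR2 : 0 ≤ m.R₂ := by simpa [MulParams.R] using h.R_nonneg 2
  have hR2' := h.R₂_le
  obtain ⟨b4, b43, b32, b21⟩ := h.b_anti
  -- The entries that enter VecSumErrBranch.
  set E : ℕ → ℝ := fun k => rn p (B k - I k) with hE
  have hE1 : ∀ k, |E k| ≤ 1.004 * |B k - I k| := fun k => by
    have := abs_rn_le p (B k - I k)
    have := mul_le_mul_of_nonneg_right (show 1 + uro p ≤ 1.004 by linarith) (abs_nonneg (B k - I k))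
    linarith
  have hE2 : ∀ k, |E k - (B k - I k)| ≤ u * |B k - I k| := fun k => abs_rn_sub_le_uro p _
  have t0 : |B 0 - I 0| ≤ 1.12 * P := by simpa [budget] using hcost.zero
  have t1 : |B 1 - I 1| ≤ 7.9 * (D * P) := by simpa [budget, mul_assoc] using hcost.one
  have tK : ∀ K, 2 ≤ K → ∀ S : Finset ℕ, (∀ k ∈ S, K ≤ k) → ∑ k ∈ S, |B k - I k| ≤ m.R K * U := by
    intro K hK S hS
    have := hcost.tail (min K 5) (by lia) (by lia) S (fun k hk => (min_le_left _ _).trans (hS k hk))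
    refine this.trans (le_of_eq ?_)
    rw [budget, if_neg (by lia), if_neg (by lia)]
    congr 1
    unfold MulParams.R
    split_ifs <;> first | rfl | lia
  have tE : ∀ K, 2 ≤ K → ∀ n, ∑ k ∈ Finset.Ico K n, |E k| ≤ 1.004 * m.R K * U := by
    intro K hK n
    have h1 := tK K hK (Finset.Ico K n) (fun k hk => (Finset.mem_Ico.1 hk).1)
    have h2 := Finset.sum_le_sum (s := Finset.Ico K n) fun k _ => hE1 k
    rw [← Finset.mul_sum] at h2
    linarith
  obtain ⟨n, hn⟩ : ∃ n, r * p / β + 2 = n + 1 := ⟨_, rfl⟩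
  have hβ0 : 0 < β := by lia
  have hq : r ≤ r * p / β := by
    rw [Nat.le_div_iff_mul_le hβ0]
    exact Nat.mul_le_mul_left _ (by lia)
  set es : List ℝ := (List.range n).map (fun k => E (k + 1)) with hes
  have hlist : (List.range (r * p / β + 2)).map E = E 0 :: es := by
    rw [hn, List.range_succ_eq_map, List.map_cons, List.map_map]
    rfl
  have hmul : mul p β x y r = vecSumErrBranch p (E 0 :: es) ((r - 1) + 1) := by
    rw [← hlist, Nat.sub_add_cancel (by lia)]
    rfl
  have hdrop : ∀ k, nrm (es.drop k) = ∑ j ∈ Finset.Ico (k + 1) (n + 1), |E j| := by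
    intro k
    rw [nrm_drop_eq, ← Finset.sum_Ico_add' (fun j => |E j|) k n 1]
    simp only [hes, List.length_map, List.length_range]
    refine Finset.sum_congr rfl fun i hi => ?_
    rw [List.getD_eq_getElem _ _ (by simpa using (Finset.mem_Ico.1 hi).2)]
    simp
  have hdrop1 : ∀ k, 1 ≤ k → nrm (es.drop k) ≤ 1.004 * m.R (k + 1) * U := fun k hk => by
    rw [hdrop]; exact tE _ (by lia) _
  have hsumE : E 0 + es.sum = ∑ j ∈ Finset.range (n + 1), E j := by
    rw [Finset.sum_range_succ', sum_eq_sum_getD, add_comm]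
    simp only [hes, List.length_map, List.length_range]
    congr 1
    refine Finset.sum_congr rfl fun i hi => ?_
    rw [List.getD_eq_getElem _ _ (by simpa using hi)]
    simp
  have hE0 := hE1 0
  have hE1' := hE1 1
  have hhead : es.headD 0 = E 1 := by
    obtain ⟨n', rfl⟩ : ∃ n', n = n' + 1 := ⟨n - 1, by lia⟩
    rw [hes, List.range_succ_eq_map]
    rfl
  have hfE : ∀ k, IsFloat p (E k) := fun k => isFloat_rn (by lia) _
  have hc1 := hdrop1 1 le_rfl
  rw [MulParams.R_two] at hc1
  obtain ⟨f1, f2, f3, f4, f5⟩ := vecSumErrBranch_bounds hp (r - 1) es (E 0) (hfE 0)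
    (by rw [hes]; intro a ha; obtain ⟨k, -, rfl⟩ := List.mem_map.1 ha; exact hfE _)
    (fun k => nrm (es.drop k)) (fun k => m.b k * U) (fun k => le_rfl)
    (by
      have e : m.b 1 = 1.25 + 1.01 * m.R₂ := rfl
      rw [e, hhead]
      have h1 : |E 0 + E 1| ≤ 1.249 * P := by
        have := abs_add_le (E 0) (E 1)
        linarith
      have h2 := mul_le_mul_of_nonneg_left h1 hup.le
      have h3 := mul_le_mul_of_nonneg_left hc1 hup.le
      have h4 := mul_le_mul_of_nonneg_right hu1 (show 0 ≤ 1.004 * m.R₂ * U by positivity)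
      have h5 : 0 ≤ m.R₂ * U := by positivity
      have h6 : u * P = U := rfl
      linarith)
    (by
      intro k hk
      have h1 := mul_le_mul_of_nonneg_right (h.b_step k hk) hU.le
      have h2 := hdrop1 (k + 1) (by lia)
      have hbk : 0 ≤ m.b k := by
        unfold MulParams.b; split_ifs <;> linarith
      have h3 := mul_le_mul_of_nonneg_right hu1 (mul_nonneg hbk hU.le)
      linarith)
  rw [← hmul] at f1 f2 f3 f4 f5
  -- The sum of the entries.
  set S := ∑ q ∈ pairSet x.length y.length r, x.getD q.1 0 * y.getD q.2 0 with hS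
  have hround : |(∑ j ∈ Finset.range (n + 1), E j) - ∑ j ∈ Finset.range (n + 1), (B j - I j)| ≤
      (1.25 + m.R₂ / 256) * U := by
    rw [← Finset.sum_sub_distrib]
    refine (Finset.abs_sum_le_sum_abs _ _).trans ((Finset.sum_le_sum fun k _ => hE2 k).trans ?_)
    rw [← Finset.mul_sum]
    have h1 : ∑ j ∈ Finset.range (n + 1), |B j - I j| ≤
        |B 0 - I 0| + |B 1 - I 1| + m.R₂ * U := by
      have := tK 2 le_rfl (Finset.Ico 2 (n + 1)) (fun k hk => (Finset.mem_Ico.1 hk).1)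
      rw [MulParams.R_two] at this
      rw [Finset.range_eq_Ico, Finset.sum_eq_sum_Ico_succ_bot (by lia),
        Finset.sum_eq_sum_Ico_succ_bot (by lia)]
      simp only [zero_add, Nat.reduceAdd]
      linarith
    have h2 := mul_le_mul_of_nonneg_left (show ∑ j ∈ Finset.range (n + 1), |B j - I j| ≤
      1.25 * P + m.R₂ * U by linarith) hup.le
    have h3 := mul_le_mul_of_nonneg_right hu1 (show 0 ≤ m.R₂ * U by positivity)
    have h6 : u * P = U := rfl
    linarith
  have hbins : ∀ K, 2 ≤ K → K ≤ n + 1 →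
      |(∑ j ∈ Finset.range (n + 1), (B j - I j)) - S| ≤ (m.accErr + m.R K) * U := by
    intro K hK hKn
    obtain ⟨N, hN⟩ := hcost.sum
    have h1 := hN (max N (n + 1)) (le_max_left _ _)
    rw [← Finset.sum_range_add_sum_Ico _ (le_max_right N (n + 1))] at h1
    have h2 := tK K hK (Finset.Ico (n + 1) (max N (n + 1)))
      (fun k hk => hKn.trans (Finset.mem_Ico.1 hk).1)
    have h3 := Finset.abs_sum_le_sum_abs (fun j => B j - I j) (Finset.Ico (n + 1) (max N (n + 1)))
    have h4 := h3.trans h2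
    rw [abs_le] at h1 h4 ⊢
    constructor <;> linarith [h1.1, h1.2, h4.1, h4.2]
  obtain ⟨p1, p2⟩ := h.sum_pairs_le hp hx hy hr
  have hbase : ∀ K, 2 ≤ K → K ≤ n + 1 → |E 0 + es.sum - S| ≤ (m.baseErr + m.R K) * U := by
    intro K hK hKn
    have h1 := hbins K hK hKn
    rw [hsumE]
    have := abs_sub_le (∑ j ∈ Finset.range (n + 1), E j) (∑ j ∈ Finset.range (n + 1), (B j - I j)) S
    have e : m.baseErr = m.accErr + 1.25 + m.R₂ / 256 := rfl
    rw [e]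
    linarith
  have hbase4 := hbase 4 (by lia) (by lia)
  rw [MulParams.R_four] at hbase4
  have htot4 : |E 0 + es.sum - x.sum * y.sum| ≤ (m.baseErr + m.R₄ + m.M₂) * U := by
    have := abs_sub_le (E 0 + es.sum) S (x.sum * y.sum)
    linarith
  -- The product of the sums and the product of the leading terms.
  have hxy : |x.sum * y.sum - P| ≤ m.M₁ * U := by
    have h1 := hx.abs_sum_sub_lead_le
    have h2 := hy.abs_sum_sub_lead_le
    have e : x.sum * y.sum - P = lead x * (y.sum - lead y) + (x.sum - lead x) * lead y +
        (x.sum - lead x) * (y.sum - lead y) := by rw [hP]; ring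
    have a1 : |lead x * (y.sum - lead y)| ≤ m.y₁ * U := by
      rw [abs_mul, abs_of_pos hx.pos]
      have := mul_le_mul_of_nonneg_left h2 hx.pos.le
      calc _ ≤ _ := this
        _ = _ := by rw [hUd, hP]; ring
    have a2 : |(x.sum - lead x) * lead y| ≤ m.x₁ * U := by
      rw [abs_mul, abs_of_pos hy.pos]
      have := mul_le_mul_of_nonneg_right h1 hy.pos.le
      calc _ ≤ _ := this
        _ = _ := by rw [hUd, hP]; ring
    have a3 : |(x.sum - lead x) * (y.sum - lead y)| ≤ m.x₁ * m.y₁ / 256 * U := by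
      rw [abs_mul]
      have := mul_le_mul h1 h2 (abs_nonneg _) ((abs_nonneg _).trans h1)
      refine this.trans ?_
      have := mul_le_mul_of_nonneg_right hu1
        (show 0 ≤ m.x₁ * m.y₁ * U from mul_nonneg (mul_nonneg h.x₁_nonneg h.y₁_nonneg) hU.le)
      calc _ = u * (m.x₁ * m.y₁ * U) := by rw [hUd, hP]; ring
        _ ≤ _ := by linarith
    rw [e]
    have := abs_add_three (lead x * (y.sum - lead y)) ((x.sum - lead x) * lead y)
      ((x.sum - lead x) * (y.sum - lead y))
    have e1 : m.M₁ = m.y₁ + m.x₁ * (1 + m.y₁ / 256) := rfl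
    rw [e1]
    linarith
  have hleadE : |lead (mul p β x y r) - P| ≤ m.leadErr * U := by
    have e : m.leadErr = m.baseErr + m.R₄ + m.M₂ + m.M₁ + m.b₁ := rfl
    have f3' : |E 0 + es.sum - lead (mul p β x y r)| ≤ m.b₁ * U := f3
    rw [e, abs_le] at *
    constructor <;> linarith [f3'.1, f3'.2, htot4.1, htot4.2, hxy.1, hxy.2]
  have hlow : (1 - m.leadErr / 256) * P ≤ lead (mul p β x y r) := by
    have h1 := (abs_le.1 hleadE).1
    have h2 : 0 ≤ m.leadErr := by
      by_contra hneg
      have := mul_neg_of_neg_of_pos (not_le.1 hneg) hU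
      linarith [abs_nonneg (lead (mul p β x y r) - P)]
    have := mul_le_mul_of_nonneg_left hUP h2
    linarith
  have hlp : 0 < lead (mul p β x y r) := by
    have := hz.leadErr_le
    refine lt_of_lt_of_le (mul_pos ?_ hPp) hlow
    linarith
  have htail : ∀ k, 1 ≤ k → ∀ z, 1.008 * m.b k ≤ z * (1 - m.leadErr / 256) → 0 ≤ m.b k →
      nrm ((mul p β x y r).drop k) ≤ z * u * lead (mul p β x y r) := by
    intro k hk z hz' hb0
    have h1 := f2 k hk
    have h2 := mul_le_mul_of_nonneg_right (amp_le hp) (show 0 ≤ m.b k * U by positivity)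
    have h3 := mul_le_mul_of_nonneg_right hz' hU.le
    have hf : 0 < 1 - m.leadErr / 256 := by linarith [hz.leadErr_le]
    have hz0 : 0 ≤ z := by
      by_contra hneg
      have := mul_neg_of_neg_of_pos (not_le.1 hneg) hf
      linarith
    have h4 := mul_le_mul_of_nonneg_left hlow (mul_nonneg hz0 hup.le)
    have h6 : u * P = U := rfl
    have h7 : z * u * ((1 - m.leadErr / 256) * P) = z * (1 - m.leadErr / 256) * U := by
      rw [← h6]; ring
    linarith
  refine ⟨⟨f1, hlp, htail 1 le_rfl _ hz.le₁ ?_, htail 2 (by lia) _ hz.le₂ ?_,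
    htail 3 (by lia) _ hz.le₃ ?_, htail 4 (by lia) _ hz.le₄ ?_⟩, hleadE, ?_, ?_⟩
  · change 0 ≤ m.b₁; linarith
  · change 0 ≤ m.b₂; linarith
  · change 0 ≤ m.b₃; linarith
  · exact b4
  · have hb : m.b (r - 1 + 1) ≤ m.b₂ := by
      rw [MulParams.b, if_neg (by lia)]; split_ifs <;> linarith
    have hbU := mul_le_mul_of_nonneg_right hb hU.le
    have f5' := f5.trans hbU
    have e : m.valErr' = m.baseErr + m.R₄ + m.M₂ + m.b₂ := rfl
    rw [e]
    rw [abs_le] at *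
    constructor <;> linarith [f5'.1, f5'.2, htot4.1, htot4.2]
  · intro hr4
    have hb : m.b (r - 1 + 1) ≤ m.b₄ := by
      rw [MulParams.b, if_neg (by lia), if_neg (by lia), if_neg (by lia)]
    have hbU := mul_le_mul_of_nonneg_right hb hU.le
    have f5' := f5.trans hbU
    have hbase5 := hbase 5 (by lia) (by lia)
    rw [MulParams.R_five] at hbase5
    have p2' := p2 hr4
    have e : m.valErr = m.baseErr + m.R₅ + m.M₃ + m.b₄ := rfl
    rw [e]
    rw [abs_le] at *
    constructor <;> linarith [f5'.1, f5'.2, hbase5.1, hbase5.2, p2'.1, p2'.2]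

/-! ### VecSum of an ulp-nonoverlapping expansion -/

lemma ulp_nonneg (p : ℕ) (x : ℝ) : 0 ≤ ulp p x := by
  unfold ulp
  split_ifs
  · exact le_rfl
  · exact (two_zpow_pos _).le

lemma ulp_of_ne_zero (p : ℕ) {x : ℝ} (hx : x ≠ 0) : ulp p x = 2 * uro p * 2 ^ expo x := by
  have := half_ulp_eq p (expo x)
  rw [ulp, if_neg hx]
  linarith

lemma ulp_le (p : ℕ) (x : ℝ) : ulp p x ≤ 2 * uro p * |x| := by
  rcases eq_or_ne x 0 with rfl | hx
  · simp [ulp]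
  · rw [ulp_of_ne_zero p hx]
    exact mul_le_mul_of_nonneg_left (zpow_expo_le hx) (by have := uro_pos p; positivity)

lemma ulp_neg (p : ℕ) (x : ℝ) : ulp p (-x) = ulp p x := by
  simp [ulp, expo_neg]

lemma isChain_neg {p : ℕ} {l : List ℝ} (h : l.IsChain (fun a a' => |a'| ≤ ulp p a)) :
    (neg l).IsChain (fun a a' => |a'| ≤ ulp p a) := by
  unfold neg
  rw [List.isChain_map]
  simpa [ulp_neg] using h

/-- The head of a sum `rn (a + s)` and its error are multiples of the last place of `s`. -/
lemma isMult_twoSum {p : ℕ} (hp : 1 ≤ p) {a s : ℝ} (ha : IsFloat p a) (hs : IsFloat p s)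
    (ha0 : a ≠ 0) (hs0 : s ≠ 0) (h : expo s ≤ expo a) :
    IsMult (expo s - p + 1) (rn p (a + s)) ∧
      IsMult (expo s - p + 1) (a + s - rn p (a + s)) := by
  have h1 : IsMult (expo s - p + 1) a := (ha.isMult (zpow_expo_le ha0)).mono (by lia)
  have h2 : IsMult (expo s - p + 1) s := hs.isMult (zpow_expo_le hs0)
  exact ⟨(h1.add h2).rn hp, (h1.add h2).sub ((h1.add h2).rn hp)⟩

lemma abs_sub_rn_le_half_ulp {p : ℕ} (hp : 1 ≤ p) (x : ℝ) :
    |x - rn p x| ≤ 1 / 2 * ulp p (rn p x) := by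
  rcases eq_or_ne x 0 with rfl | hx
  · simp [rn_zero, ulp]
  · have h0 : rn p x ≠ 0 := fun h => hx (rn_eq_zero hp h)
    have h1 := abs_rn_sub_le p x
    have h2 : expo x ≤ expo (rn p x) :=
      le_expo (le_abs_rn_of_le hp (isFloat_two_zpow hp _) (zpow_expo_le hx))
    rw [abs_sub_comm, ulp, if_neg h0]
    exact h1.trans (mul_le_mul_of_nonneg_left (two_zpow_le (by lia)) (by norm_num))

/-- The step of VecSum at an entry `a` that dominates the sum `s'` of the later entries. -/
lemma ulp_step {p : ℕ} (hp : 8 ≤ p) {a s' : ℝ} (ha : IsFloat p a)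
    (h : |s'| ≤ 1.016 * ulp p a) :
    |rn p (a + s') - a| ≤ 2.04 * ulp p a ∧ ulp p s' ≤ 4.07 * uro p * ulp p (rn p (a + s')) ∧
      (s' ≠ 0 → a ≠ 0 ∧ expo s' ≤ expo a) := by
  have hu := uro_pos p
  have hu1 := uro_le p hp
  have h0 := ulp_nonneg p a
  have h1 : |rn p (a + s') - a| ≤ 2.04 * ulp p a := by
    have e1 := abs_rn_sub_le_float (by lia : 1 ≤ p) (a + s') ha
    rw [show a - (a + s') = -s' by ring, abs_neg] at e1
    have e2 := abs_sub_le (rn p (a + s')) (a + s') a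
    rw [show a + s' - a = s' by ring] at e2
    linarith
  rcases eq_or_ne a 0 with rfl | ha0
  · have : s' = 0 := by
      rw [ulp, if_pos rfl, mul_zero] at h
      exact abs_eq_zero.1 (le_antisymm h (abs_nonneg _))
    subst this
    refine ⟨h1, ?_, fun h => absurd rfl h⟩
    have := ulp_nonneg p (rn p (0 + 0))
    rw [ulp, if_pos rfl]
    positivity
  · have h2 := ulp_le p a
    have hpos : 0 < |a| := abs_pos.2 ha0
    have h2' : 2.04 * ulp p a ≤ 0.02 * |a| := by
      have := mul_le_mul_of_nonneg_right hu1 hpos.le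
      linarith
    have h3 : 0.98 * |a| ≤ |rn p (a + s')| := by
      have := abs_sub_abs_le_abs_sub a (rn p (a + s'))
      rw [abs_sub_comm] at this
      linarith
    have hr0 : rn p (a + s') ≠ 0 := by
      intro h0
      rw [h0, abs_zero] at h3
      linarith
    have h4 : expo a - 1 ≤ expo (rn p (a + s')) := by
      refine le_expo (le_trans ?_ h3)
      have := zpow_expo_le ha0
      have e : (2 : ℝ) ^ (expo a - 1) = 2 ^ expo a / 2 := by
        rw [sub_eq_add_neg, two_zpow_add]; norm_num; ring
      rw [e]
      linarith
    have h5 : ulp p a ≤ 2 * ulp p (rn p (a + s')) := by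
      rw [ulp_of_ne_zero p ha0, ulp_of_ne_zero p hr0]
      have e : (2 : ℝ) ^ expo a = 2 * 2 ^ (expo a - 1) := by
        rw [sub_eq_add_neg, two_zpow_add]; norm_num; ring
      have := two_zpow_le h4
      rw [e]
      have := mul_le_mul_of_nonneg_left this hu.le
      linarith
    refine ⟨h1, ?_, fun hs => ⟨ha0, ?_⟩⟩
    · have e1 := ulp_le p s'
      have e2 := mul_le_mul_of_nonneg_left h hu.le
      have e3 := mul_le_mul_of_nonneg_left h5 hu.le
      have e4 := mul_nonneg hu.le (ulp_nonneg p (rn p (a + s')))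
      linarith
    · have : |s'| < 2 ^ (expo a) := by
        refine h.trans_lt ?_
        rw [ulp_of_ne_zero p ha0]
        have := two_zpow_pos (expo a)
        have := mul_le_mul_of_nonneg_right hu1 this.le
        linarith
      have := expo_lt hs this
      lia

/-- VecSum of an ulp-nonoverlapping expansion: the leading output is close to the leading entry, and
the errors decrease geometrically. -/
lemma vecSum_chain {p : ℕ} (hp : 8 ≤ p) (l : List ℝ) : ∀ a, (∀ x ∈ a :: l, IsFloat p x) →
    (a :: l).IsChain (fun a a' => |a'| ≤ ulp p a) →
    ∃ s es, vecSum p (a :: l) = s :: es ∧ |s - a| ≤ 2.04 * ulp p a ∧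
      |es.headD 0| ≤ 1 / 2 * ulp p s ∧
      ∀ k, nrm (es.drop k) ≤ 0.51 * (4.07 * uro p) ^ k * ulp p s := by
  have hu := uro_pos p
  have hu1 := uro_le p hp
  induction l with
  | nil =>
    intro a _ _
    refine ⟨a, [], by simp [vecSum], ?_, ?_, ?_⟩
    · have := ulp_nonneg p a
      simp; linarith
    · have := ulp_nonneg p a
      simp; linarith
    · intro k
      have := ulp_nonneg p a
      simp; positivity
  | cons a' l ih =>
    intro a hf hc
    obtain ⟨s', es', h, h1, h2, h3⟩ := ih a' (fun x hx => hf x (List.mem_cons_of_mem _ hx)) hc.tail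
    have ha : IsFloat p a := hf a (by simp)
    have hs : IsFloat p s' := by
      obtain ⟨s'', es'', e, he, -⟩ := vecSum_spec (by lia : 3 ≤ p) a' l
        (fun x hx => hf x (List.mem_cons_of_mem _ hx))
      rw [h, List.cons.injEq] at e
      exact e.1 ▸ he s'' (by simp)
    have haa : |a'| ≤ ulp p a := by
      rw [List.isChain_cons_cons] at hc
      exact hc.1
    have hs' : |s'| ≤ 1.016 * ulp p a := by
      have e1 := abs_sub_abs_le_abs_sub s' a'
      have e2 := ulp_le p a'
      have e3 := mul_le_mul_of_nonneg_right hu1 (abs_nonneg a')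
      linarith [abs_nonneg a']
    obtain ⟨r1, r2, -⟩ := ulp_step hp ha hs'
    have r3 := abs_sub_rn_le_half_ulp (by lia : 1 ≤ p) (a + s')
    refine ⟨_, _, vecSum_cons_of_eq (by lia) ha hs h, r1, by simpa using r3, ?_⟩
    have r0 := ulp_nonneg p (rn p (a + s'))
    have hd : ∀ k, nrm (es'.drop k) ≤ 0.51 * (4.07 * uro p) ^ (k + 1) * ulp p (rn p (a + s')) := by
      intro k
      refine (h3 k).trans ?_
      rw [pow_succ]
      have := mul_le_mul_of_nonneg_left r2 (show 0 ≤ 0.51 * (4.07 * uro p) ^ k by positivity)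
      linarith
    rintro (_ | k)
    · have e1 := hd 0
      have e2 := mul_le_mul_of_nonneg_right hu1 r0
      simp only [List.drop_zero, nrm_cons, pow_zero, zero_add, pow_one] at *
      linarith
    · exact hd k

/-- Leading zeros among the outputs of VecSum of an ulp-nonoverlapping expansion are skipped by
VecSumErrBranch; the first nonzero one dominates what follows. -/
lemma vecSumErrBranch_chain {p : ℕ} (hp : 8 ≤ p) (m : ℕ) (l : List ℝ) : ∀ a,
    (∀ x ∈ a :: l, IsFloat p x) → (a :: l).IsChain (fun a a' => |a'| ≤ ulp p a) →
    ∀ s es h, vecSum p (a :: l) = s :: es → IsFloat p h →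
    (s ≠ 0 → IsMult (expo s - p + 1) h) → h + es.sum ≠ 0 →
    ∃ h' es' g, vecSumErrBranch p (h :: es) (m + 1) = vecSumErrBranch p (h' :: es') (m + 1) ∧
      IsFloat p h' ∧ (∀ x ∈ es', IsFloat p x) ∧ h' + es'.sum = h + es.sum ∧ 0 < g ∧ g ≤ |h'| ∧
      |es'.headD 0| ≤ 1 / 2 * g ∧ ∀ k, nrm (es'.drop k) ≤ 0.51 * (4.07 * uro p) ^ k * g := by
  have hu := uro_pos p
  have key : ∀ a l, (∀ x ∈ a :: l, IsFloat p x) →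
      (a :: l).IsChain (fun a a' => |a'| ≤ ulp p a) → ∀ s es h, vecSum p (a :: l) = s :: es →
      IsFloat p h → (s ≠ 0 → IsMult (expo s - p + 1) h) → h ≠ 0 →
      ∃ h' es' g, vecSumErrBranch p (h :: es) (m + 1) = vecSumErrBranch p (h' :: es') (m + 1) ∧
      IsFloat p h' ∧ (∀ x ∈ es', IsFloat p x) ∧ h' + es'.sum = h + es.sum ∧ 0 < g ∧ g ≤ |h'| ∧
      |es'.headD 0| ≤ 1 / 2 * g ∧ ∀ k, nrm (es'.drop k) ≤ 0.51 * (4.07 * uro p) ^ k * g := by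
    intro a l hf hc s es h hv hh hm h0
    obtain ⟨s1, es1, e1, q1, -⟩ := vecSum_spec (by lia : 3 ≤ p) a l hf
    obtain ⟨s2, es2, e2, -, q2, q3⟩ := vecSum_chain hp l a hf hc
    rw [hv, List.cons.injEq] at e1 e2
    obtain ⟨rfl, rfl⟩ := e1
    obtain ⟨rfl, rfl⟩ := e2
    have hpos : 0 < |h| := abs_pos.2 h0
    have hes : ∀ x ∈ es, IsFloat p x := fun x hx => q1 x (List.mem_cons_of_mem _ hx)
    rcases eq_or_ne s 0 with hs | hs
    · have hu0 : ulp p s = 0 := by rw [hs, ulp, if_pos rfl]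
      rw [hu0] at q2 q3
      refine ⟨h, es, |h|, rfl, hh, hes, rfl, hpos, le_rfl, by linarith, fun k => ?_⟩
      have := q3 k
      have : 0 ≤ 0.51 * (4.07 * uro p) ^ k * |h| := by positivity
      linarith
    · refine ⟨h, es, ulp p s, rfl, hh, hes, rfl, ?_, ?_, q2, q3⟩
      · rw [ulp, if_neg hs]; exact two_zpow_pos _
      · rw [ulp, if_neg hs]; exact (hm hs).le_abs h0
  induction l with
  | nil =>
    intro a hf hc s es h hv hh hm h0
    refine key a [] hf hc s es h hv hh hm ?_
    simp only [vecSum, List.cons.injEq] at hv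
    rintro rfl
    rw [← hv.2] at h0
    simp at h0
  | cons a' l ih =>
    intro a hf hc s es h hv hh hm h0
    by_cases hz : h = 0
    · subst hz
      have hf' : ∀ x ∈ a' :: l, IsFloat p x := fun x hx => hf x (List.mem_cons_of_mem _ hx)
      obtain ⟨s', es', e1, q1, -⟩ := vecSum_spec (by lia : 3 ≤ p) a' l hf'
      obtain ⟨s2, es2, e2, q2, -⟩ := vecSum_chain hp l a' hf' hc.tail
      rw [e1, List.cons.injEq] at e2
      obtain ⟨rfl, rfl⟩ := e2
      have ha : IsFloat p a := hf a (by simp)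
      have hs' : IsFloat p s' := q1 s' (by simp)
      rw [vecSum_cons_of_eq (by lia) ha hs' e1, List.cons.injEq] at hv
      obtain ⟨rfl, rfl⟩ := hv
      have haa : |a'| ≤ ulp p a := by
        rw [List.isChain_cons_cons] at hc
        exact hc.1
      have hb : |s'| ≤ 1.016 * ulp p a := by
        have e1 := abs_sub_abs_le_abs_sub s' a'
        have e2 := ulp_le p a'
        have e3 := mul_le_mul_of_nonneg_right (uro_le p hp) (abs_nonneg a')
        linarith [abs_nonneg a']
      obtain ⟨-, -, r3⟩ := ulp_step hp ha hb
      have hfe := isFloat_add_err (by lia : 1 ≤ p) ha hs'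
      obtain ⟨h', es'', g, i1, i2, i3, i4, i5⟩ := ih a' hf' hc.tail s' es' _ e1 hfe
        (fun hs0 => (isMult_twoSum (by lia) ha hs' (r3 hs0).1 hs0 (r3 hs0).2).2)
        (by simpa using h0)
      refine ⟨h', es'', g, ?_, i2, i3, ?_, i5⟩
      · rw [← i1]
        simp only [vecSumErrBranch]
        rw [vecSumErrBranchLoop_zero_cons (by lia) m hfe]
      · rw [i4]; simp
    · exact key a _ hf hc s es h hv hh hm hz

/-- The output of VecSumErrBranch when the entries decrease geometrically. The first two entries
enter only through their sum `Q`: they may cancel up to a factor of two. -/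
lemma vecSumErrBranch_shape {p : ℕ} (hp : 8 ≤ p) {m : ℕ} (hm : 1 ≤ m) {h : ℝ} {es : List ℝ}
    (hh : IsFloat p h) (hes : ∀ x ∈ es, IsFloat p x) {Q : ℝ} (hQ : |h + es.headD 0| = Q)
    (hQ0 : 0 < Q)
    (hc : ∀ k, nrm (es.drop (k + 1)) ≤ 4.16 * 0.016 ^ k * (uro p * Q)) (hpos : 0 < h + es.sum) :
    Shape p (vecSumErrBranch p (h :: es) (m + 1)) 5.5 0.1 0.01 0.001 ∧
      |(vecSumErrBranch p (h :: es) (m + 1)).sum - (h + es.sum)| ≤ 0.1 * uro p * (h + es.sum) := by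
  have hu := uro_pos p
  have hu1 := uro_le p hp
  have hU : 0 < uro p * Q := by positivity
  have huU := mul_le_mul_of_nonneg_right hu1 hU.le
  set U := uro p * Q with hUd
  set b : ℕ → ℝ := fun k => if k ≤ 1 then 5.2 * U else if k = 2 then 0.09 * U else
    if k = 3 then 0.002 * U else 0.0009 * U with hb
  have c1 := hc 0
  have c2 := hc 1
  have c3 := hc 2
  rw [pow_zero, zero_add] at c1
  norm_num at c2 c3
  have hT : |h + es.sum - (h + es.headD 0)| ≤ 4.16 * U := by
    cases es with
    | nil => simp; positivity
    | cons e es =>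
      have := abs_sum_le_nrm es
      simp only [List.drop_succ_cons, List.drop_zero] at c1
      simp only [List.sum_cons, List.headD_cons]
      rw [show h + (e + es.sum) - (h + e) = es.sum by ring]
      linarith
  obtain ⟨f1, f2, f3, -, f5⟩ := vecSumErrBranch_bounds hp m es h hh hes
    (fun k => nrm (es.drop k)) b (fun k => le_rfl)
    (by
      have e : b 1 = 5.2 * U := rfl
      have := mul_le_mul_of_nonneg_left c1 hu.le
      rw [e, hQ]
      linarith)
    (by
      intro k hk
      rcases (show k = 1 ∨ k = 2 ∨ 3 ≤ k by lia) with rfl | rfl | hk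
      · simp only [hb]; norm_num; linarith
      · simp only [hb]; norm_num; linarith
      · have h4 : nrm (es.drop (k + 1)) ≤ 0.0001 * U := by
          have e1 := nrm_drop_anti (show 4 ≤ k + 1 by lia) es
          have e2 := hc 3
          norm_num at e2
          linarith
        rcases (show k = 3 ∨ 4 ≤ k by lia) with rfl | hk
        · simp only [hb]; norm_num; linarith
        · have e1 : b k = 0.0009 * U := by
            simp only [hb]; rw [if_neg (by lia), if_neg (by lia), if_neg (by lia)]
          have e2 : b (k + 1) = 0.0009 * U := by
            simp only [hb]; rw [if_neg (by lia), if_neg (by lia), if_neg (by lia)]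
          rw [e1, e2]
          linarith)
  have hTQ : (1 - 4.16 * uro p) * Q ≤ h + es.sum := by
    have e1 := abs_sub_abs_le_abs_sub (h + es.headD 0) (h + es.sum)
    rw [abs_sub_comm, hQ, abs_of_pos hpos] at e1
    linarith
  have f3' : |h + es.sum - lead (vecSumErrBranch p (h :: es) (m + 1))| ≤ 5.2 * U := f3
  have hl : 0.9634 * Q ≤ lead (vecSumErrBranch p (h :: es) (m + 1)) := by
    have e1 := (abs_le.1 f3').2
    have e2 := mul_le_mul_of_nonneg_right hu1 hQ0.le
    linarith
  have hl' := mul_le_mul_of_nonneg_left hl hu.le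
  have hA := fun (x : ℝ) (hx : 0 ≤ x) => mul_le_mul_of_nonneg_right (amp_le hp) (mul_nonneg hx hU.le)
  refine ⟨⟨f1, by linarith, ?_, ?_, ?_, ?_⟩, ?_⟩
  · have := f2 1 le_rfl
    have := hA 5.2 (by norm_num)
    simp only [hb] at *
    norm_num at *
    linarith
  · have := f2 2 (by lia)
    have := hA 0.09 (by norm_num)
    simp only [hb] at *
    norm_num at *
    linarith
  · have := f2 3 (by lia)
    have := hA 0.002 (by norm_num)
    simp only [hb] at *
    norm_num at *
    linarith
  · have := f2 4 (by lia)
    have := hA 0.0009 (by norm_num)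
    simp only [hb] at *
    norm_num at *
    linarith
  · have e : b (m + 1) ≤ 0.09 * U := by
      simp only [hb]
      rw [if_neg (by lia)]
      split_ifs <;> linarith
    rw [abs_sub_comm]
    have e1 := mul_le_mul_of_nonneg_left hTQ hu.le
    have e2 := mul_le_mul_of_nonneg_left huU (show (0 : ℝ) ≤ 1 by norm_num)
    linarith

/-- Renormalization of an entry followed by an ulp-nonoverlapping expansion of smaller magnitude, the
sum being positive. There may be arbitrary cancellation. -/
lemma renormalize_cons_chain {p : ℕ} (hp : 8 ≤ p) {m : ℕ} (hm : 1 ≤ m) {c a : ℝ} {l : List ℝ}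
    (hf : ∀ x ∈ c :: a :: l, IsFloat p x) (hc : (a :: l).IsChain (fun a a' => |a'| ≤ ulp p a))
    (hc0 : c ≠ 0) (hac : 1.016 * |a| < 2 ^ (expo c + 1)) (hpos : 0 < (c :: a :: l).sum) :
    Shape p (renormalize p (c :: a :: l) (m + 1)) 5.5 0.1 0.01 0.001 ∧
      |(renormalize p (c :: a :: l) (m + 1)).sum - (c :: a :: l).sum| ≤
        0.1 * uro p * (c :: a :: l).sum := by
  have hu := uro_pos p
  have hu1 := uro_le p hp
  have hf' : ∀ x ∈ a :: l, IsFloat p x := fun x hx => hf x (List.mem_cons_of_mem _ hx)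
  obtain ⟨s, es, e1, q1, q2, -⟩ := vecSum_spec (by lia : 3 ≤ p) a l hf'
  obtain ⟨s2, es2, e2, q3, q4, q5⟩ := vecSum_chain hp l a hf' hc
  rw [e1, List.cons.injEq] at e2
  obtain ⟨rfl, rfl⟩ := e2
  have hcf : IsFloat p c := hf c (by simp)
  have hsf : IsFloat p s := q1 s (by simp)
  have hesf : ∀ x ∈ es, IsFloat p x := fun x hx => q1 x (List.mem_cons_of_mem _ hx)
  have hr : renormalize p (c :: a :: l) (m + 1) =
      vecSumErrBranch p (rn p (c + s) :: (c + s - rn p (c + s)) :: es) (m + 1) := by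
    rw [renormalize, vecSum_cons_of_eq (by lia) hcf hsf e1]
  have hsum : (c :: a :: l).sum = rn p (c + s) + ((c + s - rn p (c + s)) + es.sum) := by
    simp only [List.sum_cons]
    linarith
  have hexp : s ≠ 0 → expo s ≤ expo c := by
    intro hs
    have h1 : |s| < 2 ^ (expo c + 1) := by
      have e3 := abs_sub_abs_le_abs_sub s a
      have e4 := ulp_le p a
      have e5 := mul_le_mul_of_nonneg_right hu1 (abs_nonneg a)
      linarith [abs_nonneg a]
    have := expo_lt hs h1
    lia
  have hmul := fun hs : s ≠ 0 => isMult_twoSum (by lia) hcf hsf hc0 hs (hexp hs)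
  have hrf : IsFloat p (rn p (c + s)) := isFloat_rn (by lia) _
  have hef : IsFloat p (c + s - rn p (c + s)) := isFloat_add_err (by lia) hcf hsf
  have hpow : ∀ k, (4.07 * uro p) ^ k ≤ 0.016 ^ k := fun k =>
    pow_le_pow_left₀ (by positivity) (by linarith) k
  rw [hr, hsum]
  rw [hsum] at hpos
  by_cases hz : c + s - rn p (c + s) = 0
  · -- The sum is exact, and the zero is skipped.
    rw [hz, zero_add] at hpos ⊢
    obtain ⟨h', es', g, i1, i2, i3, i4, i5, i6, i7, i8⟩ := vecSumErrBranch_chain hp m l a hf' hc s es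
      (rn p (c + s)) e1 hrf (fun hs => (hmul hs).1) hpos.ne'
    have hb : vecSumErrBranch p (rn p (c + s) :: 0 :: es) (m + 1) =
        vecSumErrBranch p (rn p (c + s) :: es) (m + 1) := by
      simp only [vecSumErrBranch]
      rw [vecSumErrBranchLoop_cons_zero (by lia) m hrf]
    rw [hb, i1, ← i4]
    rw [← i4] at hpos
    have hQ : 1 / 2 * g ≤ |h' + es'.headD 0| := by
      have := abs_sub_abs_le_abs_sub h' (-es'.headD 0)
      rw [sub_neg_eq_add, abs_neg] at this
      linarith
    refine vecSumErrBranch_shape hp hm i2 i3 rfl (by linarith) (fun k => (i8 (k + 1)).trans ?_) hpos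
    have e3 := mul_le_mul_of_nonneg_right (hpow k) (mul_nonneg hu.le (abs_nonneg (h' + es'.headD 0)))
    have e4 := mul_le_mul_of_nonneg_left hQ (show 0 ≤ (4.07 * uro p) ^ k * uro p by positivity)
    have e5 : 0 ≤ (4.07 * uro p) ^ k * uro p * |h' + es'.headD 0| := by positivity
    rw [pow_succ]
    linarith
  · have hs : s ≠ 0 := by
      rintro rfl
      rw [add_zero, rn_of_isFloat (by lia) hcf, sub_self] at hz
      exact hz rfl
    have hg : ulp p s ≤ |c + s - rn p (c + s)| := by
      rw [ulp, if_neg hs]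
      exact (hmul hs).2.le_abs hz
    have he : |c + s - rn p (c + s)| ≤ uro p * |rn p (c + s)| := by
      have h1 := abs_sub_rn_le_half_ulp (by lia : 1 ≤ p) (c + s)
      have h2 := ulp_le p (rn p (c + s))
      linarith
    have hr0 : 0 < |rn p (c + s)| := by
      by_contra hneg
      have : |rn p (c + s)| = 0 := le_antisymm (not_lt.1 hneg) (abs_nonneg _)
      rw [this, mul_zero] at he
      exact hz (abs_eq_zero.1 (le_antisymm he (abs_nonneg _)))
    have hQ : 0.996 * |rn p (c + s)| ≤ |rn p (c + s) + (c + s - rn p (c + s))| := by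
      have h1 := abs_sub_abs_le_abs_sub (rn p (c + s)) (-(c + s - rn p (c + s)))
      rw [sub_neg_eq_add, abs_neg] at h1
      have h2 := mul_le_mul_of_nonneg_right hu1 hr0.le
      linarith
    refine vecSumErrBranch_shape hp hm hrf (es := (c + s - rn p (c + s)) :: es)
      (by simpa using ⟨hef, hesf⟩) rfl ?_ (fun k => ?_) (by simpa using hpos)
    · simp only [List.headD_cons]
      linarith
    · simp only [List.headD_cons, List.drop_succ_cons]
      have h1 := q5 k
      have h2 := (hg.trans he).trans (mul_le_mul_of_nonneg_left
        (show |rn p (c + s)| ≤ 1.01 * |rn p (c + s) + (c + s - rn p (c + s))| by linarith) hu.le)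
      have h3 := mul_le_mul_of_nonneg_left h2 (show 0 ≤ (4.07 * uro p) ^ k by positivity)
      have h4 := mul_le_mul_of_nonneg_right (hpow k)
        (mul_nonneg hu.le (abs_nonneg (rn p (c + s) + (c + s - rn p (c + s)))))
      have h5 : 0 ≤ (0.016 : ℝ) ^ k * (uro p * |rn p (c + s) + (c + s - rn p (c + s))|) := by
        positivity
      linarith

/-! ### The Newton iteration -/

namespace MulParams

/-- The product of an approximate reciprocal and the divisor. -/
def residual : MulParams :=
  ⟨5.3, 0.6, 0.07, 0.0135, 5.5, 0.1, 0.01, 0.001, 21 / 256,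
    3.10727, 0.37035, 0.05384, 0.00982, 0.01549, 0.42646, 0.05912, 0.01062⟩

/-- The update of an approximate reciprocal in the steps before the last one. -/
def update : MulParams :=
  ⟨5.3, 0.6, 0.07, 0.0135, 4, 0.51, 0.073, 0.014, 17 / 256,
    3.56250, 0.49671, 0.05649, 0.01188, 0.01732, 0.56039, 0.06293, 0.01278⟩

/-- The update of an approximate reciprocal in the last step, where there are more terms. -/
def lastUpdate : MulParams :=
  ⟨5.3, 0.6, 0.07, 0.0135, 4, 0.51, 0.073, 0.014, 29 / 256,
    3.56250, 0.49671, 0.11227, 0.02947, 0.01732, 0.56039, 0.12038, 0.03135⟩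

/-- The product of the argument and a reciprocal. -/
def quotient : MulParams :=
  ⟨2.1, 0.02, 0.0002, 0.00001, 5.3, 0.6, 0.13, 0.035, 21 / 256,
    3.37056, 0.52053, 0.07096, 0.01141, 0.01655, 0.58333, 0.07802, 0.01242⟩

/-- The product of the argument and its double. -/
def square : MulParams :=
  ⟨2.1, 0.02, 0.0002, 0.00001, 2.1, 0.02, 0.0002, 0.00001, 21 / 256,
    2.46221, 0.22135, 0.03294, 0.00423, 0.01289, 0.26764, 0.03632, 0.00468⟩

/-- The product of the square and a reciprocal. -/
def squareQuotient : MulParams :=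
  ⟨3.95, 0.26, 0.037, 0.005, 5.3, 0.6, 0.13, 0.035, 21 / 256,
    3.68634, 0.58762, 0.08376, 0.01769, 0.01782, 0.65505, 0.09178, 0.01899⟩

/-! The parameters `R` and `t` are solutions of the inequalities in `MulParams.Valid`, rounded up; the
first eight numbers are the shapes of the factors. -/

lemma residual_valid : residual.Valid := by
  constructor <;> norm_num [residual, M₁, M₂, M₃, M₄]

lemma update_valid : update.Valid := by
  constructor <;> norm_num [update, M₁, M₂, M₃, M₄]

lemma lastUpdate_valid : lastUpdate.Valid := by
  constructor <;> norm_num [lastUpdate, M₁, M₂, M₃, M₄]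

lemma quotient_valid : quotient.Valid := by
  constructor <;> norm_num [quotient, M₁, M₂, M₃, M₄]

lemma square_valid : square.Valid := by
  constructor <;> norm_num [square, M₁, M₂, M₃, M₄]

lemma squareQuotient_valid : squareQuotient.Valid := by
  constructor <;> norm_num [squareQuotient, M₁, M₂, M₃, M₄]

lemma residual_out : residual.ShapeOut 4.8 0.425 0.061 0.011 ∧ residual.valErr ≤ 2.17 := by
  refine ⟨⟨?_, ?_, ?_, ?_, ?_⟩, ?_⟩ <;>
  norm_num [residual, leadErr, valErr, baseErr, accErr, b₁, b₂, b₃, b₄, M₁, M₂, M₃]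

lemma update_out : update.ShapeOut 5.3 0.6 0.07 0.0135 ∧ update.valErr ≤ 2.27 := by
  refine ⟨⟨?_, ?_, ?_, ?_, ?_⟩, ?_⟩ <;>
  norm_num [update, leadErr, valErr, baseErr, accErr, b₁, b₂, b₃, b₄, M₁, M₂, M₃]

lemma lastUpdate_out : lastUpdate.ShapeOut 5.3 0.6 0.13 0.035 ∧ lastUpdate.valErr ≤ 2.27 := by
  refine ⟨⟨?_, ?_, ?_, ?_, ?_⟩, ?_⟩ <;>
  norm_num [lastUpdate, leadErr, valErr, baseErr, accErr, b₁, b₂, b₃, b₄, M₁, M₂, M₃]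

lemma quotient_out : quotient.ShapeOut 5 0.6 0.08 0.013 ∧ quotient.valErr' ≤ 2.83 := by
  refine ⟨⟨?_, ?_, ?_, ?_, ?_⟩, ?_⟩ <;>
  norm_num [quotient, leadErr, valErr', baseErr, accErr, b₁, b₂, b₃, b₄, M₁, M₂, M₃]

lemma square_out : square.ShapeOut 3.95 0.26 0.037 0.005 ∧ square.valErr' ≤ 2.06 := by
  refine ⟨⟨?_, ?_, ?_, ?_, ?_⟩, ?_⟩ <;>
  norm_num [square, leadErr, valErr', baseErr, accErr, b₁, b₂, b₃, b₄, M₁, M₂, M₃]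

lemma squareQuotient_out :
    squareQuotient.ShapeOut 5.5 0.7 0.1 0.02 ∧ squareQuotient.valErr' ≤ 3.08 := by
  refine ⟨⟨?_, ?_, ?_, ?_, ?_⟩, ?_⟩ <;>
  norm_num [squareQuotient, leadErr, valErr', baseErr, accErr, b₁, b₂, b₃, b₄, M₁, M₂, M₃]

end MulParams

namespace Shape

variable {p : ℕ} {x : List ℝ} {a₁ a₂ a₃ a₄ : ℝ}

lemma lead_le_sum (hp : 8 ≤ p) (h : Shape p x a₁ a₂ a₃ a₄) (h0 : 0 ≤ a₁) :
    (1 - a₁ / 256) * lead x ≤ x.sum := by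
  have h1 := (abs_le.1 h.abs_sum_sub_lead_le).1
  have h2 := mul_le_mul_of_nonneg_left (uro_le p hp) (mul_nonneg h0 h.pos.le)
  linarith

lemma take (h : Shape p x a₁ a₂ a₃ a₄) {n : ℕ} (hn : 1 ≤ n) : Shape p (x.take n) a₁ a₂ a₃ a₄ := by
  have hl : lead (x.take n) = lead x := by
    obtain ⟨n, rfl⟩ := Nat.exists_eq_add_of_le' hn
    cases x <;> simp [lead]
  have ht : ∀ k, nrm ((x.take n).drop k) ≤ nrm (x.drop k) := fun k => by
    rw [List.drop_take]
    have := nrm_take_add_drop (n - k) (x.drop k)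
    linarith [nrm_nonneg ((x.drop k).drop (n - k))]
  refine ⟨fun a ha => h.isFloat a (List.mem_of_mem_take ha), by rw [hl]; exact h.pos, ?_, ?_, ?_, ?_⟩
    <;> rw [hl]
  exacts [(ht 1).trans h.tail₁, (ht 2).trans h.tail₂, (ht 3).trans h.tail₃, (ht 4).trans h.tail₄]

lemma abs_sum_take_sub_le (h : Shape p x a₁ a₂ a₃ a₄) {n : ℕ} (hn : 2 ≤ n) :
    |(x.take n).sum - x.sum| ≤ a₂ * uro p * lead x := by
  have h1 : x.sum = (x.take n).sum + (x.drop n).sum := by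
    rw [← List.sum_append, List.take_append_drop]
  rw [h1, sub_add_cancel_left, abs_neg]
  exact (abs_sum_le_nrm _).trans ((nrm_drop_anti hn x).trans h.tail₂)

end Shape

/-- VecSum of a list of small numbers that is followed by `2`. -/
lemma vecSum_append_two {p : ℕ} (hp : 8 ≤ p) (y : List ℝ) (hf : ∀ a ∈ y, IsFloat p a)
    (hy : nrm y ≤ 0.02) :
    ∃ s es, vecSum p (y ++ [2]) = s :: es ∧ (∀ x ∈ s :: es, IsFloat p x) ∧
      s + es.sum = y.sum + 2 ∧ |es.headD 0| ≤ 2.05 * uro p ∧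
      ∀ k, nrm (es.drop k) ≤ nrm (y.drop k) := by
  have hu := uro_pos p
  induction y with
  | nil =>
    refine ⟨2, [], by simp [vecSum], ?_, by simp, by simp; positivity, by simp⟩
    have := isFloat_two_zpow (p := p) (by lia) 1
    simpa using this
  | cons a y ih =>
    rw [nrm_cons] at hy
    obtain ⟨s, es, h1, h2, h3, h4, h5⟩ := ih (fun x hx => hf x (List.mem_cons_of_mem _ hx))
      (by linarith [abs_nonneg a])
    have ha := hf a (by simp)
    have hs := h2 s (by simp)
    refine ⟨rn p (a + s), (a + s - rn p (a + s)) :: es,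
      vecSum_cons_of_eq (by lia) ha hs h1, ?_, ?_, ?_, ?_⟩
    · intro x hx
      rcases List.mem_cons.1 hx with rfl | hx
      · exact isFloat_rn (by lia) _
      rcases List.mem_cons.1 hx with rfl | hx
      · exact isFloat_add_err (by lia) ha hs
      · exact h2 x (List.mem_cons_of_mem _ hx)
    · simp only [List.sum_cons]; linarith
    · have e1 := abs_sub_rn_le p (a + s)
      have e2 : |a + s| ≤ 2.05 := by
        have e3 := abs_sum_le_nrm es
        have e4 := h5 0
        have e5 := abs_sum_le_nrm y
        simp only [List.drop_zero] at e4
        rw [abs_le] at *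
        have := abs_le.1 (le_refl |a|)
        constructor <;> linarith [e3.1, e3.2, e5.1, e5.2, this.1, this.2]
      have := mul_le_mul_of_nonneg_left e2 hu.le
      simp only [List.headD_cons]
      linarith
    · rintro (_ | k)
      · have := abs_add_sub_rn_le_right (by lia : 1 ≤ p) a hs
        have := h5 0
        simp only [List.drop_zero, nrm_cons] at *
        linarith
      · exact h5 k

lemma sum_map_neg (l : List ℝ) : (l.map (fun a => -a)).sum = -l.sum := by
  induction l with
  | nil => simp
  | cons a l ih => rw [List.map_cons, List.sum_cons, List.sum_cons, ih]; ring

/-- The correction factor `2 - v` of the Newton step. -/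
lemma correction_spec {p : ℕ} (hp : 8 ≤ p) {v : List ℝ} (hv : Shape p v 4.8 0.425 0.061 0.011)
    (hs : |v.sum - 1| ≤ 9.33 * uro p) {R : ℕ} (hR : 4 ≤ R) :
    let w := renormalize p (v.map (fun a => -a) ++ [2]) R
    Shape p w 4 0.51 0.073 0.014 ∧ |w.sum - (2 - v.sum)| ≤ 0.02 * uro p ∧ lead w ≤ 1.06 := by
  intro w
  have hu := uro_pos p
  have hu1 := uro_le p hp
  set u := uro p with hud
  have huu := mul_le_mul_of_nonneg_right hu1 hu.le
  obtain ⟨v₀, y, rfl⟩ : ∃ v₀ y, v = v₀ :: y := List.exists_cons_of_ne_nil hv.ne_nil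
  have hlead := hv.lead_le_sum hp (by norm_num)
  have hpos := hv.pos
  rw [lead_cons] at hlead hpos
  have hs' := abs_le.1 hs
  have hv0 : v₀ ≤ 1.0565 := by linarith [hs'.2]
  have hUv : u * v₀ ≤ u * 1.0565 := mul_le_mul_of_nonneg_left hv0 hu.le
  have t1 := hv.tail₁
  have t2 := hv.tail₂
  have t3 := hv.tail₃
  have t4 := hv.tail₄
  simp only [List.drop_succ_cons, List.drop_zero, lead_cons] at t1 t2 t3 t4
  have hnd : ∀ k, nrm ((y.map (fun a => -a)).drop k) = nrm (y.drop k) := fun k => by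
    rw [← List.map_drop, nrm_map_neg]
  have hyf : ∀ a ∈ y.map (fun a => -a), IsFloat p a := by
    intro a ha
    obtain ⟨b, hb, rfl⟩ := List.mem_map.1 ha
    exact (hv.isFloat b (List.mem_cons_of_mem _ hb)).neg
  obtain ⟨s, es, e1, e2, e3, e4, e5⟩ := vecSum_append_two hp (y.map (fun a => -a)) hyf
    (by rw [nrm_map_neg]; linarith)
  have hyn : (y.map (fun a => -a)).sum = -y.sum := by
    exact sum_map_neg y
  rw [hyn] at e3
  have hsf := e2 s (by simp)
  have hnf := (hv.isFloat v₀ (by simp)).neg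
  set h := rn p (-v₀ + s) with hh
  set e := -v₀ + s - h with he
  have hw : w = vecSumErrBranch p (h :: e :: es) ((R - 1) + 1) := by
    rw [Nat.sub_add_cancel (by lia)]
    change renormalize p _ R = _
    rw [renormalize, List.map_cons, List.cons_append, vecSum_cons_of_eq (by lia) hnf hsf e1]
  have hT : h + (e :: es).sum = 2 - (v₀ :: y).sum := by
    simp only [List.sum_cons, he]
    linarith
  have d1 : nrm (es.drop 1) ≤ 0.4491 * u := by
    have := e5 1
    rw [hnd] at this
    linarith
  have d2 : nrm (es.drop 2) ≤ 0.0645 * u := by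
    have := e5 2
    rw [hnd] at this
    linarith
  have d3 : nrm (es.drop 3) ≤ 0.01163 * u := by
    have := e5 3
    rw [hnd] at this
    linarith
  have d0 : nrm es ≤ 2.5 * u := by
    cases es with
    | nil => simp; positivity
    | cons b es =>
      simp only [nrm_cons, List.headD_cons, List.drop_succ_cons, List.drop_zero] at *
      linarith
  have hS : |h + e| ≤ 1.048 := by
    have h1 := abs_sum_le_nrm es
    have h2 : h + e = 2 - (v₀ :: y).sum - es.sum := by
      simp only [List.sum_cons] at hT ⊢
      linarith
    rw [h2]
    rw [abs_le] at *
    constructor <;> linarith [h1.1, h1.2, hs'.1, hs'.2]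
  set b : ℕ → ℝ := fun k => if k ≤ 1 then 3.6 * u else if k = 2 then 0.4632 * u else
    if k = 3 then 0.0664 * u else 0.012 * u with hb
  obtain ⟨f1, f2, f3, -, f5⟩ := vecSumErrBranch_bounds hp (R - 1) (e :: es) h (isFloat_rn (by lia) _)
    (by
      intro x hx
      rcases List.mem_cons.1 hx with rfl | hx
      · exact isFloat_add_err (by lia) hnf hsf
      · exact e2 x (List.mem_cons_of_mem _ hx))
    (fun k => nrm ((e :: es).drop k)) b (fun k => le_rfl)
    (by
      have eb : b 1 = 3.6 * u := rfl
      have h1 := mul_le_mul_of_nonneg_left hS hu.le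
      have h2 := mul_le_mul_of_nonneg_left d0 hu.le
      rw [eb]
      simp only [List.drop_succ_cons, List.drop_zero, List.headD_cons]
      linarith)
    (by
      intro k hk
      rcases (show k = 1 ∨ k = 2 ∨ 3 ≤ k by lia) with rfl | rfl | hk
      · simp only [hb, List.drop_succ_cons]; norm_num; norm_num at d1; linarith
      · simp only [hb, List.drop_succ_cons]; norm_num; linarith
      · have h4 : nrm ((e :: es).drop (k + 1)) ≤ 0.01163 * u := by
          rw [List.drop_succ_cons]
          exact (nrm_drop_anti hk es).trans d3
        rcases (show k = 3 ∨ 4 ≤ k by lia) with rfl | hk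
        · simp only [hb]; norm_num; norm_num at h4; linarith
        · have e1 : b k = 0.012 * u := by
            simp only [hb]; rw [if_neg (by lia), if_neg (by lia), if_neg (by lia)]
          have e2 : b (k + 1) = 0.012 * u := by
            simp only [hb]; rw [if_neg (by lia), if_neg (by lia), if_neg (by lia)]
          rw [e1, e2]
          linarith)
  rw [← hw, hT] at f3 f5
  rw [← hw] at f1 f2
  have f3' : |2 - (v₀ :: y).sum - lead w| ≤ 3.6 * u := f3
  have f3'' := abs_le.1 f3'
  have hl : 0.949 ≤ lead w := by linarith [f3''.1, f3''.2, hs'.1, hs'.2]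
  have hA := fun (x : ℝ) (hx : 0 ≤ x) => mul_le_mul_of_nonneg_right (amp_le hp) (mul_nonneg hx hu.le)
  have hul := mul_le_mul_of_nonneg_left hl hu.le
  refine ⟨⟨f1, by linarith, ?_, ?_, ?_, ?_⟩, ?_, ?_⟩
  · have h1 := f2 1 le_rfl
    have h2 := hA 3.6 (by norm_num)
    rw [show b 1 = 3.6 * u from rfl] at h1
    linarith
  · have h1 := f2 2 (by lia)
    have h2 := hA 0.4632 (by norm_num)
    rw [show b 2 = 0.4632 * u by simp [hb]] at h1
    linarith
  · have h1 := f2 3 (by lia)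
    have h2 := hA 0.0664 (by norm_num)
    rw [show b 3 = 0.0664 * u by simp [hb]] at h1
    linarith
  · have h1 := f2 4 (by lia)
    have h2 := hA 0.012 (by norm_num)
    rw [show b 4 = 0.012 * u by simp [hb]] at h1
    linarith
  · have e : b (R - 1 + 1) = 0.012 * u := by
      simp only [hb]
      rw [if_neg (by lia), if_neg (by lia), if_neg (by lia)]
    rw [e] at f5
    rw [abs_sub_comm]
    linarith
  · linarith [f3''.1, f3''.2, hs'.1, hs'.2]

/-- One step of the Newton iteration for the reciprocal of `d`. -/
lemma newton_step {p β : ℕ} (hp : 8 ≤ p) (hβ : β + 2 ≤ p) (hβ2 : p + 4 ≤ 2 * β) {m : MulParams}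
    (hm : m.Valid) {z₁ z₂ z₃ z₄ : ℝ} (hz : m.ShapeOut z₁ z₂ z₃ z₄) (hval : m.valErr ≤ 2.27)
    {r d : List ℝ} (hr : Shape p r 5.3 0.6 0.07 0.0135) (hd : Shape p d 5.5 0.1 0.01 0.001)
    (hx : Shape p r m.x₁ m.x₂ m.x₃ m.x₄)
    (hy : ∀ w, Shape p w 4 0.51 0.073 0.014 → Shape p w m.y₁ m.y₂ m.y₃ m.y₄)
    (hE : |r.sum * d.sum - 1| ≤ 7 * uro p) {R : ℕ} (hR : 4 ≤ R)
    (hν : ((r.length + d.length + 5 : ℕ) : ℝ) * uro p ≤ 21 / 256)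
    (hν' : ((r.length + R + 5 : ℕ) : ℝ) * uro p ≤ m.ν) :
    let v := mul p β r d R
    let w := renormalize p (v.map (fun a => -a) ++ [2]) R
    let r' := mul p β r w R
    Shape p r' z₁ z₂ z₃ z₄ ∧ |r'.sum * d.sum - 1| ≤ 5.2 * uro p := by
  intro v w r'
  have hu := uro_pos p
  have hu1 := uro_le p hp
  have hlen : w.length = R := length_vecSumErrBranch _ _ _
  obtain ⟨v1, -, -, v2⟩ := mul_spec hp hβ hβ2 MulParams.residual_valid hr hd (r := R) (by lia)
    (le_trans (mul_le_mul_of_nonneg_right (by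
      have := min_le_left r.length (R + 1)
      have := min_le_left d.length (R + 1)
      exact_mod_cast (by lia)) hu.le) hν) MulParams.residual_out.1
  have v2 := v2 hR
  change |v.sum - _| ≤ _ at v2
  have r0 := hr.pos
  have d0 := hd.pos
  have r1 := hr.lead_le_sum hp (by norm_num)
  have d1 := hd.lead_le_sum hp (by norm_num)
  set u := uro p
  have hE' := abs_le.1 hE
  have hr0 : 0 < r.sum := by linarith
  have hd0 : 0 < d.sum := by linarith
  have hrd : lead r * lead d ≤ 1.0723 := by
    have := mul_le_mul r1 d1 (by positivity) hr0.le
    linarith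
  have hv : |v.sum - r.sum * d.sum| ≤ 2.33 * u := by
    have h1 := mul_le_mul_of_nonneg_right MulParams.residual_out.2
      (show 0 ≤ u * (lead r * lead d) by positivity)
    have h2 := mul_le_mul_of_nonneg_left hrd hu.le
    linarith
  have hv' := abs_le.1 hv
  obtain ⟨w1, w2, w3⟩ := correction_spec hp v1 (by
    change |v.sum - 1| ≤ 9.33 * u
    rw [abs_le]; constructor <;> linarith [hv'.1, hv'.2]) hR
  change Shape p w _ _ _ _ at w1
  change |w.sum - (2 - v.sum)| ≤ _ at w2
  change lead w ≤ _ at w3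
  obtain ⟨q1, -, -, q2⟩ := mul_spec hp hβ hβ2 hm hx (hy w w1) (r := R) (by lia)
    (le_trans (mul_le_mul_of_nonneg_right (by
      have := min_le_left r.length (R + 1)
      have := min_le_left w.length (R + 1)
      rw [hlen] at this ⊢
      exact_mod_cast (by lia)) hu.le) hν') hz
  have q2 := q2 hR
  change |r'.sum - _| ≤ _ at q2
  refine ⟨q1, ?_⟩
  set ρ := r.sum * d.sum with hρ
  have w2' := abs_le.1 w2
  have hg : |w.sum - (2 - ρ)| ≤ 2.35 * u := by
    rw [abs_le]; constructor <;> linarith [hv'.1, hv'.2, w2'.1, w2'.2]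
  have hk : |(r'.sum - r.sum * w.sum) * d.sum| ≤ 2.53 * u := by
    rw [abs_mul, abs_of_pos hd0]
    have h1 : lead r * d.sum ≤ 1.0492 := by
      have := mul_le_mul_of_nonneg_right r1 hd0.le
      linarith
    have h2 : lead r * d.sum * lead w ≤ 1.0492 * 1.06 :=
      mul_le_mul h1 w3 w1.pos.le (by norm_num)
    have h3 := mul_le_mul_of_nonneg_right q2 hd0.le
    have h4 := mul_le_mul_of_nonneg_right hval
      (show 0 ≤ u * (lead r * lead w) * d.sum by have := w1.pos; positivity)
    have h5 := mul_le_mul_of_nonneg_left h2 hu.le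
    linarith
  have hsq : (1 - ρ) ^ 2 ≤ 0.1915 * u := by
    have h1 := abs_mul_abs_self (ρ - 1)
    have h2 := mul_le_mul hE hE (abs_nonneg _) (by positivity)
    have h3 := mul_le_mul_of_nonneg_left hu1 hu.le
    have e : (1 - ρ) ^ 2 = (ρ - 1) * (ρ - 1) := by ring
    rw [e, ← h1]
    linarith
  have hρg : |ρ * (w.sum - (2 - ρ))| ≤ 2.415 * u := by
    have h1 : |ρ| ≤ 1.0274 := by rw [abs_le]; constructor <;> linarith [hE'.1, hE'.2]
    rw [abs_mul]
    have := mul_le_mul h1 hg (abs_nonneg _) (by norm_num)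
    linarith
  have e : r'.sum * d.sum - 1 =
      (r'.sum - r.sum * w.sum) * d.sum + ρ * (w.sum - (2 - ρ)) - (1 - ρ) ^ 2 := by
    rw [hρ]; ring
  have hk' := abs_le.1 hk
  have hρg' := abs_le.1 hρg
  have := sq_nonneg (1 - ρ)
  rw [e, abs_le]
  constructor <;> linarith [hk'.1, hk'.2, hρg'.1, hρg'.2]

lemma length_mul (p β : ℕ) (x y : List ℝ) (r : ℕ) : (mul p β x y r).length = r :=
  length_vecSumErrBranch _ _ _

/-- The starting value of the Newton iteration. -/
lemma reciprocalIter_zero_spec {p β : ℕ} (hp : 8 ≤ p) {d : List ℝ}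
    (hd : Shape p d 5.5 0.1 0.01 0.001) :
    Shape p (reciprocalIter p β d 0) 5.3 0.6 0.07 0.0135 ∧
      |(reciprocalIter p β d 0).sum * d.sum - 1| ≤ 7 * uro p := by
  have hu := uro_pos p
  have hu1 := uro_le p hp
  have d0 := hd.pos
  have h1 := abs_rn_sub_le_uro p (1 / lead d)
  have hinv : 0 < 1 / lead d := by positivity
  rw [abs_of_pos hinv] at h1
  have h2 := abs_le.1 h1
  have h3 := mul_le_mul_of_nonneg_right hu1 hinv.le
  set r₀ := rn p (1 / lead d) with hr
  have hr0 : 0 < r₀ := by linarith [h2.1]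
  have e : reciprocalIter p β d 0 = [r₀] := rfl
  rw [e]
  have hl : lead [r₀] = r₀ := rfl
  refine ⟨⟨?_, hr0, ?_, ?_, ?_, ?_⟩, ?_⟩
  · intro a ha
    rw [List.mem_singleton.1 ha]
    exact isFloat_rn (by lia) _
  all_goals try (simp [hl]; positivity)
  rw [List.sum_singleton]
  have h4 : |r₀ * lead d - 1| ≤ uro p := by
    have e : r₀ * lead d - 1 = (r₀ - 1 / lead d) * lead d := by field_simp
    rw [e, abs_mul, abs_of_pos d0]
    have := mul_le_mul_of_nonneg_right h1 d0.le
    have e2 : uro p * (1 / lead d) * lead d = uro p := by field_simp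
    rwa [e2] at this
  have h5 := hd.abs_sum_sub_lead_le
  have h6 : |r₀ * (d.sum - lead d)| ≤ 5.53 * uro p := by
    rw [abs_mul, abs_of_pos hr0]
    have e1 := mul_le_mul_of_nonneg_left h5 hr0.le
    have e2 := mul_le_mul_of_nonneg_left (show r₀ * lead d ≤ 1.004 by linarith [(abs_le.1 h4).2]) hu.le
    linarith
  rw [abs_le] at *
  have e : r₀ * d.sum - 1 = (r₀ * lead d - 1) + r₀ * (d.sum - lead d) := by ring
  rw [e]
  constructor <;> linarith [h4.1, h4.2, h6.1, h6.2]

/-- The Newton iteration before its last step. -/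
lemma reciprocalIter_spec {p β : ℕ} (hp : 8 ≤ p) (hβ : β + 2 ≤ p) (hβ2 : p + 4 ≤ 2 * β)
    {d : List ℝ} (hd : Shape p d 5.5 0.1 0.01 0.001) {q : ℕ} (hdq : d.length ≤ 2 ^ q)
    (hq : (2 : ℝ) ^ q * uro p ≤ 1 / 32) {i : ℕ} (hi : i + 1 ≤ q) :
    Shape p (reciprocalIter p β d i) 5.3 0.6 0.07 0.0135 ∧
      |(reciprocalIter p β d i).sum * d.sum - 1| ≤ 7 * uro p ∧
      (reciprocalIter p β d i).length ≤ 2 ^ (i + 1) := by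
  have hu := uro_pos p
  have hu1 := uro_le p hp
  induction i with
  | zero =>
    obtain ⟨h1, h2⟩ := reciprocalIter_zero_spec (β := β) hp hd
    exact ⟨h1, h2, by simp [reciprocalIter]⟩
  | succ i ih =>
    obtain ⟨h1, h2, h3⟩ := ih (by lia)
    have hp1 : (2 : ℕ) ^ (i + 2) ≤ 2 ^ q := Nat.pow_le_pow_right (by lia) (by lia)
    have hp2 : (2 : ℕ) ^ (i + 2) = 2 * 2 ^ (i + 1) := by rw [pow_succ]; ring
    have hn1 : (reciprocalIter p β d i).length + d.length + 5 ≤ 2 * 2 ^ q + 5 := by lia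
    have hn2 : 2 * ((reciprocalIter p β d i).length + 2 ^ (i + 2) + 5) ≤ 3 * 2 ^ q + 10 := by lia
    obtain ⟨h4, h5⟩ := newton_step hp hβ hβ2 MulParams.update_valid MulParams.update_out.1
      MulParams.update_out.2 h1 hd h1 (fun w hw => hw) h2 (R := 2 ^ (i + 2))
      (by rw [pow_add]; have := Nat.one_le_two_pow (n := i); lia)
      (by
        have : ((reciprocalIter p β d i).length + d.length + 5 : ℕ) * uro p ≤
          (2 * 2 ^ q + 5 : ℝ) * uro p := mul_le_mul_of_nonneg_right (by exact_mod_cast hn1) hu.le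
        linarith)
      (by
        have : 2 * ((reciprocalIter p β d i).length + 2 ^ (i + 2) + 5 : ℕ) * uro p ≤
          (3 * 2 ^ q + 10 : ℝ) * uro p := mul_le_mul_of_nonneg_right (by exact_mod_cast hn2) hu.le
        change _ ≤ (17 / 256 : ℝ)
        linarith)
    exact ⟨h4, h5.trans (by linarith), (length_mul _ _ _ _ _).le⟩

/-- The reciprocal: its terms, and how well it inverts the divisor. -/
lemma reciprocal_spec {p β : ℕ} (hp : 8 ≤ p) (hβ : β + 2 ≤ p) (hβ2 : p + 4 ≤ 2 * β)
    {d : List ℝ} (hd : Shape p d 5.5 0.1 0.01 0.001) {q : ℕ} (hq1 : 1 ≤ q) (hdq : d.length ≤ 2 ^ q)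
    (hq : (2 : ℝ) ^ q * uro p ≤ 1 / 32) :
    Shape p (reciprocal p β d q) 5.3 0.6 0.13 0.035 ∧
      |(reciprocal p β d q).sum * d.sum - 1| ≤ 5.9 * uro p ∧
      (reciprocal p β d q).length ≤ 2 ^ q := by
  have hu := uro_pos p
  have hu1 := uro_le p hp
  obtain ⟨i, rfl⟩ := Nat.exists_eq_add_of_le' hq1
  obtain ⟨h1, h2, h3⟩ := reciprocalIter_spec hp hβ hβ2 hd hdq hq (i := i) le_rfl
  have hp2 : (2 : ℕ) ^ (i + 2) = 2 * 2 ^ (i + 1) := by rw [pow_succ]; ring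
  have hn1 : (reciprocalIter p β d i).length + d.length + 5 ≤ 2 * 2 ^ (i + 1) + 5 := by lia
  have hn2 : (reciprocalIter p β d i).length + 2 ^ (i + 2) + 5 ≤ 3 * 2 ^ (i + 1) + 5 := by lia
  obtain ⟨h4, h5⟩ := newton_step hp hβ hβ2 MulParams.lastUpdate_valid MulParams.lastUpdate_out.1
    MulParams.lastUpdate_out.2 h1 hd h1 (fun w hw => hw) h2 (R := 2 ^ (i + 2))
    (by rw [pow_add]; have := Nat.one_le_two_pow (n := i); lia)
    (by
      have : ((reciprocalIter p β d i).length + d.length + 5 : ℕ) * uro p ≤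
        (2 * 2 ^ (i + 1) + 5 : ℝ) * uro p := mul_le_mul_of_nonneg_right (by exact_mod_cast hn1) hu.le
      linarith)
    (by
      have : ((reciprocalIter p β d i).length + 2 ^ (i + 2) + 5 : ℕ) * uro p ≤
        (3 * 2 ^ (i + 1) + 5 : ℝ) * uro p := mul_le_mul_of_nonneg_right (by exact_mod_cast hn2) hu.le
      change _ ≤ (29 / 256 : ℝ)
      linarith)
  change Shape p (reciprocalIter p β d (i + 1)) _ _ _ _ at h4
  change |(reciprocalIter p β d (i + 1)).sum * d.sum - 1| ≤ _ at h5
  set r := reciprocalIter p β d (i + 1)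
  have h2q : (2 : ℕ) ≤ 2 ^ (i + 1) := by
    rw [pow_succ]; have := Nat.one_le_two_pow (n := i); lia
  have hr : reciprocal p β d (i + 1) = r.take (2 ^ (i + 1)) := rfl
  rw [hr]
  refine ⟨h4.take (by lia), ?_, List.length_take_le _ _⟩
  have h6 := h4.abs_sum_take_sub_le h2q
  have d0 := hd.pos
  have d1 := hd.lead_le_sum hp (by norm_num)
  have hd0 : 0 < d.sum := by linarith
  have h7 := h4.lead_le_sum hp (by norm_num)
  have h5' := abs_le.1 h5
  have h8 : |((r.take (2 ^ (i + 1))).sum - r.sum) * d.sum| ≤ 0.65 * uro p := by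
    rw [abs_mul, abs_of_pos hd0]
    have e1 := mul_le_mul_of_nonneg_right h6 hd0.le
    have e2 := mul_le_mul_of_nonneg_right h7 hd0.le
    have e3 := mul_le_mul_of_nonneg_left (show lead r * d.sum ≤ 1.05 by linarith) hu.le
    linarith
  have h8' := abs_le.1 h8
  have e : (r.take (2 ^ (i + 1))).sum * d.sum - 1 = (r.sum * d.sum - 1) +
    ((r.take (2 ^ (i + 1))).sum - r.sum) * d.sum := by ring
  rw [e, abs_le]
  constructor <;> linarith [h8'.1, h8'.2]

/-- The number of terms of a reciprocal is small compared with `1 / u`. -/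
lemma two_pow_clog_mul_uro_le {p t : ℕ} (hp : 8 ≤ p) (htp : t < p) :
    (2 : ℝ) ^ Nat.clog 2 t * uro p ≤ 1 / 32 := by
  have h1 : t ≤ 2 ^ (p - 5) := by
    obtain ⟨k, rfl⟩ := Nat.exists_eq_add_of_le hp
    rw [show 8 + k - 5 = k + 3 by lia, pow_add]
    have := Nat.lt_two_pow_self (n := k)
    lia
  have h2 : Nat.clog 2 t ≤ p - 5 := (Nat.clog_le_iff_le_pow (by lia)).2 h1
  have h3 : (2 : ℝ) ^ Nat.clog 2 t ≤ 2 ^ (p - 5) := pow_le_pow_right₀ (by norm_num) h2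
  have h4 := mul_le_mul_of_nonneg_right h3 (uro_pos p).le
  refine h4.trans (le_of_eq ?_)
  rw [uro, ← zpow_natCast, ← two_zpow_add, show ((p - 5 : ℕ) : ℤ) + -(p : ℤ) = -5 by lia]
  norm_num

/-! ### Renormalization without cancellation -/

/-- The sum of the absolute values of the entries, each capped at `c`. -/
def capSum (c : ℝ) (l : List ℝ) : ℝ := (l.map (fun a => min |a| c)).sum

lemma capSum_cons (c a : ℝ) (l : List ℝ) : capSum c (a :: l) = min |a| c + capSum c l := by
  simp [capSum]

lemma capSum_append (c : ℝ) (l m : List ℝ) : capSum c (l ++ m) = capSum c l + capSum c m := by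
  simp [capSum]

lemma capSum_perm {c : ℝ} {l m : List ℝ} (h : l.Perm m) : capSum c l = capSum c m :=
  (h.map _).sum_eq

/-- At most `k` entries need the cap. -/
lemma capSum_le {c : ℝ} (hc : 0 ≤ c) (k : ℕ) (l : List ℝ) :
    capSum c l ≤ k * c + nrm (l.drop k) := by
  induction l generalizing k with
  | nil => simp [capSum]; positivity
  | cons a l ih =>
    rw [capSum_cons]
    cases k with
    | zero =>
      have := ih 0
      have := min_le_left |a| c
      simp only [List.drop_zero, nrm_cons, Nat.cast_zero, zero_mul, zero_add] at *
      linarith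
    | succ k =>
      have := ih k
      have := min_le_right |a| c
      rw [List.drop_succ_cons]
      push_cast
      linarith

/-- Each error of VecSum is bounded by the corresponding entry and by the rounding error of a partial
sum. -/
lemma vecSum_capSum {p : ℕ} (hp : 8 ≤ p) (l : List ℝ) : ∀ a, (∀ x ∈ a :: l, IsFloat p x) →
    ∃ s es, vecSum p (a :: l) = s :: es ∧ (∀ x ∈ s :: es, IsFloat p x) ∧
      s + es.sum = (a :: l).sum ∧ nrm es ≤ nrm (a :: l) ∧
      ∀ c, uro p * (nrm (a :: l) + nrm es) ≤ c → nrm es ≤ capSum c (a :: l) := by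
  have hu := uro_pos p
  induction l with
  | nil =>
    intro a hf
    refine ⟨a, [], by simp [vecSum], by simpa using hf, by simp, by simp, fun c hc => ?_⟩
    simp only [nrm_cons, nrm_nil, add_zero] at hc
    have : 0 ≤ c := le_trans (by positivity) hc
    simp only [nrm_nil, capSum, List.map_cons, List.map_nil, List.sum_cons, List.sum_nil, add_zero]
    exact le_min (abs_nonneg _) this
  | cons b l ih =>
    intro a hf
    obtain ⟨s, es, h1, h2, h3, h4, h5⟩ := ih b (fun x hx => hf x (List.mem_cons_of_mem _ hx))
    have ha := hf a (by simp)
    have hs := h2 s (by simp)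
    have he := abs_add_sub_rn_le_right (by lia : 1 ≤ p) a hs
    refine ⟨_, _, vecSum_cons_of_eq (by lia) ha hs h1, ?_, ?_, ?_, fun c hc => ?_⟩
    · intro x hx
      rcases List.mem_cons.1 hx with rfl | hx
      · exact isFloat_rn (by lia) _
      rcases List.mem_cons.1 hx with rfl | hx
      · exact isFloat_add_err (by lia) ha hs
      · exact h2 x (List.mem_cons_of_mem _ hx)
    · simp only [List.sum_cons] at *; linarith
    · rw [nrm_cons, nrm_cons a]; linarith
    · rw [nrm_cons a, nrm_cons (a + s - rn p (a + s))] at hc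
      rw [nrm_cons, capSum_cons]
      have hc' : uro p * (nrm (b :: l) + nrm es) ≤ c := by
        refine le_trans (mul_le_mul_of_nonneg_left ?_ hu.le) hc
        linarith [abs_nonneg a, abs_nonneg (a + s - rn p (a + s))]
      have h6 := h5 c hc'
      have h7 := abs_sub_rn_le p (a + s)
      have h8 : |a + s| ≤ |a| + nrm (b :: l) + nrm es := by
        have e1 := abs_sum_le_nrm (b :: l)
        have e2 := abs_sum_le_nrm es
        rw [← h3] at e1
        have e3 := abs_le.1 e1
        have e4 := abs_le.1 e2
        have e5 := abs_le.1 (le_refl |a|)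
        rw [abs_le]
        constructor <;> linarith [e3.1, e3.2, e4.1, e4.2, e5.1, e5.2]
      have h9 := mul_le_mul_of_nonneg_left h8 hu.le
      have h10 : 0 ≤ uro p * |a + s - rn p (a + s)| := by positivity
      exact add_le_add (le_min he (by linarith)) h6

/-- Renormalization of a list with few large entries: `hcap` says that at most `K` entries are large
and that the others have sum at most `B`. -/
lemma renormalize_spec {p : ℕ} (hp : 8 ≤ p) {l : List ℝ} (hl : l ≠ []) (hf : ∀ x ∈ l, IsFloat p x)
    {K B N : ℝ} (hN : nrm l = N) (hK0 : 0 ≤ K) (hK : K ≤ 4) (hB0 : 0 ≤ B) (hB : B ≤ 4 * uro p * N)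
    (hcap : ∀ c, 0 ≤ c → capSum c l ≤ K * c + B) {m : ℕ} (hm : 1 ≤ m) {E : ℝ}
    (hE : E = 1.047 * K * uro p * N + B) :
    let out := renormalize p l (m + 1)
    (∀ x ∈ out, IsFloat p x) ∧ |lead out - l.sum| ≤ E ∧
      |out.sum - l.sum| ≤ E + 0.04 * uro p * N ∧
      nrm (out.drop 1) ≤ 1.008 * (E + 1.07 * uro p * N) ∧
      nrm (out.drop 2) ≤ 1.008 * (E + 0.04 * uro p * N) := by
  intro out
  have hu := uro_pos p
  have hu1 := uro_le p hp
  obtain ⟨a, l', rfl⟩ := List.exists_cons_of_ne_nil hl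
  obtain ⟨s, es, h1, h2, h3, h4, h5⟩ := vecSum_capSum hp l' a hf
  rw [hN] at h4 h5
  have hN0 : 0 ≤ N := hN ▸ nrm_nonneg _
  have huN : 0 ≤ uro p * N := by positivity
  have he0 := nrm_nonneg es
  have huu := mul_le_mul_of_nonneg_right hu1 huN
  have hKu := mul_le_mul_of_nonneg_right hK huN
  have hKN : 0 ≤ K * (uro p * N) := by positivity
  have hKuu := mul_le_mul_of_nonneg_left huu hK0
  have g1 : nrm es ≤ 12 * (uro p * N) := by
    have e1 := (h5 (uro p * (N + N)) (mul_le_mul_of_nonneg_left (by linarith) hu.le)).trans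
      (hcap _ (by positivity))
    linarith
  have g2 : nrm es ≤ E := by
    have e1 := (h5 _ le_rfl).trans (hcap _ (by positivity))
    have e2 := mul_le_mul_of_nonneg_left g1 hu.le
    have e3 := mul_le_mul_of_nonneg_left e2 hK0
    rw [hE]
    linarith
  have hE8 : E ≤ 8.2 * (uro p * N) := by rw [hE]; linarith
  have hE0 : 0 ≤ E := he0.trans g2
  have hEu := mul_le_mul_of_nonneg_left hE8 hu.le
  set b : ℕ → ℝ := fun k => if k ≤ 1 then E + 1.07 * uro p * N else E + 0.04 * uro p * N with hb
  obtain ⟨f1, f2, -, f4, f5⟩ := vecSumErrBranch_bounds hp m es s (h2 s (by simp))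
    (fun x hx => h2 x (List.mem_cons_of_mem _ hx)) (fun k => nrm (es.drop k)) b (fun k => le_rfl)
    (by
      have eb : b 1 = E + 1.07 * uro p * N := rfl
      have e1 := nrm_drop_le 1 es
      have e2 : |s + es.headD 0| ≤ N + E := by
        have e3 := abs_sum_le_nrm (a :: l')
        rw [← h3, hN] at e3
        cases es with
        | nil => simp only [List.headD_nil, add_zero, List.sum_nil] at *; linarith
        | cons e es =>
          have e4 := abs_sum_le_nrm es
          rw [nrm_cons] at g2
          simp only [List.headD_cons, List.sum_cons] at *
          have e5 := abs_le.1 e3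
          have e6 := abs_le.1 e4
          rw [abs_le]
          constructor <;> linarith [abs_nonneg e, e5.1, e5.2, e6.1, e6.2]
      have e3 := mul_le_mul_of_nonneg_left e2 hu.le
      have e4 := mul_le_mul_of_nonneg_left (e1.trans g2) hu.le
      rw [eb]
      linarith)
    (by
      intro k hk
      have e1 := nrm_drop_le (k + 1) es
      have e2 : b (k + 1) = E + 0.04 * uro p * N := by simp only [hb]; rw [if_neg (by lia)]
      have e3 : b k ≤ E + 1.07 * uro p * N := by
        simp only [hb]; split_ifs <;> linarith
      have e4 := mul_le_mul_of_nonneg_left e3 hu.le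
      rw [e2]
      linarith)
  have ho : out = vecSumErrBranch p (s :: es) (m + 1) := by
    change renormalize p _ _ = _
    rw [renormalize, h1]
  rw [h3] at f4 f5
  rw [← ho] at f1 f2 f4 f5
  have e2 : b (m + 1) = E + 0.04 * uro p * N := by simp only [hb]; rw [if_neg (by lia)]
  rw [e2] at f5
  have hA := fun (x : ℝ) (hx : 0 ≤ x) => mul_le_mul_of_nonneg_right (amp_le hp) hx
  refine ⟨f1, ?_, ?_, ?_, ?_⟩
  · rw [abs_sub_comm]; exact f4.trans g2
  · rw [abs_sub_comm]; exact f5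
  · exact (f2 1 le_rfl).trans (hA _ (by simp only [hb]; positivity))
  · exact (f2 2 (by lia)).trans (hA _ (by simp only [hb]; positivity))

/-! ### Expansions and their merges -/

lemma merge_perm (x y : List ℝ) : (merge x y).Perm (x ++ y) := List.perm_insertionSort _ _

/-- The terms of an ulp-nonoverlapping expansion decrease geometrically. -/
lemma nrm_drop_chain {p : ℕ} (hp : 8 ≤ p) (l : List ℝ) : ∀ a,
    (a :: l).IsChain (fun a a' => |a'| ≤ ulp p a) → ∀ k,
    nrm (l.drop k) ≤ (2.02 * uro p) ^ (k + 1) * |a| := by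
  have hu := uro_pos p
  have hu1 := uro_le p hp
  induction l with
  | nil => intro a _ k; simp; positivity
  | cons b l ih =>
    intro a hc k
    have hab : |b| ≤ 2 * uro p * |a| := by
      rw [List.isChain_cons_cons] at hc
      exact hc.1.trans (ulp_le p a)
    have h0 := mul_nonneg hu.le (abs_nonneg a)
    cases k with
    | zero =>
      have e1 := ih b hc.tail 0
      have e2 := mul_le_mul_of_nonneg_left hab hu.le
      have e3 := mul_le_mul_of_nonneg_right hu1 h0
      simp only [List.drop_zero, nrm_cons, zero_add, pow_one] at *
      linarith
    | succ k =>
      have e1 := ih b hc.tail k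
      have e2 := mul_le_mul_of_nonneg_left hab (show 0 ≤ (2.02 * uro p) ^ (k + 1) by positivity)
      have e3 : 0 ≤ (2.02 * uro p) ^ (k + 1) * (uro p * |a|) := by positivity
      rw [List.drop_succ_cons, pow_succ _ (k + 1)]
      linarith

/-- The shape of an ulp-nonoverlapping expansion with positive value. -/
lemma IsFPE.shape {p t : ℕ} (hp : 8 ≤ p) {f : List ℝ} (hf : IsFPE p t f) (h0 : 0 < f.sum) :
    Shape p f 2.1 0.02 0.0002 0.00001 := by
  have hu := uro_pos p
  have hu1 := uro_le p hp
  cases f with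
  | nil => simp at h0
  | cons a l =>
    have h := nrm_drop_chain hp l a hf.nonoverlapping
    have h1 := h 0
    have h2 := h 1
    have h3 := h 2
    have h4 := h 3
    have hua := mul_nonneg hu.le (abs_nonneg a)
    have huu := mul_le_mul_of_nonneg_right hu1 (abs_nonneg a)
    simp only [List.drop_zero, zero_add, pow_one] at h1
    have ha : 0 < a := by
      have e := (abs_le.1 (abs_sum_le_nrm l)).2
      rw [List.sum_cons] at h0
      by_contra hneg
      rw [abs_of_nonpos (not_lt.1 hneg)] at h1 huu
      linarith
    rw [abs_of_pos ha] at h1 h2 h3 h4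
    have hua' : 0 < uro p * a := by positivity
    have q2 := mul_le_mul_of_nonneg_left hu1 hua'.le
    have q3 := mul_le_mul_of_nonneg_left q2 hu.le
    have q4 := mul_le_mul_of_nonneg_left q3 hu.le
    refine ⟨hf.isFloat, ha, ?_, ?_, ?_, ?_⟩ <;> simp only [lead_cons, List.drop_succ_cons]
    · simp only [List.drop_zero]; linarith
    · norm_num at h2 ⊢; linarith
    · norm_num at h3 ⊢; linarith
    · norm_num at h4 ⊢; linarith

lemma IsFPE.neg {p t : ℕ} {f : List ℝ} (hf : IsFPE p t f) : IsFPE p t (neg f) := by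
  refine ⟨by simp [FPE.neg, hf.length_eq], fun a ha => ?_, isChain_neg hf.nonoverlapping⟩
  obtain ⟨b, hb, rfl⟩ := List.mem_map.1 ha
  exact (hf.isFloat b hb).neg

lemma sum_neg (l : List ℝ) : (neg l).sum = -l.sum := sum_map_neg l

lemma pairwise_of_chain {p : ℕ} (hp : 8 ≤ p) {l : List ℝ}
    (h : l.IsChain (fun a a' => |a'| ≤ ulp p a)) : l.Pairwise (fun a a' => |a'| ≤ |a|) := by
  have : IsTrans ℝ (fun a a' => |a'| ≤ |a|) := ⟨fun a b c h1 h2 => le_trans h2 h1⟩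
  refine List.isChain_iff_pairwise.1 (h.imp fun a b hab => hab.trans ((ulp_le p a).trans ?_))
  have := mul_le_mul_of_nonneg_right (uro_le p hp) (abs_nonneg a)
  linarith [abs_nonneg a]

/-- Merging `1` into an ulp-nonoverlapping expansion. -/
lemma merge_one {p : ℕ} (hp : 8 ≤ p) {a : ℝ} {l : List ℝ}
    (h : (a :: l).IsChain (fun a a' => |a'| ≤ ulp p a)) (hl : ∀ b ∈ l, |b| ≤ 1) :
    merge [1] (a :: l) = if |a| ≤ 1 then 1 :: a :: l else a :: 1 :: l := by
  have h1 := pairwise_of_chain hp h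
  have h2 : (a :: l).insertionSort (fun a a' => |a'| ≤ |a|) = a :: l :=
    List.Pairwise.insertionSort_eq h1
  rw [merge, List.singleton_append, List.insertionSort_cons, h2]
  simp only [List.orderedInsert, abs_one]
  split_ifs with h3
  · rfl
  · cases l with
    | nil => rfl
    | cons b l =>
      have := hl b (by simp)
      simp [List.orderedInsert, this]

/-- The difference of `1` and an expansion with value in `(0, 1)`. -/
lemma one_sub_spec {p t : ℕ} (hp : 8 ≤ p) (ht : 2 ≤ t) {f : List ℝ} (hf : IsFPE p t f)
    (h0 : 0 < f.sum) (h1 : f.sum < 1) :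
    Shape p (add p [1] (neg f) t) 5.5 0.1 0.01 0.001 ∧
      |(add p [1] (neg f) t).sum - (1 - f.sum)| ≤ 0.1 * uro p * (1 - f.sum) := by
  have hu := uro_pos p
  have hu1 := uro_le p hp
  have hs := hf.shape hp h0
  have hlow := hs.lead_le_sum hp (by norm_num)
  obtain ⟨m, rfl⟩ := Nat.exists_eq_add_of_le' (show 1 ≤ t by lia)
  have hn := hf.neg
  have hsum := sum_neg f
  have hone : IsFloat p 1 := by simpa using isFloat_two_zpow (p := p) (by lia) 0
  have hexp1 : expo (1 : ℝ) = 0 := by simpa using expo_two_zpow 0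
  have htl := hs.tail₁
  cases f with
  | nil => simp at h0
  | cons a l =>
    have ha := hs.pos
    rw [lead_cons] at hlow ha htl
    simp only [List.drop_succ_cons, List.drop_zero] at htl
    have ha1 : a ≤ 1.01 := by linarith
    have hnl : neg (a :: l) = -a :: neg l := rfl
    rw [hnl] at hn hsum ⊢
    have hna : |-a| = a := by rw [abs_neg, abs_of_pos ha]
    have hl1 : ∀ b ∈ neg l, |b| ≤ 1 := by
      intro b hb
      have e1 : |b| ≤ nrm (neg l) := List.single_le_sum (by simp) _ (List.mem_map_of_mem hb)
      rw [neg, nrm_map_neg] at e1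
      have := mul_le_mul_of_nonneg_right hu1 ha.le
      linarith
    have hT : 1 - (a :: l).sum = (1 :: -a :: neg l).sum := by
      simp only [List.sum_cons] at hsum ⊢; linarith
    rw [add, merge_one hp hn.nonoverlapping hl1, hT]
    have hpos : 0 < (1 :: -a :: neg l).sum := by rw [← hT]; linarith
    split_ifs with h3
    · refine renormalize_cons_chain hp (by lia) ?_ hn.nonoverlapping one_ne_zero ?_ hpos
      · intro x hx
        rcases List.mem_cons.1 hx with rfl | hx
        exacts [hone, hn.isFloat x hx]
      · rw [hna, hexp1]; norm_num; linarith
    · rw [hna] at h3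
      have hexp : expo (-a) = 0 := by
        rw [expo_neg]
        refine le_antisymm ?_ (le_expo (by rw [abs_of_pos ha]; norm_num; linarith))
        have := expo_lt (k := 1) ha.ne' (by rw [abs_of_pos ha]; norm_num; linarith)
        lia
      have hswap : (1 :: -a :: neg l).sum = (-a :: 1 :: neg l).sum := by
        simp only [List.sum_cons]; ring
      rw [hswap] at hpos ⊢
      refine renormalize_cons_chain hp (by lia) ?_ ?_ (by linarith) ?_ hpos
      · intro x hx
        rcases List.mem_cons.1 hx with rfl | hx
        · exact hn.isFloat _ (by simp)
        rcases List.mem_cons.1 hx with rfl | hx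
        exacts [hone, hn.isFloat x (List.mem_cons_of_mem _ hx)]
      · have hc := hn.nonoverlapping
        have hulp : ulp p (-a) = ulp p 1 := by
          rw [ulp, ulp, if_neg (by linarith), if_neg one_ne_zero, hexp, hexp1]
        cases hnl : neg l with
        | nil => simp
        | cons b l' =>
          rw [hnl, List.isChain_cons_cons] at hc
          rw [List.isChain_cons_cons, ← hulp]
          exact hc
      · rw [hexp, abs_one]; norm_num

lemma nrm_double (l : List ℝ) : nrm (double l) = 2 * nrm l := by
  induction l with
  | nil => simp [double]
  | cons a l ih =>
    rw [double] at *
    rw [List.map_cons, nrm_cons, nrm_cons, ih, abs_mul, abs_two]; ring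

lemma sum_double (l : List ℝ) : (double l).sum = 2 * l.sum := by
  simpa [double] using List.sum_map_mul_left l id (2 : ℝ)

lemma lead_double (l : List ℝ) : lead (double l) = 2 * lead l := by
  cases l <;> simp [double, lead]

lemma drop_double (l : List ℝ) (k : ℕ) : (double l).drop k = double (l.drop k) := by
  simp [double, List.map_drop]

lemma Shape.double {p : ℕ} {x : List ℝ} {a₁ a₂ a₃ a₄ : ℝ} (h : Shape p x a₁ a₂ a₃ a₄) :
    Shape p (double x) a₁ a₂ a₃ a₄ := by
  have h0 := h.pos
  have h1 := h.tail₁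
  have h2 := h.tail₂
  have h3 := h.tail₃
  have h4 := h.tail₄
  refine ⟨fun a ha => ?_, by rw [lead_double]; linarith, ?_, ?_, ?_, ?_⟩
  · obtain ⟨b, hb, rfl⟩ := List.mem_map.1 ha
    exact (h.isFloat b hb).two_mul
  all_goals rw [drop_double, nrm_double, lead_double]; linarith

/-! ### The expansion under the logarithm -/

lemma length_add (p : ℕ) (x y : List ℝ) (r : ℕ) : (add p x y r).length = r :=
  length_vecSumErrBranch _ _ _

lemma isFloat_lead {p : ℕ} {x : List ℝ} (h : ∀ a ∈ x, IsFloat p a) : IsFloat p (lead x) := by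
  cases x with
  | nil => exact isFloat_zero p
  | cons a l => exact h a (by simp)

/-- The reciprocal of `1 - f`. -/
lemma reciprocal_one_sub_spec {p t β : ℕ} (hp : 8 ≤ p) (hβ : β + 2 ≤ p) (hβ2 : p + 4 ≤ 2 * β)
    (ht : 2 ≤ t) (htp : t < p) {f : List ℝ} (hf : IsFPE p t f) (h0 : 0 < f.sum) (h1 : f.sum < 1) :
    let R := reciprocal p β (add p [1] (neg f) t) (Nat.clog 2 (add p [1] (neg f) t).length)
    Shape p R 5.3 0.6 0.13 0.035 ∧ |R.sum * (1 - f.sum) - 1| ≤ 6.02 * uro p ∧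
      ((t + R.length + 5 : ℕ) : ℝ) * uro p ≤ 21 / 256 := by
  have hu := uro_pos p
  have hu1 := uro_le p hp
  obtain ⟨d1, d2⟩ := one_sub_spec hp ht hf h0 h1
  rw [length_add]
  intro R
  have hpow := two_pow_clog_mul_uro_le hp htp
  have htq : t ≤ 2 ^ Nat.clog 2 t := Nat.le_pow_clog (by lia) t
  obtain ⟨r1, r2, r3⟩ := reciprocal_spec hp hβ hβ2 d1 (Nat.clog_pos (by lia) ht)
    (by rw [length_add]; exact htq) hpow
  change Shape p R _ _ _ _ at r1
  change |R.sum * _ - 1| ≤ _ at r2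
  change R.length ≤ _ at r3
  set d := add p [1] (neg f) t
  refine ⟨r1, ?_, ?_⟩
  · set δ := 1 - f.sum with hδ
    have hδ0 : 0 < δ := by rw [hδ]; linarith
    have hR0 : 0 < R.sum := by
      have e1 := r1.lead_le_sum hp (by norm_num)
      have e2 := r1.pos
      linarith
    have hud := mul_le_mul_of_nonneg_right hu1 hδ0.le
    have d2' := abs_le.1 d2
    have r2' := abs_le.1 r2
    have hRδ : R.sum * δ ≤ 1.03 := by
      have e1 := mul_le_mul_of_nonneg_left (show 0.999 * δ ≤ d.sum by linarith [d2'.1]) hR0.le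
      linarith
    have h3 : |R.sum * (d.sum - δ)| ≤ 0.11 * uro p := by
      rw [abs_mul, abs_of_pos hR0]
      have e1 := mul_le_mul_of_nonneg_left d2 hR0.le
      have e2 := mul_le_mul_of_nonneg_left hRδ hu.le
      linarith
    have h3' := abs_le.1 h3
    rw [abs_le]
    constructor <;> linarith [h3'.1, h3'.2, r2'.1, r2'.2]
  · have e1 : ((t + R.length + 5 : ℕ) : ℝ) ≤ 2 * 2 ^ Nat.clog 2 t + 5 := by
      exact_mod_cast (show t + R.length + 5 ≤ 2 * 2 ^ Nat.clog 2 t + 5 by lia)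
    have := mul_le_mul_of_nonneg_right e1 hu.le
    linarith

lemma min_length_le {a b n p : ℕ} {c : ℝ} (h : ((a + b + 5 : ℕ) : ℝ) * uro p ≤ c) :
    ((min a n + min b n + 5 : ℕ) : ℝ) * uro p ≤ c := by
  refine le_trans (mul_le_mul_of_nonneg_right ?_ (uro_pos p).le) h
  have := min_le_left a n
  have := min_le_left b n
  exact_mod_cast (by lia)

lemma length_double (l : List ℝ) : (double l).length = l.length := by simp [double]

/-- The quotient `2 f / (1 - f)`. -/
lemma div_double_spec {p t β : ℕ} (hp : 8 ≤ p) (hβ : β + 2 ≤ p) (hβ2 : p + 4 ≤ 2 * β)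
    (ht : 2 ≤ t) (htp : t < p) {f : List ℝ} (hf : IsFPE p t f) (h0 : 0 < f.sum) (h1 : f.sum < 1) :
    let D := div p β (double f) (add p [1] (neg f) t) t
    let Q := 2 * f.sum / (1 - f.sum)
    Shape p D 5 0.6 0.08 0.013 ∧ |D.sum - Q| ≤ 9.05 * uro p * Q := by
  intro D Q
  have hu := uro_pos p
  have hu1 := uro_le p hp
  obtain ⟨r1, r2, r3⟩ := reciprocal_one_sub_spec hp hβ hβ2 ht htp hf h0 h1
  have hD : D = mul p β (double f) (reciprocal p β (add p [1] (neg f) t)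
      (Nat.clog 2 (add p [1] (neg f) t).length)) t := rfl
  set R := reciprocal p β (add p [1] (neg f) t) (Nat.clog 2 (add p [1] (neg f) t).length)
  have hf2 := (hf.shape hp h0).double
  obtain ⟨q1, -, q3, -⟩ := mul_spec hp hβ hβ2 MulParams.quotient_valid hf2 r1 (r := t) ht
    (min_length_le (by rw [length_double, hf.length_eq]; exact r3)) MulParams.quotient_out.1
  rw [← hD] at q1 q3
  refine ⟨q1, ?_⟩
  have g1 := hf2.lead_le_sum hp (by norm_num)
  have g2 := r1.lead_le_sum hp (by norm_num)
  have p1 := hf2.pos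
  have p2 := r1.pos
  rw [sum_double] at q3 g1
  set δ := 1 - f.sum with hδ
  have hδ0 : 0 < δ := by rw [hδ]; linarith
  have hQ0 : 0 < Q := by positivity
  have hQ : Q * δ = 2 * f.sum := div_mul_cancel₀ _ hδ0.ne'
  have e1 : lead (double f) * lead R ≤ 1.0297 * (2 * f.sum * R.sum) := by
    have := mul_le_mul g1 g2 (by positivity) (by linarith)
    have e0 : 0 < lead (double f) * lead R := by positivity
    linarith
  have e2 : |2 * f.sum * R.sum - Q| ≤ 6.02 * uro p * Q := by
    have e : 2 * f.sum * R.sum - Q = Q * (R.sum * δ - 1) := by rw [← hQ]; ring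
    rw [e, abs_mul, abs_of_pos hQ0]
    have := mul_le_mul_of_nonneg_left r2 hQ0.le
    linarith
  have e2' := abs_le.1 e2
  have huQ := mul_le_mul_of_nonneg_right hu1 hQ0.le
  have e3 : lead (double f) * lead R ≤ 1.055 * Q := by linarith
  have e4 := mul_le_mul_of_nonneg_right MulParams.quotient_out.2
    (show 0 ≤ uro p * (lead (double f) * lead R) by positivity)
  have e5 := mul_le_mul_of_nonneg_left e3 hu.le
  have huQ' := mul_pos hu hQ0
  have q3' := abs_le.1 q3
  rw [abs_le]
  constructor <;> linarith [q3'.1, q3'.2]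

set_option maxHeartbeats 1000000 in
/-- The quotient `(2 f * f) / (1 - f)`. -/
lemma div_square_spec {p t β : ℕ} (hp : 8 ≤ p) (hβ : β + 2 ≤ p) (hβ2 : p + 4 ≤ 2 * β)
    (ht : 2 ≤ t) (htp : t < p) {f : List ℝ} (hf : IsFPE p t f) (h0 : 0 < f.sum) (h1 : f.sum < 1) :
    let G := div p β (mul p β (double f) f t) (add p [1] (neg f) t) t
    let Q := 2 * f.sum ^ 2 / (1 - f.sum)
    Shape p G 5.5 0.7 0.1 0.02 ∧ |G.sum - Q| ≤ 11.6 * uro p * Q := by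
  intro G Q
  have hu := uro_pos p
  have hu1 := uro_le p hp
  obtain ⟨r1, r2, r3⟩ := reciprocal_one_sub_spec hp hβ hβ2 ht htp hf h0 h1
  have hG : G = mul p β (mul p β (double f) f t) (reciprocal p β (add p [1] (neg f) t)
      (Nat.clog 2 (add p [1] (neg f) t).length)) t := rfl
  set R := reciprocal p β (add p [1] (neg f) t) (Nat.clog 2 (add p [1] (neg f) t).length)
  have hf1 := hf.shape hp h0
  have hf2 := hf1.double
  have hpow : ((t + t + 5 : ℕ) : ℝ) * uro p ≤ 21 / 256 := by
    have h1 := two_pow_clog_mul_uro_le hp htp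
    have htq : t ≤ 2 ^ Nat.clog 2 t := Nat.le_pow_clog (by lia) t
    have e1 : ((t + t + 5 : ℕ) : ℝ) ≤ 2 * 2 ^ Nat.clog 2 t + 5 := by
      exact_mod_cast (show t + t + 5 ≤ 2 * 2 ^ Nat.clog 2 t + 5 by lia)
    have := mul_le_mul_of_nonneg_right e1 hu.le
    linarith
  obtain ⟨s1, -, s3, -⟩ := mul_spec hp hβ hβ2 MulParams.square_valid hf2 hf1 (r := t) ht
    (min_length_le (by rw [length_double, hf.length_eq]; exact hpow)) MulParams.square_out.1
  have hSl : (mul p β (double f) f t).length = t := length_mul _ _ _ _ _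
  set S := mul p β (double f) f t
  obtain ⟨q1, -, q3, -⟩ := mul_spec hp hβ hβ2 MulParams.squareQuotient_valid s1 r1 (r := t) ht
    (min_length_le (by rw [hSl]; exact r3)) MulParams.squareQuotient_out.1
  rw [← hG] at q1 q3
  refine ⟨q1, ?_⟩
  have g1 := hf1.lead_le_sum hp (by norm_num)
  have g2 := r1.lead_le_sum hp (by norm_num)
  have g3 := s1.lead_le_sum hp (by norm_num)
  have p1 := hf1.pos
  have p2 := r1.pos
  have p3 := s1.pos
  rw [sum_double, lead_double] at s3
  set δ := 1 - f.sum with hδ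
  have hδ0 : 0 < δ := by rw [hδ]; linarith
  have hR0 : 0 < R.sum := by linarith
  have hQ0 : 0 < Q := by positivity
  have hQ : Q * δ = 2 * f.sum ^ 2 := div_mul_cancel₀ _ hδ0.ne'
  have huQ := mul_le_mul_of_nonneg_right hu1 hQ0.le
  have huQ' := mul_pos hu hQ0
  -- The square.
  have e1 : lead f * lead f ≤ 1.0167 * f.sum ^ 2 := by
    have := mul_le_mul g1 g1 (by positivity) h0.le
    have e0 : 0 < lead f * lead f := by positivity
    linarith
  have e2 : |S.sum - 2 * f.sum ^ 2| ≤ 2.1 * uro p * (2 * f.sum ^ 2) := by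
    have a1 := mul_le_mul_of_nonneg_right MulParams.square_out.2
      (show 0 ≤ uro p * (2 * lead f * lead f) by positivity)
    have a2 := mul_le_mul_of_nonneg_left e1 hu.le
    have a3 : 0 ≤ uro p * f.sum ^ 2 := by positivity
    have a4 : 2 * f.sum * f.sum = 2 * f.sum ^ 2 := by ring
    rw [a4] at s3
    linarith
  -- The product with the exact quotient.
  have e3 : |2 * f.sum ^ 2 * R.sum - Q| ≤ 6.02 * uro p * Q := by
    have e : 2 * f.sum ^ 2 * R.sum - Q = Q * (R.sum * δ - 1) := by rw [← hQ]; ring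
    rw [e, abs_mul, abs_of_pos hQ0]
    have := mul_le_mul_of_nonneg_left r2 hQ0.le
    linarith
  have e3' := abs_le.1 e3
  have e4 : |S.sum * R.sum - Q| ≤ 8.2 * uro p * Q := by
    have a1 : |(S.sum - 2 * f.sum ^ 2) * R.sum| ≤ 2.16 * uro p * Q := by
      rw [abs_mul, abs_of_pos hR0]
      have b1 := mul_le_mul_of_nonneg_right e2 hR0.le
      have b2 := mul_le_mul_of_nonneg_left
        (show 2 * f.sum ^ 2 * R.sum ≤ 1.0236 * Q by linarith) hu.le
      linarith
    have a1' := abs_le.1 a1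
    rw [abs_le]
    constructor <;> linarith
  have e4' := abs_le.1 e4
  have e5 : lead S * lead R ≤ 1.075 * Q := by
    have := mul_le_mul g3 g2 (by positivity) (by linarith)
    have e0 : 0 < lead S * lead R := by positivity
    linarith
  have e6 := mul_le_mul_of_nonneg_right MulParams.squareQuotient_out.2
    (show 0 ≤ uro p * (lead S * lead R) by positivity)
  have e7 := mul_le_mul_of_nonneg_left e5 hu.le
  have q3' := abs_le.1 q3
  rw [abs_le]
  constructor <;> linarith [q3'.1, q3'.2]

lemma merge_ne_nil {x y : List ℝ} (h : x ≠ []) : merge x y ≠ [] := by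
  intro h0
  have := (merge_perm x y).length_eq
  rw [h0] at this
  have := List.length_pos_iff.2 h
  simp only [List.length_nil, List.length_append] at *
  lia

lemma isFloat_merge {p : ℕ} {x y : List ℝ} (hx : ∀ a ∈ x, IsFloat p a)
    (hy : ∀ a ∈ y, IsFloat p a) : ∀ a ∈ merge x y, IsFloat p a := fun a ha => by
  rcases List.mem_append.1 ((merge_perm x y).mem_iff.1 ha) with h | h
  exacts [hx a h, hy a h]

lemma nrm_merge (x y : List ℝ) : nrm (merge x y) = nrm x + nrm y := by
  rw [nrm_perm (merge_perm x y), nrm_append]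

lemma sum_merge (x y : List ℝ) : (merge x y).sum = x.sum + y.sum := by
  rw [(merge_perm x y).sum_eq, List.sum_append]

lemma capSum_merge (c : ℝ) (x y : List ℝ) : capSum c (merge x y) = capSum c x + capSum c y := by
  rw [capSum_perm (merge_perm x y), capSum_append]

lemma isFloat_one {p : ℕ} (hp : 1 ≤ p) : IsFloat p 1 := by
  simpa using isFloat_two_zpow hp 0

/-- The leading term of `1 + 2 f / (1 - f)`. -/
lemma lead_one_add_div_spec {p t β : ℕ} (hp : 8 ≤ p) (hβ : β + 2 ≤ p) (hβ2 : p + 4 ≤ 2 * β)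
    (ht : 2 ≤ t) (htp : t < p) {f : List ℝ} (hf : IsFPE p t f) (h0 : 0 < f.sum) (h1 : f.sum < 1) :
    let z := lead (add p [1] (div p β (double f) (add p [1] (neg f) t) t) t)
    let y := (1 + f.sum) / (1 - f.sum)
    IsFloat p z ∧ |z - y| ≤ 15 * uro p * y := by
  intro z y
  have hu := uro_pos p
  have hu1 := uro_le p hp
  obtain ⟨D1, D2⟩ := div_double_spec hp hβ hβ2 ht htp hf h0 h1
  have hz : z = lead (renormalize p (merge [1] (div p β (double f) (add p [1] (neg f) t) t))
    ((t - 1) + 1)) := by rw [Nat.sub_add_cancel (by lia)]; rfl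
  set D := div p β (double f) (add p [1] (neg f) t) t
  set Q := 2 * f.sum / (1 - f.sum) with hQ
  have hδ0 : 0 < 1 - f.sum := by linarith
  have hQ0 : 0 < Q := by positivity
  have hy : y = 1 + Q := by simp only [y, hQ]; field_simp; ring
  have D0 := D1.pos
  have Dl := D1.lead_le_sum hp (by norm_num)
  have Dn := D1.nrm_eq
  have Dt := D1.tail₁
  have D2' := abs_le.1 D2
  have huQ := mul_le_mul_of_nonneg_right hu1 hQ0.le
  have huQ' := mul_pos hu hQ0
  have hDQ : lead D ≤ 1.057 * Q := by linarith
  have huD := mul_le_mul_of_nonneg_right hu1 D0.le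
  have huD' := mul_pos hu D0
  have hN : nrm (merge [1] D) = 1 + nrm D := by rw [nrm_merge]; simp
  have hDN : lead D ≤ nrm D := by rw [Dn]; linarith [nrm_nonneg (D.drop 1)]
  obtain ⟨f1, f2, -⟩ := renormalize_spec hp (merge_ne_nil (x := [1]) (y := D) (by simp))
    (isFloat_merge (by simpa using isFloat_one (by lia)) D1.isFloat) (K := 3)
    (B := 0.6 * uro p * lead D) hN (by norm_num) (by norm_num) (by positivity)
    (by
      have := mul_le_mul_of_nonneg_left hDN hu.le
      linarith)
    (fun c hc => by
      have e1 := capSum_le hc 1 [1]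
      have e2 := capSum_le hc 2 D
      have e3 := D1.tail₂
      rw [capSum_merge]
      simp only [List.drop_succ_cons, List.drop_nil, nrm_nil] at e1
      push_cast at e1 e2
      linarith)
    (m := t - 1) (by lia) rfl
  rw [sum_merge, List.sum_singleton] at f2
  rw [← hz] at f2
  refine ⟨by rw [hz]; exact isFloat_lead f1, ?_⟩
  have hDn : uro p * nrm D ≤ 1.08 * (uro p * Q) := by
    have := mul_le_mul_of_nonneg_left (show nrm D ≤ 1.08 * Q by linarith) hu.le
    linarith
  have huDQ := mul_le_mul_of_nonneg_left hDQ hu.le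
  have f2' := abs_le.1 f2
  rw [hy, abs_le]
  constructor <;> linarith [f2'.1, f2'.2]

/-- The leading term of `1 + 2 f + (2 f * f) / (1 - f)`. -/
lemma lead_one_add_add_div_spec {p t β : ℕ} (hp : 8 ≤ p) (hβ : β + 2 ≤ p) (hβ2 : p + 4 ≤ 2 * β)
    (ht : 2 ≤ t) (htp : t < p) {f : List ℝ} (hf : IsFPE p t f) (h0 : 0 < f.sum)
    (h1 : f.sum ≤ 1 / 2) :
    let z := lead (add p (add p [1] (double f) t)
      (div p β (mul p β (double f) f t) (add p [1] (neg f) t) t) t)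
    let y := (1 + f.sum) / (1 - f.sum)
    IsFloat p z ∧ |z - y| ≤ 15 * uro p * y := by
  intro z y
  have hu := uro_pos p
  have hu1 := uro_le p hp
  obtain ⟨G1, G2⟩ := div_square_spec hp hβ hβ2 ht htp hf h0 (by linarith)
  have hz : z = lead (renormalize p (merge (add p [1] (double f) t)
    (div p β (mul p β (double f) f t) (add p [1] (neg f) t) t)) ((t - 1) + 1)) := by
    rw [Nat.sub_add_cancel (by lia)]; rfl
  have hA : add p [1] (double f) t = renormalize p (merge [1] (double f)) ((t - 1) + 1) := by
    rw [Nat.sub_add_cancel (by lia)]; rfl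
  set G := div p β (mul p β (double f) f t) (add p [1] (neg f) t) t
  set Q := 2 * f.sum ^ 2 / (1 - f.sum) with hQ
  have hδ0 : 0 < 1 - f.sum := by linarith
  have hQ0 : 0 < Q := by positivity
  have hy : y = 1 + 2 * f.sum + Q := by simp only [y, hQ]; field_simp; ring
  have hQf : Q ≤ 1 / 2 * (1 + 2 * f.sum) := by
    rw [hQ, div_le_iff₀ hδ0]
    nlinarith
  -- The sum `1 + 2 f`.
  have F1 := (hf.shape hp h0).double
  have F0 := F1.pos
  have Fl := F1.lead_le_sum hp (by norm_num)
  have Fn := F1.nrm_eq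
  have Ft := F1.tail₁
  rw [sum_double] at Fl
  have huF := mul_le_mul_of_nonneg_right hu1 F0.le
  have huF' := mul_pos hu F0
  have hN : nrm (merge [1] (double f)) = 1 + nrm (double f) := by rw [nrm_merge]; simp
  have hFN : lead (double f) ≤ nrm (double f) := by
    rw [Fn]; linarith [nrm_nonneg ((double f).drop 1)]
  set N := 1 + nrm (double f) with hNd
  set EA := 1.047 * 2 * uro p * N + 2.1 * uro p * lead (double f) with hEA
  obtain ⟨a1, a2, a3, a4, a5⟩ := renormalize_spec hp
    (merge_ne_nil (x := [1]) (y := double f) (by simp))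
    (isFloat_merge (by simpa using isFloat_one (by lia)) F1.isFloat) (K := 2)
    (B := 2.1 * uro p * lead (double f)) hN (by norm_num) (by norm_num) (by positivity)
    (by
      have := mul_le_mul_of_nonneg_left hFN hu.le
      linarith)
    (fun c hc => by
      have e1 := capSum_le hc 1 [1]
      have e2 := capSum_le hc 1 (double f)
      rw [capSum_merge]
      simp only [List.drop_succ_cons, List.drop_nil, nrm_nil] at e1
      push_cast at e1 e2
      linarith)
    (m := t - 1) (by lia) hEA
  rw [← hA, sum_merge, List.sum_singleton, sum_double] at a2 a3
  rw [← hA] at a1 a4 a5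
  set A := add p [1] (double f) t
  set s := 1 + 2 * f.sum with hs
  have hs1 : 1 ≤ s := by rw [hs]; linarith
  have hsF : lead (double f) ≤ 0.5042 * s := by linarith
  have hsN : N ≤ 1.0085 * s := by linarith
  have hus : 0 < uro p * s := by positivity
  have hus1 := mul_le_mul_of_nonneg_right hu1 (show 0 ≤ s by linarith)
  have husF := mul_le_mul_of_nonneg_left hsF hu.le
  have husN := mul_le_mul_of_nonneg_left hsN hu.le
  have hEs : EA ≤ 3.172 * (uro p * s) := by rw [hEA]; linarith
  have a2' := abs_le.1 a2
  have a3' := abs_le.1 a3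
  have hlA : 0.987 * s ≤ lead A := by linarith [a2'.1]
  have hA0 : A ≠ [] := by
    intro h
    rw [h] at hlA
    simp only [lead, List.headD_nil] at hlA
    linarith
  have hnA := nrm_eq_of_lead_pos (show 0 < lead A by linarith)
  -- The final sum.
  have G0 := G1.pos
  have Gl := G1.lead_le_sum hp (by norm_num)
  have Gn := G1.nrm_eq
  have Gt := G1.tail₁
  have Gt2 := G1.tail₂
  have G2' := abs_le.1 G2
  have huQ := mul_le_mul_of_nonneg_right hu1 hQ0.le
  have huQ' := mul_pos hu hQ0
  have huG := mul_le_mul_of_nonneg_right hu1 G0.le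
  have huG' := mul_pos hu G0
  have hGQ : lead G ≤ 1.07 * Q := by linarith
  have hN' : nrm (merge A G) = nrm A + nrm G := nrm_merge A G
  have hGN : lead G ≤ nrm G := by rw [Gn]; linarith [nrm_nonneg (G.drop 1)]
  have hAN : lead A ≤ nrm A := by rw [hnA]; linarith [nrm_nonneg (A.drop 1)]
  have hA2 : nrm (A.drop 2) ≤ 3.25 * (uro p * s) := by linarith
  obtain ⟨f1, f2, -⟩ := renormalize_spec hp (merge_ne_nil (x := A) (y := G) hA0)
    (isFloat_merge a1 G1.isFloat) (K := 4) (B := 3.25 * (uro p * s) + 0.7 * uro p * lead G) hN'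
    (by norm_num) le_rfl (by positivity)
    (by
      have e1 := mul_le_mul_of_nonneg_left (add_le_add (hlA.trans hAN) hGN) hu.le
      linarith)
    (fun c hc => by
      have e1 := capSum_le hc 2 A
      have e2 := capSum_le hc 2 G
      rw [capSum_merge]
      push_cast at e1 e2
      linarith)
    (m := t - 1) (by lia) rfl
  rw [sum_merge] at f2
  rw [← hz] at f2
  refine ⟨by rw [hz]; exact isFloat_lead f1, ?_⟩
  have hnN : nrm A + nrm G ≤ 1.031 * s + 1.094 * Q := by
    rw [hnA, Gn]
    linarith [a2'.2]
  have hunN := mul_le_mul_of_nonneg_left hnN hu.le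
  have huGQ := mul_le_mul_of_nonneg_left hGQ hu.le
  have huQf := mul_le_mul_of_nonneg_left hQf hu.le
  have f2' := abs_le.1 f2
  rw [hy, abs_le]
  constructor <;> linarith [f2'.1, f2'.2, a3'.1, a3'.2]

lemma absE_spec {p t : ℕ} {x : List ℝ} (hx : IsFPE p t x) :
    IsFPE p t (absE x) ∧ (absE x).sum = |x.sum| := by
  unfold absE
  split_ifs with h
  · exact ⟨hx.neg, by rw [sum_neg, abs_of_neg h]⟩
  · exact ⟨hx, (abs_of_nonneg (not_lt.1 h)).symm⟩

/-- The leading term of the expansion under the logarithm. -/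
lemma lead_artanhArg_spec {p t β : ℕ} (hp : 8 ≤ p) (hβ : β + 2 ≤ p) (hβ2 : p + 4 ≤ 2 * β)
    (ht : 2 ≤ t) (htp : t < p) {x : List ℝ} (hx : IsFPE p t x) (h0 : x.sum ≠ 0) (h1 : |x.sum| < 1) :
    let z := lead (artanhArg p β x)
    let y := (1 + |x.sum|) / (1 - |x.sum|)
    IsFloat p z ∧ |z - y| ≤ 15 * uro p * y := by
  obtain ⟨hf, hs⟩ := absE_spec hx
  have h0' : 0 < (absE x).sum := by rw [hs]; exact abs_pos.2 h0
  intro z y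
  have hz : z = lead (artanhArg p β x) := rfl
  unfold artanhArg at hz
  simp only [hx.length_eq] at hz
  simp only [y, ← hs]
  rw [hz]
  split_ifs with h
  · exact lead_one_add_add_div_spec hp hβ hβ2 ht htp hf h0' (by rw [hs]; exact h.le)
  · exact lead_one_add_div_spec hp hβ hβ2 ht htp hf h0' (by rw [hs]; exact h1)

/-- A relative error of `15 u` changes half the logarithm by at most `8 u`. -/
lemma abs_half_log_sub_le {u y z : ℝ} (hu : 0 < u) (hu1 : u ≤ 1 / 256) (hy : 0 < y)
    (h : |z - y| ≤ 15 * u * y) : 0 < z ∧ |1 / 2 * Real.log z - 1 / 2 * Real.log y| ≤ 8 * u := by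
  have h' := abs_le.1 h
  have huy := mul_le_mul_of_nonneg_right hu1 hy.le
  have huy' := mul_pos hu hy
  have hz : 0 < z := by linarith
  refine ⟨hz, ?_⟩
  have e1 := Real.log_le_sub_one_of_pos (div_pos hz hy)
  have e2 := Real.log_le_sub_one_of_pos (div_pos hy hz)
  rw [Real.log_div hz.ne' hy.ne'] at e1
  rw [Real.log_div hy.ne' hz.ne'] at e2
  have e3 : z / y - 1 ≤ 16 * u := by
    rw [sub_le_iff_le_add, div_le_iff₀ hy]
    linarith
  have e4 : y / z - 1 ≤ 16 * u := by
    rw [sub_le_iff_le_add, div_le_iff₀ hz]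
    have := mul_le_mul_of_nonneg_left huy hu.le
    have := mul_le_mul_of_nonneg_left h'.1 hu.le
    linarith
  rw [abs_le]
  constructor <;> linarith

/-- The inverse hyperbolic tangent is odd. -/
lemma artanh_abs {X : ℝ} (h : |X| < 1) :
    Real.sign X * (1 / 2 * Real.log ((1 + |X|) / (1 - |X|))) = Real.artanh X := by
  have hX := abs_lt.1 h
  rw [Real.artanh_eq_half_log ⟨hX.1.le, hX.2.le⟩]
  rcases lt_trichotomy X 0 with h0 | h0 | h0
  · have e : (1 + -X) / (1 - -X) = ((1 + X) / (1 - X))⁻¹ := by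
      rw [inv_div, sub_neg_eq_add, ← sub_eq_add_neg]
    rw [Real.sign_of_neg h0, abs_of_neg h0, e, Real.log_inv]
    ring
  · simp [h0]
  · rw [Real.sign_of_pos h0, abs_of_pos h0, one_mul]

end FPE

end

theorem theorem4 (b t β : ℕ) (ht : 1 ≤ t) (hbt : t < b)
    (hcarry : β + 2 ≤ b) (hbin : b + 4 ≤ 2 * β)
    (x : List ℝ) (hx : FPE.IsFPE b t x)
    (hrange : x.sum ∈ Set.Icc (-1 + FPE.machEps b ^ (t - 1)) (1 - FPE.machEps b ^ (t - 1)))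
    (L : ℝ → ℝ) (η : ℝ)
    (hL : ∀ v : ℝ, FPE.IsFloat b v → 1 / 2 ≤ v → v ≤ 4 / FPE.machEps b ^ (t - 1) →
      |L v - Real.log v| ≤ η) :
    (∃ y : ℝ, FPE.artanh L b β x = some (y : EReal) ∧
      |y - Real.artanh x.sum| ≤ 4 * FPE.machEps b + η / 2) ∧
    (1 / 2 ≤ |x.sum| →
      0 < FPE.lead (FPE.artanhArg b β x) ∧
      |1 / 2 * Real.sign x.sum * Real.log (FPE.lead (FPE.artanhArg b β x))
        - Real.artanh x.sum| ≤ 4 * FPE.machEps b) := by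
  have hp : 8 ≤ b := by lia
  have hu := FPE.uro_pos b
  have hu1 := FPE.uro_le b hp
  have heps : FPE.machEps b = 2 * FPE.uro b := by
    rw [FPE.machEps, sub_eq_add_neg, FPE.two_zpow_add, FPE.uro]; norm_num
  set δ := FPE.machEps b ^ (t - 1) with hδ
  have hδ0 : 0 < δ := by rw [hδ, heps]; positivity
  have hδ1 : δ ≤ 1 := pow_le_one₀ (by rw [heps]; positivity) (by rw [heps]; linarith)
  have hX : |x.sum| ≤ 1 - δ := abs_le.2 ⟨by linarith [hrange.1], hrange.2⟩
  have hX1 : |x.sum| < 1 := by linarith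
  have hη : 0 ≤ η := (abs_nonneg _).trans (hL 1 (FPE.isFloat_one (by lia)) (by norm_num)
    (by rw [le_div_iff₀ hδ0]; linarith))
  have hroutine : FPE.artanh L b β x = some ((1 / 2 * Real.sign x.sum *
      L (FPE.lead (FPE.artanhArg b β x)) : ℝ) : EReal) := by
    rw [FPE.artanh, if_neg (by linarith), if_neg hX1.ne]
  rcases eq_or_ne x.sum 0 with h0 | h0
  · -- The sign of zero is zero, and so is the result.
    refine ⟨⟨_, hroutine, ?_⟩, fun h => ?_⟩
    · rw [h0, Real.sign_zero, Real.artanh_zero, heps]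
      simp only [mul_zero, zero_mul, sub_zero, abs_zero]
      positivity
    · rw [h0, abs_zero] at h
      norm_num at h
  · -- With a single term, the range of `x` is the point `0`.
    have ht2 : 2 ≤ t := by
      by_contra h
      have : t = 1 := by lia
      rw [hδ, this] at hX
      simp only [Nat.sub_self, pow_zero, sub_self] at hX
      exact h0 (abs_eq_zero.1 (le_antisymm hX (abs_nonneg _)))
    obtain ⟨z1, z2⟩ := FPE.lead_artanhArg_spec hp hcarry hbin ht2 hbt hx h0 hX1
    set z := FPE.lead (FPE.artanhArg b β x)
    set y := (1 + |x.sum|) / (1 - |x.sum|) with hy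
    have hy1 : 1 ≤ y := by
      rw [hy, le_div_iff₀ (by linarith)]
      linarith [abs_nonneg x.sum]
    have hy2 : y ≤ 2 / δ := by
      rw [hy]
      exact div_le_div₀ (by norm_num) (by linarith) hδ0 (by linarith)
    obtain ⟨z3, z4⟩ := FPE.abs_half_log_sub_le hu hu1 (by linarith) z2
    have hsgn : |Real.sign x.sum| = 1 := by
      rcases Real.sign_apply_eq_of_ne_zero x.sum h0 with h | h <;> rw [h] <;> norm_num
    have hlog : |1 / 2 * Real.sign x.sum * Real.log z - Real.artanh x.sum| ≤ 8 * FPE.uro b := by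
      rw [← FPE.artanh_abs hX1, show 1 / 2 * Real.sign x.sum * Real.log z -
        Real.sign x.sum * (1 / 2 * Real.log y) =
        Real.sign x.sum * (1 / 2 * Real.log z - 1 / 2 * Real.log y) by ring, abs_mul, hsgn, one_mul]
      exact z4
    have huy := mul_le_mul_of_nonneg_right hu1 (show 0 ≤ y by linarith)
    have z2' := abs_le.1 z2
    have hLz := hL z z1 (by linarith) (by
      have : 4 / δ = 2 * (2 / δ) := by ring
      linarith)
    refine ⟨⟨_, hroutine, ?_⟩, fun _ => ⟨z3, by rw [heps]; linarith⟩⟩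
    have e : 1 / 2 * Real.sign x.sum * L z - Real.artanh x.sum =
        1 / 2 * Real.sign x.sum * (L z - Real.log z) +
        (1 / 2 * Real.sign x.sum * Real.log z - Real.artanh x.sum) := by ring
    rw [e, heps]
    refine (abs_add_le _ _).trans ?_
    rw [abs_mul, abs_mul, hsgn]
    norm_num
    linarith
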